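/- Let $d\ge 1$, let $\Omega=C_0([0,1];\mathbb R^d)$ be the space of continuous paths $\gamma:[0,1]\to\mathbb R^d$ with $\gamma(0)=0$, and let $\nu$ be the Wiener measure on $\Omega$. Let $H_1\equiv 1$ and, for $m\ge 0$, $1\le k\le 2^m$, let $H_{2^m+k}$ equal $2^{m/2}$ on $[\frac{k-1}{2^m},\frac{2k-1}{2^{m+1}})$, $-2^{m/2}$ on $[\frac{2k-1}{2^{m+1}},\frac{k}{2^m})$ and $0$ elsewhere (Haar functions). Put $g_{d(r-1)+j}=H_r e_j$ for $r\ge1$, $1\le j\le d$, where $e_1,\dots,e_d$ is the standard basis of $\mathbb R^d$, and let $S_i(s)=\int_0^s g_i(u)\,du$ and $\mathbb S_i(\gamma)=\int_0^1\langle g_i(s),d\gamma_s\rangle$. Let $0<\lambda_1\le\lambda_2\le\cdots$. Let $f\in C_b^2(\mathbb R^d;\mathbb R)$, $b=\nabla f$, and $$\varphi(\gamma)=\exp\Bigl\{\int_0^1\langle b(\gamma_s),d\gamma_s\rangle-\tfrac12\int_0^1\|b(\gamma_s)\|^2\,ds\Bigr\},$$ the first integral being an Itô integral. Let $Y$ be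 the set of functions $F(\gamma)=g(\gamma(s_1),\dots,\gamma(s_k))$, where $k\ge 1$, $0<s_1<\dots<s_k=1$ are dyadic and $g\in C^\infty((\mathbb R^d)^k)$ has, together with all its derivatives, at most polynomial growth. For $F\in Y$ let $\partial_{S_i}F(\gamma)=\frac{d}{dt}\big|_{t=0}F(\gamma+tS_i)$, and put $$\mathcal E(F,G)=\sum_{i=1}^\infty\lambda_i\int\partial_{S_i}F\,\partial_{S_i}G\;\varphi\,d\nu,\qquad F,G\in Y$$ (the sum has only finitely many nonzero terms). Then the following holds. (i) The stochastic integrals above exist, and for every $i$ the derivative $\partial_{S_i}\varphi=\lim_{t\to0}t^{-1}(\varphi(\cdot+tS_i)-\varphi)$ exists as a limit in $L^2(\nu)$. (ii) $(\mathcal E,Y)$ is closable on $L^2(\varphi\nu)$. Let $(\mathcal E,D_Y(\mathcal E))$ be its closure, and let $\mathbf A$ be the generator of the closure: $F\in D(\mathbf A)$ if and only if $F\in D_Y(\mathcal E)$ and there is an element $\mathbf AF\in L^2(\varphi\nu)$ with $\mathcal E(F,G)=\int(-\mathbf AF)\,G\,\varphi\,d\nu$ for all $G\in D_Y(\mathcal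 E)$. (iii) $Y\subset D(\mathbf A)$, and for every $F\in Y$, $\varphi\nu$-almost everywhere, $$\mathbf AF=\sum_{i=1}^\infty\lambda_i\Bigl[\partial_{S_i}^2F+\frac{\partial_{S_i}\varphi\;\partial_{S_i}F}{\varphi}-\mathbb S_i\,\partial_{S_i}F\Bigr].$$ -/

import Mathlib

open MeasureTheory ProbabilityTheory Filter Topology
open scoped ENNReal

noncomputable section

namespace WienerForm

/-- `ℝ^d` with its Euclidean structure. -/
abbrev E (d : ℕ) : Type := EuclideanSpace ℝ (Fin d)

/-- The path space `Ω = C₀([0,1]; ℝ^d)` of continuous paths starting at `0`, with the supremum norm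
and pointwise linear operations. -/
def PathSpace (d : ℕ) : Submodule ℝ C(unitInterval, E d) where
  carrier := {γ | γ 0 = 0}
  add_mem' := by
    intro a b ha hb
    change a 0 = 0 at ha
    change b 0 = 0 at hb
    change a 0 + b 0 = 0
    rw [ha, hb, add_zero]
  zero_mem' := rfl
  smul_mem' := by
    intro c a ha
    change a 0 = 0 at ha
    change c • a 0 = 0
    rw [ha, smul_zero]

/-- The Borel `σ`-algebra of the supremum norm. -/
instance (d : ℕ) : MeasurableSpace (PathSpace d) := borel _

instance (d : ℕ) : BorelSpace (PathSpace d) := ⟨rfl⟩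

/-- The value `γ(s)`, for a real time `s` (only times in `[0,1]` are ever used; the path is
continued by constants outside). -/
def pathAt {d : ℕ} (γ : PathSpace d) (s : ℝ) : E d :=
  (γ : C(unitInterval, E d)) (Set.projIcc 0 1 zero_le_one s)

/-- `ν` is the Wiener measure on `Ω`: under `ν` the coordinate process is a standard
`d`-dimensional Brownian motion, i.e. it has independent increments and `γ(t) - γ(s)` is
`N(0, (t - s) I_d)`-distributed for `s ≤ t`. (It starts at `0` and is continuous by definition
of `Ω`.) -/
structure IsWienerMeasure {d : ℕ} (ν : Measure (PathSpace d)) : Prop where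
  indep : HasIndepIncrements
    (fun (t : unitInterval) (γ : PathSpace d) => (γ : C(unitInterval, E d)) t) ν
  law : ∀ s t : unitInterval, s ≤ t →
    HasLaw (fun γ : PathSpace d => (γ : C(unitInterval, E d)) t - (γ : C(unitInterval, E d)) s)
      (multivariateGaussian 0 (((t : ℝ) - (s : ℝ)) • (1 : Matrix (Fin d) (Fin d) ℝ))) ν

/-! ### Haar and Schauder functions

All sequences are indexed from `0`, so the index `n` here is the index `n + 1` of the usual
enumeration starting at `1`. -/

/-- The Haar functions. `haar 0 = 1`, and for `n = 2^m + l` with `0 ≤ l < 2^m`, `haar n` is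
`2^{m/2}` on `[l/2^m, (2l+1)/2^{m+1})`, `-2^{m/2}` on `[(2l+1)/2^{m+1}, (l+1)/2^m)` and `0`
elsewhere. -/
def haar (n : ℕ) (t : ℝ) : ℝ :=
  if n = 0 then 1
  else
    let m : ℕ := Nat.log 2 n
    let l : ℕ := n - 2 ^ m
    if (l : ℝ) / 2 ^ m ≤ t ∧ t < (2 * (l : ℝ) + 1) / 2 ^ (m + 1) then Real.sqrt (2 ^ m)
    else if (2 * (l : ℝ) + 1) / 2 ^ (m + 1) ≤ t ∧ t < ((l : ℝ) + 1) / 2 ^ m then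
      -Real.sqrt (2 ^ m)
    else 0

/-- `g_{d r + j} = H_r e_j` for `r ≥ 0` and `0 ≤ j < d`. -/
def haarVec (d : ℕ) [NeZero d] (n : ℕ) (t : ℝ) : E d :=
  haar (n / d) t • EuclideanSpace.single (Fin.ofNat d n) (1 : ℝ)

theorem measurable_haar (n : ℕ) : Measurable (haar n) := by
  unfold haar
  refine Measurable.ite (by simp) measurable_const ?_
  refine Measurable.ite ?_ measurable_const (Measurable.ite ?_ measurable_const measurable_const)
  · exact measurableSet_Ico
  · exact measurableSet_Ico

theorem norm_haarVec_le (d : ℕ) [NeZero d] (n : ℕ) (t : ℝ) :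
    ‖haarVec d n t‖ ≤ 1 + Real.sqrt (2 ^ Nat.log 2 (n / d)) := by
  have h := Real.sqrt_nonneg ((2 : ℝ) ^ Nat.log 2 (n / d))
  simp only [haarVec, haar, norm_smul, PiLp.norm_single, norm_one, mul_one,
    Real.norm_eq_abs]
  split_ifs <;> simp [abs_of_nonneg h]
  positivity

theorem intervalIntegrable_haarVec (d : ℕ) [NeZero d] (n : ℕ) (a b : ℝ) :
    IntervalIntegrable (haarVec d n) volume a b := by
  have hm : Measurable (haarVec d n) := (measurable_haar _).smul_const _
  exact (intervalIntegrable_const (c := 1 + Real.sqrt (2 ^ Nat.log 2 (n / d)))).mono_fun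
    hm.aestronglyMeasurable (Eventually.of_forall fun t =>
      (norm_haarVec_le d n t).trans (le_abs_self _))

/-- The Schauder functions `S_n(s) = ∫₀ˢ g_n(u) du`, as elements of `Ω`. -/
def schauder (d : ℕ) [NeZero d] (n : ℕ) : PathSpace d :=
  ⟨⟨fun s => ∫ u in (0 : ℝ)..(s : ℝ), haarVec d n u,
    (intervalIntegral.continuous_primitive (intervalIntegrable_haarVec d n) 0).comp
      continuous_subtype_val⟩, intervalIntegral.integral_same⟩

/-! ### Stochastic integrals -/

/-- Left-point Riemann sums `∑_k ⟨u(t_k), γ(t_{k+1}) - γ(t_k)⟩` along the dyadic partition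
`t_k = k / 2^n` of `[0,1]`. -/
def itoSum {d : ℕ} (u : ℝ → PathSpace d → E d) (n : ℕ) (γ : PathSpace d) : ℝ :=
  ∑ k ∈ Finset.range (2 ^ n),
    inner ℝ (u ((k : ℝ) / 2 ^ n) γ) (pathAt γ (((k : ℝ) + 1) / 2 ^ n) - pathAt γ ((k : ℝ) / 2 ^ n))

/-- `J` is (a version of) the Itô integral `∫₀¹ ⟨u_s, dγ_s⟩`: the `L²(ν)`-limit of the left-point
Riemann sums. This agrees with the Itô integral for bounded adapted integrands that are continuous
in time, and for the deterministic Haar functions, which are right-continuous step functions with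
dyadic jumps; it is only used for these. -/
def HasItoIntegral {d : ℕ} (ν : Measure (PathSpace d)) (u : ℝ → PathSpace d → E d)
    (J : PathSpace d → ℝ) : Prop :=
  Measurable J ∧ MemLp J 2 ν ∧
    Tendsto (fun n => eLpNorm (fun γ => itoSum u n γ - J γ) 2 ν) atTop (𝓝 0)

open Classical in
/-- The Itô integral `∫₀¹ ⟨u_s, dγ_s⟩` (determined up to `ν`-null sets). -/
def itoIntegral {d : ℕ} (ν : Measure (PathSpace d)) (u : ℝ → PathSpace d → E d) :
    PathSpace d → ℝ :=
  if h : ∃ J, HasItoIntegral ν u J then h.choose else 0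

/-- `𝕊_i(γ) = ∫₀¹ ⟨g_i(s), dγ_s⟩`. -/
def wienerCoord {d : ℕ} [NeZero d] (ν : Measure (PathSpace d)) (i : ℕ) : PathSpace d → ℝ :=
  itoIntegral ν (fun s _ => haarVec d i s)

/-- `f ∈ C_b²`: twice continuously differentiable, with `f` and its derivatives up to order two
bounded. -/
def IsCb2 {d : ℕ} (f : E d → ℝ) : Prop :=
  ContDiff ℝ 2 f ∧ ∀ k : ℕ, k ≤ 2 → ∃ C : ℝ, ∀ x, ‖iteratedFDeriv ℝ k f x‖ ≤ C

/-- `φ(γ) = exp { ∫₀¹ ⟨b(γ_s), dγ_s⟩ - ½ ∫₀¹ ‖b(γ_s)‖² ds }`. -/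
def girsanovDensity {d : ℕ} (ν : Measure (PathSpace d)) (b : E d → E d) (γ : PathSpace d) : ℝ :=
  Real.exp (itoIntegral ν (fun s η => b (pathAt η s)) γ
    - (1 / 2) * ∫ s in (0 : ℝ)..1, ‖b (pathAt γ s)‖ ^ 2)

/-- The measure `φ ν`. -/
def weightedMeasure {d : ℕ} (ν : Measure (PathSpace d)) (φ : PathSpace d → ℝ) :
    Measure (PathSpace d) :=
  ν.withDensity (fun γ => ENNReal.ofReal (φ γ))

/-! ### Directional derivatives -/

/-- `∂_h F(γ) = d/dt F(γ + t h)` at `t = 0`. -/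
def dirDeriv {d : ℕ} (h : PathSpace d) (F : PathSpace d → ℝ) (γ : PathSpace d) : ℝ :=
  deriv (fun t : ℝ => F (γ + t • h)) 0

/-- `ψ` is the directional derivative of the random variable `Φ` in direction `h`, as a limit of
difference quotients in `L²(ν)`. -/
def HasL2DirDeriv {d : ℕ} (ν : Measure (PathSpace d)) (h : PathSpace d) (Φ ψ : PathSpace d → ℝ) :
    Prop :=
  MemLp ψ 2 ν ∧
    Tendsto (fun t : ℝ => eLpNorm (fun γ => t⁻¹ * (Φ (γ + t • h) - Φ γ) - ψ γ) 2 ν)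
      (𝓝[≠] 0) (𝓝 0)

open Classical in
/-- The derivative `∂_h Φ` of a random variable in the `L²(ν)` sense (determined up to `ν`-null
sets). -/
def l2DirDeriv {d : ℕ} (ν : Measure (PathSpace d)) (h : PathSpace d) (Φ : PathSpace d → ℝ) :
    PathSpace d → ℝ :=
  if ex : ∃ ψ, HasL2DirDeriv ν h Φ ψ then ex.choose else 0

/-! ### Cylindrical functions and the form -/

/-- The set `Y` of cylindrical functions `F(γ) = f(γ(s_1), …, γ(s_k))` with dyadic times
`0 < s_1 < … < s_k = 1`, where `f` is smooth and all its derivatives, including `f` itself, have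
at most polynomial growth. -/
def cylindrical (d : ℕ) : Set (PathSpace d → ℝ) :=
  {F | ∃ (k : ℕ) (s : Fin (k + 1) → unitInterval) (f : (Fin (k + 1) → E d) → ℝ),
    StrictMono s ∧ 0 < s 0 ∧ s (Fin.last k) = 1 ∧
    (∃ n : ℕ, ∀ j, ∃ l : ℕ, (s j : ℝ) = (l : ℝ) / 2 ^ n) ∧
    f.HasTemperateGrowth ∧
    ∀ γ : PathSpace d, F γ = f (fun j => (γ : C(unitInterval, E d)) (s j))}

/-- `ℰ(F, G) = ∑_i λ_i ∫ ∂_{S_i} F ∂_{S_i} G dμ`, where `μ = φ ν`, for `F, G ∈ Y` (for which the sum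
has only finitely many nonzero terms). -/
def form {d : ℕ} [NeZero d] (lam : ℕ → ℝ) (μ : Measure (PathSpace d)) (F G : PathSpace d → ℝ) : ℝ :=
  ∑' i, lam i * ∫ γ, dirDeriv (schauder d i) F γ * dirDeriv (schauder d i) G γ ∂μ

/-- `F_n ∈ Y` converges to `u` in `L²(μ)` and is an `ℰ`-Cauchy sequence. -/
def IsFormApprox {d : ℕ} [NeZero d] (lam : ℕ → ℝ) (μ : Measure (PathSpace d))
    (F : ℕ → PathSpace d → ℝ) (u : PathSpace d → ℝ) : Prop :=
  (∀ n, F n ∈ cylindrical d) ∧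
  Tendsto (fun n => eLpNorm (F n - u) 2 μ) atTop (𝓝 0) ∧
  Tendsto (fun p : ℕ × ℕ => form lam μ (F p.1 - F p.2) (F p.1 - F p.2)) (atTop ×ˢ atTop) (𝓝 0)

/-- `(ℰ, Y)` is closable on `L²(μ)`. -/
def IsClosableForm {d : ℕ} [NeZero d] (lam : ℕ → ℝ) (μ : Measure (PathSpace d)) : Prop :=
  ∀ F : ℕ → PathSpace d → ℝ, IsFormApprox lam μ F 0 →
    Tendsto (fun n => form lam μ (F n) (F n)) atTop (𝓝 0)

/-- The domain `D_Y(ℰ)` of the closure of `(ℰ, Y)` on `L²(μ)`. -/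
def closureDomain {d : ℕ} [NeZero d] (lam : ℕ → ℝ) (μ : Measure (PathSpace d)) :
    Set (PathSpace d → ℝ) :=
  {u | MemLp u 2 μ ∧ ∃ F, IsFormApprox lam μ F u}

/-- `e` is the value `ℰ(u, v)` of the closure of `(ℰ, Y)`, for `u, v ∈ D_Y(ℰ)`: it is the limit of
`ℰ(F_n, G_n)` along all approximating sequences of `u` and `v`. -/
def HasFormValue {d : ℕ} [NeZero d] (lam : ℕ → ℝ) (μ : Measure (PathSpace d))
    (u v : PathSpace d → ℝ) (e : ℝ) : Prop :=
  u ∈ closureDomain lam μ ∧ v ∈ closureDomain lam μ ∧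
  ∀ F G, IsFormApprox lam μ F u → IsFormApprox lam μ G v →
    Tendsto (fun n => form lam μ (F n) (G n)) atTop (𝓝 e)

/-- `w ∈ L²(μ)` satisfies `ℰ(u, v) = ∫ (-w) v dμ` for all `v ∈ D_Y(ℰ)`. -/
def IsGeneratorValue {d : ℕ} [NeZero d] (lam : ℕ → ℝ) (μ : Measure (PathSpace d))
    (u w : PathSpace d → ℝ) : Prop :=
  MemLp w 2 μ ∧ ∀ v ∈ closureDomain lam μ, HasFormValue lam μ u v (∫ γ, (-w γ) * v γ ∂μ)

/-- The domain `D(𝐀)` of the generator of the closure of `(ℰ, Y)` on `L²(μ)`. -/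
def generatorDomain {d : ℕ} [NeZero d] (lam : ℕ → ℝ) (μ : Measure (PathSpace d)) :
    Set (PathSpace d → ℝ) :=
  {u | u ∈ closureDomain lam μ ∧ ∃ w, IsGeneratorValue lam μ u w}

open Classical in
/-- The generator `𝐀` of the closure of `(ℰ, Y)` on `L²(μ)` (its values are determined up to
`μ`-null sets). -/
def generator {d : ℕ} [NeZero d] (lam : ℕ → ℝ) (μ : Measure (PathSpace d))
    (u : PathSpace d → ℝ) : PathSpace d → ℝ :=
  if h : u ∈ generatorDomain lam μ then h.2.choose else 0

end WienerForm

end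

noncomputable section

namespace WienerForm

variable {d : ℕ}

/-! ### The path space -/

/-! The formula for the generator is an integration by parts. Suppose a weight `φ > 0` has moments
of every order, is `L²`-differentiable along each `S_i`, and has logarithmic derivatives `ψ_i = ∂_i
φ / φ` with moments of every order (`IsWeight`). Gaussian integration by parts, `∫ (∂_i K · φ + K ·
∂_i φ) dν = ∫ K φ 𝕊_i dν`, with `K = ∂_i F · G` turns `ℰ(F, G)` into `∫ (-𝐀F) G φ dν`, where `𝐀F` is
the claimed expression and lies in `L²(φν)` (`form_eq_integral`). The sum is finite because Schauder
functions of high level vanish at all times on which `F` depends (`gridEval_schauder`). Hence for `F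
∈ Y` the functional `ℰ(F, ·)` is continuous for `L²(φν)` convergence alone (`tendsto_form`). With
the Cauchy–Schwarz inequality this yields closability and `Y ⊂ D(𝐀)`; `𝐀F` is unique because bounded
cylindrical functions are total (`ae_eq_zero_of_integral_mul_eq_zero`).

Integration by parts is the derivative at `t = 0` of the Cameron–Martin formula
(`map_add_schauder`). The latter is one-dimensional: a path is its residual plus `𝕊_i(γ) S_i`,
residual and coordinate are jointly Gaussian and uncorrelated, hence independent, and the shift by
`t S_i` only translates a standard normal variable.

It remains to see that the Girsanov density is such a weight. The difference `log φ(γ + t S_i) - log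
φ(γ)` equals `t D_t` exactly, where `D_t` consists of an Itô integral of an averaged derivative of
`b`, a drift term and a difference quotient of the time integral (`logDensity_shift`). By the Itô
isometry and dominated convergence `D_t → D_0` in `L²`. Bounded integrands give `E exp(J) ≤ exp(K² /
2)`, thus exponential moments uniform in `t`, and these allow passing from the logarithm to `φ`
itself (`exists_hasL2DirDeriv`).

Itô integrals are `L²` limits of dyadic Riemann sums. Their isometry and exponential bound are
proved for the sums, by integrating out one increment at a time given the past. -/

theorem isClosed_pathSpace (d : ℕ) : IsClosed (PathSpace d : Set C(unitInterval, E d)) :=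
  isClosed_eq (continuous_eval_const 0) continuous_const

instance (d : ℕ) : CompleteSpace (PathSpace d) :=
  (isClosed_pathSpace d).completeSpace_coe

instance (d : ℕ) : PolishSpace (PathSpace d) := inferInstance

instance (d : ℕ) : ContinuousAdd (PathSpace d) :=
  (PathSpace d).toAddSubmonoid.continuousAdd

theorem continuous_uncurry_pathAt :
    Continuous fun p : ℝ × PathSpace d => pathAt p.2 p.1 := by
  unfold pathAt
  exact (continuous_subtype_val.comp continuous_snd).eval
    (continuous_projIcc.comp continuous_fst)

theorem continuous_pathAt (γ : PathSpace d) : Continuous (pathAt γ) :=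
  continuous_uncurry_pathAt.comp (continuous_id.prodMk continuous_const)

theorem continuous_pathAt_left (s : ℝ) : Continuous fun γ : PathSpace d => pathAt γ s :=
  continuous_uncurry_pathAt.comp (continuous_const.prodMk continuous_id)

theorem measurable_pathAt (s : ℝ) : Measurable fun γ : PathSpace d => pathAt γ s :=
  (continuous_pathAt_left s).measurable

@[simp] theorem pathAt_add (γ η : PathSpace d) (s : ℝ) :
    pathAt (γ + η) s = pathAt γ s + pathAt η s := rfl

@[simp] theorem pathAt_smul (c : ℝ) (γ : PathSpace d) (s : ℝ) :
    pathAt (c • γ) s = c • pathAt γ s := rfl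

theorem pathAt_coe (γ : PathSpace d) (s : unitInterval) :
    pathAt γ (s : ℝ) = (γ : C(unitInterval, E d)) s := by
  simp [pathAt]

theorem continuous_add_smul (h : PathSpace d) :
    Continuous fun p : PathSpace d × ℝ => p.1 + p.2 • h :=
  continuous_fst.add (continuous_snd.smul continuous_const)

theorem measurable_shift (h : PathSpace d) (t : ℝ) : Measurable fun γ => γ + t • h :=
  ((continuous_add_smul h).comp (continuous_id.prodMk continuous_const)).measurable

theorem path_ext {γ η : PathSpace d} (h : ∀ s, pathAt γ s = pathAt η s) : γ = η :=
  Subtype.ext (ContinuousMap.ext fun s => by rw [← pathAt_coe, ← pathAt_coe, h])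

theorem shift_shift (γ h : PathSpace d) (a b : ℝ) : γ + a • h + b • h = γ + (a + b) • h :=
  path_ext fun s => by simp only [pathAt_add, pathAt_smul]; module

@[simp] theorem shift_zero (γ h : PathSpace d) : γ + (0 : ℝ) • h = γ :=
  path_ext fun s => by simp only [pathAt_add, pathAt_smul]; module

theorem path_zero (γ : PathSpace d) : (γ : C(unitInterval, E d)) 0 = 0 := γ.2

@[simp] theorem pathAt_zero (γ : PathSpace d) : pathAt γ 0 = 0 := by
  have := pathAt_coe γ 0
  rw [path_zero] at this
  simpa using this

theorem norm_pathAt_le (γ : PathSpace d) (s : ℝ) : ‖pathAt γ s‖ ≤ ‖γ‖ :=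
  (γ : C(unitInterval, E d)).norm_coe_le_norm _

/-- The `σ`-algebra generated by the path up to time `s`. -/
@[reducible]
def past (d : ℕ) (s : ℝ) : MeasurableSpace (PathSpace d) :=
  MeasurableSpace.comap (fun γ (r : Set.Iic s) => pathAt γ r) MeasurableSpace.pi

theorem past_le (s : ℝ) : past d s ≤ (inferInstance : MeasurableSpace (PathSpace d)) :=
  (measurable_pi_lambda (fun (γ : PathSpace d) (r : Set.Iic s) => pathAt γ r)
    fun r => measurable_pathAt r.1).comap_le

theorem measurable_past_pathAt {r s : ℝ} (h : r ≤ s) :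
    Measurable[past d s] fun γ : PathSpace d => pathAt γ r :=
  (measurable_pi_apply (⟨r, h⟩ : Set.Iic s)).comp
    (comap_measurable (fun (γ : PathSpace d) (r : Set.Iic s) => pathAt γ r))

theorem past_mono {r s : ℝ} (h : r ≤ s) : past d r ≤ past d s := by
  rw [past, ← measurable_iff_comap_le]
  exact @measurable_pi_lambda _ _ _ (past d s) _ _ fun q =>
    measurable_past_pathAt (q.2.trans h)

/-! ### Gaussian increments -/

/-- The centred Gaussian law with covariance `δ` times the identity. -/
abbrev incrLaw (d : ℕ) (δ : ℝ) : Measure (E d) :=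
  multivariateGaussian 0 (δ • (1 : Matrix (Fin d) (Fin d) ℝ))

theorem posSemidef_smul_one {δ : ℝ} (hδ : 0 ≤ δ) :
    (δ • (1 : Matrix (Fin d) (Fin d) ℝ)).PosSemidef :=
  Matrix.PosSemidef.one.smul hδ

theorem covarianceBilin_incrLaw {δ : ℝ} (hδ : 0 ≤ δ) (x y : E d) :
    covarianceBilin (incrLaw d δ) x y = δ * inner ℝ x y := by
  rw [covarianceBilin_multivariateGaussian (posSemidef_smul_one hδ)]
  simp [Matrix.smul_mulVec, PiLp.inner_apply, dotProduct, Finset.mul_sum, mul_left_comm, mul_comm]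

theorem map_inner_incrLaw {δ : ℝ} (hδ : 0 ≤ δ) (v : E d) :
    (incrLaw d δ).map (fun x => inner ℝ v x) = gaussianReal 0 (δ * ‖v‖ ^ 2).toNNReal := by
  have h := IsGaussian.map_eq_gaussianReal (μ := incrLaw d δ) (innerSL ℝ v)
  have h1 : ∫ x, (innerSL ℝ v) x ∂(incrLaw d δ) = 0 := by
    rw [ContinuousLinearMap.integral_comp_comm _ IsGaussian.integrable_fun_id]
    simp
  have h2 : Var[innerSL ℝ v; incrLaw d δ] = δ * ‖v‖ ^ 2 := by
    rw [← real_inner_self_eq_norm_sq, ← covarianceBilin_incrLaw hδ,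
      covarianceBilin_self IsGaussian.memLp_two_id]
    rfl
  rw [h1, h2] at h
  exact h

theorem lintegral_exp_inner_incrLaw {δ : ℝ} (hδ : 0 ≤ δ) (v : E d) :
    ∫⁻ x, ENNReal.ofReal (Real.exp (inner ℝ v x)) ∂(incrLaw d δ) =
      ENNReal.ofReal (Real.exp (δ * ‖v‖ ^ 2 / 2)) := by
  have hm := map_inner_incrLaw hδ v
  have h := mgf_gaussianReal hm 1
  have hi : Integrable (fun x => Real.exp (inner ℝ v x)) (incrLaw d δ) := by
    have : Integrable (fun y => Real.exp (1 * y)) ((incrLaw d δ).map (fun x => inner ℝ v x)) := by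
      rw [hm]; exact integrable_exp_mul_gaussianReal 1
    simpa using! this.comp_measurable (by fun_prop)
  rw [← ofReal_integral_eq_lintegral_ofReal hi (.of_forall fun _ => (Real.exp_pos _).le)]
  simp only [mgf, one_mul] at h
  rw [h, Real.coe_toNNReal _ (by positivity)]
  simp

theorem lintegral_inner_sq_incrLaw {δ : ℝ} (hδ : 0 ≤ δ) (v : E d) :
    ∫⁻ x, ENNReal.ofReal (inner ℝ v x ^ 2) ∂(incrLaw d δ) = ENNReal.ofReal (δ * ‖v‖ ^ 2) := by
  have hm := map_inner_incrLaw hδ v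
  have hL : MemLp (fun y : ℝ => y) 2 (gaussianReal 0 (δ * ‖v‖ ^ 2).toNNReal) :=
    IsGaussian.memLp_two_id
  have hi : Integrable (fun y : ℝ => y ^ 2) (gaussianReal 0 (δ * ‖v‖ ^ 2).toNNReal) :=
    hL.integrable_sq
  rw [← lintegral_map (μ := incrLaw d δ) (f := fun y : ℝ => ENNReal.ofReal (y ^ 2))
    (g := fun x => inner ℝ v x) (by fun_prop) (by fun_prop), hm,
    ← ofReal_integral_eq_lintegral_ofReal hi (.of_forall fun _ => sq_nonneg _)]
  have hv := variance_of_integral_eq_zero (μ := gaussianReal 0 (δ * ‖v‖ ^ 2).toNNReal)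
    (X := fun y : ℝ => y) aemeasurable_id (by simp)
  have hv' : Var[fun y : ℝ => y; gaussianReal 0 (δ * ‖v‖ ^ 2).toNNReal]
    = (δ * ‖v‖ ^ 2).toNNReal := variance_id_gaussianReal
  rw [← hv, hv', Real.coe_toNNReal _ (by positivity)]

/-- The centred Gaussian is symmetric. In this product form the symmetry makes integrals that are
odd in the increment vanish without any integrability assumption. -/
theorem map_prod_neg_incrLaw {δ : ℝ} (hδ : 0 ≤ δ) (ρ : Measure (E d)) [IsFiniteMeasure ρ] :
    (ρ.prod (incrLaw d δ)).map (Prod.map id fun x => -x) = ρ.prod (incrLaw d δ) := by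
  have hneg : (incrLaw d δ).map (fun x => -x) = incrLaw d δ := by
    -- A Gaussian measure is determined by its mean and covariance, and reflection preserves both.
    refine IsGaussian.ext ?_ ?_
    · rw [integral_map (by fun_prop) (by fun_prop)]
      simp only [id_eq]
      rw [integral_neg, integral_id_multivariateGaussian, neg_zero]
    · ext x y
      have e : (fun x : E d => -x) = (-ContinuousLinearMap.id ℝ (E d) : E d →L[ℝ] E d) := by
        ext; simp
      rw [e, covarianceBilin_map IsGaussian.memLp_two_id, covarianceBilin_incrLaw hδ,
        covarianceBilin_incrLaw hδ]
      simp [ContinuousLinearMap.adjoint_inner_left, ContinuousLinearMap.adjoint_inner_right]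
  rw [← Measure.map_prod_map ρ (incrLaw d δ) measurable_id measurable_neg, Measure.map_id, hneg]

/-! ### Brownian motion: covariances and independence of the past -/

namespace IsWienerMeasure

variable {ν : Measure (PathSpace d)}

theorem isProbabilityMeasure (hν : IsWienerMeasure ν) : IsProbabilityMeasure ν :=
  (hν.indep 0 (fun _ => 0) (fun _ _ _ => le_rfl)).isProbabilityMeasure

theorem hasLaw_sub (hν : IsWienerMeasure ν) {s t : ℝ} (hs : 0 ≤ s) (hst : s ≤ t) (ht : t ≤ 1) :
    HasLaw (fun γ : PathSpace d => pathAt γ t - pathAt γ s) (incrLaw d (t - s)) ν := by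
  have := hν.law ⟨s, hs, hst.trans ht⟩ ⟨t, hs.trans hst, ht⟩ hst
  simp only [← pathAt_coe] at this
  exact this

theorem hasLaw_pathAt (hν : IsWienerMeasure ν) {t : ℝ} (h0 : 0 ≤ t) (ht : t ≤ 1) :
    HasLaw (fun γ : PathSpace d => pathAt γ t) (incrLaw d t) ν := by
  simpa using hν.hasLaw_sub le_rfl h0 ht

/-- Independent Gaussian increments started at `0` form a Gaussian process, so the independence
statements below reduce to vanishing covariances. -/
theorem isGaussianProcess_eval (hν : IsWienerMeasure ν) :
    IsGaussianProcess (fun (t : unitInterval) (γ : PathSpace d) =>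
      (γ : C(unitInterval, E d)) t) ν := by
  refine HasIndepIncrements.isGaussianProcess (fun t => ?_) ?_ hν.indep
  · have := hν.hasLaw_pathAt t.2.1 t.2.2
    simp only [pathAt_coe] at this
    exact this.hasGaussianLaw
  · exact .of_forall fun γ => path_zero γ

theorem isGaussianProcess (hν : IsWienerMeasure ν) :
    IsGaussianProcess (fun (t : ℝ) (γ : PathSpace d) => pathAt γ t) ν :=
  hν.isGaussianProcess_eval.comp_right (Set.projIcc 0 1 zero_le_one)

theorem memLp_two_inner (hν : IsWienerMeasure ν) (x : E d) (s : ℝ) :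
    MemLp (fun γ : PathSpace d => inner ℝ x (pathAt γ s)) 2 ν :=
  ((hν.isGaussianProcess.hasGaussianLaw_eval s).map (innerSL ℝ x)).memLp_two

theorem indepFun_pathAt_sub (hν : IsWienerMeasure ν) {r s : ℝ} (hr : 0 ≤ r) (hrs : r ≤ s)
    (hs : s ≤ 1) :
    IndepFun (fun γ : PathSpace d => pathAt γ r) (fun γ => pathAt γ s - pathAt γ r) ν := by
  have := hν.indep.indepFun_eval_sub (r := 0) (s := ⟨r, hr, hrs.trans hs⟩)
    (t := ⟨s, hr.trans hrs, hs⟩) hr hrs (.of_forall fun γ => path_zero γ)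
  have e : (fun γ : PathSpace d => pathAt γ s - pathAt γ r) =
      (fun γ : PathSpace d => pathAt γ s) - fun γ => pathAt γ r := rfl
  rw [e]
  convert this using 1
  · funext γ; exact pathAt_coe γ ⟨r, hr, hrs.trans hs⟩
  · congr 1
    · funext γ; exact pathAt_coe γ ⟨s, hr.trans hrs, hs⟩
    · funext γ; exact pathAt_coe γ ⟨r, hr, hrs.trans hs⟩

theorem covariance_inner_sub_right (hν : IsWienerMeasure ν) {r s : ℝ} (hr : 0 ≤ r) (hrs : r ≤ s)
    (hs : s ≤ 1) (x y : E d) :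
    cov[fun γ => inner ℝ x (pathAt γ r),
      fun γ => inner ℝ y (pathAt γ s - pathAt γ r); ν] = 0 := by
  have := hν.isProbabilityMeasure
  refine IndepFun.covariance_eq_zero ?_ (hν.memLp_two_inner x r) ?_
  · exact (hν.indepFun_pathAt_sub hr hrs hs).comp (φ := fun z => inner ℝ x z)
      (ψ := fun z => inner ℝ y z) (by fun_prop) (by fun_prop)
  · simp_rw [inner_sub_right]
    exact (hν.memLp_two_inner y s).sub (hν.memLp_two_inner y r)

theorem covariance_inner_of_le (hν : IsWienerMeasure ν) {r s : ℝ} (hr : 0 ≤ r) (hrs : r ≤ s)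
    (hs : s ≤ 1) (x y : E d) :
    cov[fun γ => inner ℝ x (pathAt γ r), fun γ => inner ℝ y (pathAt γ s); ν] =
      r * inner ℝ x y := by
  have := hν.isProbabilityMeasure
  have h := hν.covariance_inner_sub_right hr hrs hs x y
  simp_rw [inner_sub_right] at h
  rw [covariance_fun_sub_right (hν.memLp_two_inner x r) (hν.memLp_two_inner y s)
    (hν.memLp_two_inner y r), sub_eq_zero] at h
  rw [h, ← covarianceBilin_incrLaw hr, ← (hν.hasLaw_pathAt hr (hrs.trans hs)).map_eq]
  have hm : AEMeasurable (fun γ : PathSpace d => pathAt γ r) ν := (measurable_pathAt r).aemeasurable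
  rw [covarianceBilin_apply_eq_cov, covariance_map_fun]
  · rw [(hν.hasLaw_pathAt hr (hrs.trans hs)).map_eq]
    fun_prop
  · rw [(hν.hasLaw_pathAt hr (hrs.trans hs)).map_eq]
    fun_prop
  · exact hm
  · rw [(hν.hasLaw_pathAt hr (hrs.trans hs)).map_eq]
    exact IsGaussian.memLp_two_id

theorem covariance_inner (hν : IsWienerMeasure ν) {r s : ℝ} (hr : r ∈ Set.Icc (0 : ℝ) 1)
    (hs : s ∈ Set.Icc (0 : ℝ) 1) (x y : E d) :
    cov[fun γ => inner ℝ x (pathAt γ r), fun γ => inner ℝ y (pathAt γ s); ν] =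
      min r s * inner ℝ x y := by
  rcases le_total r s with h | h
  · rw [min_eq_left h, hν.covariance_inner_of_le hr.1 h hs.2]
  · rw [min_eq_right h, covariance_comm, hν.covariance_inner_of_le hs.1 h hr.2, real_inner_comm]

/-- The past and the increment are jointly Gaussian, and `min r t - min r s = 0` for `0 ≤ r ≤ s`
makes them uncorrelated. -/
theorem indep_past (hν : IsWienerMeasure ν) {s t : ℝ} (hst : s ≤ t) (ht : t ≤ 1)
    {β : Type*} [MeasurableSpace β] {V : PathSpace d → β} (hV : Measurable[past d s] V) :
    IndepFun V (fun γ => pathAt γ t - pathAt γ s) ν := by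
  have := hν.isProbabilityMeasure
  have key : IndepFun (fun (γ : PathSpace d) (r : Set.Iic s) => pathAt γ r)
      (fun (γ : PathSpace d) (_ : Unit) => pathAt γ t - pathAt γ s) ν := by
    refine IsGaussianProcess.indepFun_of_covariance_inner
      (X := fun (r : Set.Iic s) (γ : PathSpace d) => pathAt γ r)
      (Y := fun (_ : Unit) (γ : PathSpace d) => pathAt γ t - pathAt γ s) ?_ ?_ ?_ ?_
    · refine hν.isGaussianProcess.of_isGaussianProcess ?_
      rintro (r | _)
      · refine ⟨{r.1}, ContinuousLinearMap.proj (R := ℝ) (φ := fun _ => E d) ⟨r.1, by simp⟩,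
          fun γ => rfl⟩
      · classical
        refine ⟨{s, t}, ContinuousLinearMap.proj (R := ℝ) (φ := fun _ => E d) ⟨t, by simp⟩ -
          ContinuousLinearMap.proj (R := ℝ) (φ := fun _ => E d) ⟨s, by simp⟩, fun γ => rfl⟩
    · exact fun r => (measurable_pathAt r.1).aemeasurable
    · exact fun _ => ((measurable_pathAt t).sub (measurable_pathAt s)).aemeasurable
    · rintro ⟨r, hr⟩ _ x y
      have hr : r ≤ s := hr
      simp_rw [inner_sub_right]
      rw [covariance_fun_sub_right (hν.memLp_two_inner x _) (hν.memLp_two_inner y t)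
        (hν.memLp_two_inner y s)]
      -- `past d s` also contains negative times, at which the path is clamped to its initial value
      -- `0`.
      rcases le_total 0 r with h0 | h0
      · rw [hν.covariance_inner_of_le h0 (hr.trans hst) ht,
          hν.covariance_inner_of_le h0 hr (hst.trans ht), sub_self]
      · have : ∀ γ : PathSpace d, pathAt γ r = 0 := fun γ => by
          rw [← pathAt_zero γ, pathAt, pathAt, Set.projIcc_of_le_left _ h0,
            Set.projIcc_of_le_left _ le_rfl]
        simp [this, covariance_const_left]
  have h2 := key.comp (φ := id) (ψ := fun z : Unit → E d => z ()) measurable_id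
    (measurable_pi_apply (X := fun _ : Unit => E d) ())
  rw [IndepFun_iff_Indep] at h2 ⊢
  exact indep_of_indep_of_le_left h2 hV.comap_le

/-- Conditioning on the past: an increment can be integrated out against its law. -/
theorem lintegral_past (hν : IsWienerMeasure ν) {s t : ℝ} (hs : 0 ≤ s) (hst : s ≤ t) (ht : t ≤ 1)
    {β : Type*} [MeasurableSpace β] {V : PathSpace d → β} (hV : Measurable[past d s] V)
    {G : β × E d → ℝ≥0∞} (hG : Measurable G) :
    ∫⁻ γ, G (V γ, pathAt γ t - pathAt γ s) ∂ν =
      ∫⁻ γ, ∫⁻ x, G (V γ, x) ∂(incrLaw d (t - s)) ∂ν := by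
  have := hν.isProbabilityMeasure
  have hVm : Measurable V := hV.mono (past_le s) le_rfl
  have hD : Measurable fun γ : PathSpace d => pathAt γ t - pathAt γ s :=
    (measurable_pathAt t).sub (measurable_pathAt s)
  have h := (indepFun_iff_map_prod_eq_prod_map_map hVm.aemeasurable hD.aemeasurable).1
    (hν.indep_past hst ht hV)
  rw [(hν.hasLaw_sub hs hst ht).map_eq] at h
  rw [← lintegral_map (f := G) hG (hVm.prodMk hD), h, lintegral_prod _ hG.aemeasurable,
    lintegral_map hG.lintegral_prod_right' hVm]

/-- The martingale property: by independence the joint law of `V` and the increment is a product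
invariant under reflecting the increment, so the integral equals its own negative. -/
theorem integral_inner_sub_eq_zero (hν : IsWienerMeasure ν) {s t : ℝ} (hs : 0 ≤ s) (hst : s ≤ t)
    (ht : t ≤ 1) {V : PathSpace d → E d} (hV : Measurable[past d s] V) :
    ∫ γ, inner ℝ (V γ) (pathAt γ t - pathAt γ s) ∂ν = 0 := by
  have := hν.isProbabilityMeasure
  have hVm : Measurable V := hV.mono (past_le s) le_rfl
  have hD : Measurable fun γ : PathSpace d => pathAt γ t - pathAt γ s :=
    (measurable_pathAt t).sub (measurable_pathAt s)
  have h := (indepFun_iff_map_prod_eq_prod_map_map hVm.aemeasurable hD.aemeasurable).1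
    (hν.indep_past hst ht hV)
  rw [(hν.hasLaw_sub hs hst ht).map_eq] at h
  have := Measure.isProbabilityMeasure_map hVm.aemeasurable (μ := ν)
  have h3 := map_prod_neg_incrLaw (sub_nonneg.2 hst) (ν.map V)
  have e1 : ∫ γ, inner ℝ (V γ) (pathAt γ t - pathAt γ s) ∂ν =
      ∫ p, inner ℝ p.1 p.2 ∂((ν.map V).prod (incrLaw d (t - s))) := by
    rw [← h, integral_map (by fun_prop) (by fun_prop)]
  have e2 : ∫ p, inner ℝ p.1 p.2 ∂((ν.map V).prod (incrLaw d (t - s))) =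
      - ∫ p, inner ℝ p.1 p.2 ∂((ν.map V).prod (incrLaw d (t - s))) := by
    conv_lhs => rw [← h3]
    rw [integral_map (by fun_prop) (by fun_prop), ← integral_neg]
    simp
  rw [e1]
  linarith

end IsWienerMeasure

/-! ### Preliminaries on `L²` norms -/

theorem eLpNorm_two_sq {α F : Type*} [MeasurableSpace α] [NormedAddCommGroup F] (μ : Measure α)
    (f : α → F) : eLpNorm f 2 μ ^ 2 = ∫⁻ x, ‖f x‖ₑ ^ 2 ∂μ := by
  have := eLpNorm_nnreal_pow_eq_lintegral (f := f) (μ := μ) (p := 2) (by norm_num)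
  simpa using this

theorem enorm_sq_real (x : ℝ) : ‖x‖ₑ ^ 2 = ENNReal.ofReal (x ^ 2) := by
  rw [← ofReal_norm, ← ENNReal.ofReal_pow (norm_nonneg _), Real.norm_eq_abs, sq_abs]

theorem enorm_sq_eq {F : Type*} [NormedAddCommGroup F] (x : F) :
    ‖x‖ₑ ^ 2 = ENNReal.ofReal (‖x‖ ^ 2) := by
  rw [← ofReal_norm, ← ENNReal.ofReal_pow (norm_nonneg _)]

theorem eLpNorm_two_le_iff {α F : Type*} [MeasurableSpace α] [NormedAddCommGroup F]
    {μ : Measure α} {f : α → F} {c : ℝ≥0∞} :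
    eLpNorm f 2 μ ≤ c ↔ ∫⁻ x, ‖f x‖ₑ ^ 2 ∂μ ≤ c ^ 2 := by
  rw [← eLpNorm_two_sq]
  exact (ENNReal.pow_le_pow_left_iff two_ne_zero).symm

/-! ### Riemann sums of adapted processes -/

/-- Adaptedness to the filtration generated by the path. -/
def IsAdapted (u : ℝ → PathSpace d → E d) : Prop :=
  ∀ s, 0 ≤ s → Measurable[past d s] (u s)

/-- The partial sums of `itoSum`. -/
def itoPartial (u : ℝ → PathSpace d → E d) (n k : ℕ) (γ : PathSpace d) : ℝ :=
  ∑ j ∈ Finset.range k,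
    inner ℝ (u ((j : ℝ) / 2 ^ n) γ) (pathAt γ (((j : ℝ) + 1) / 2 ^ n) - pathAt γ ((j : ℝ) / 2 ^ n))

theorem itoPartial_two_pow (u : ℝ → PathSpace d → E d) (n : ℕ) :
    itoPartial u n (2 ^ n) = itoSum u n := rfl

theorem itoPartial_succ (u : ℝ → PathSpace d → E d) (n k : ℕ) (γ : PathSpace d) :
    itoPartial u n (k + 1) γ = itoPartial u n k γ +
      inner ℝ (u ((k : ℝ) / 2 ^ n) γ)
        (pathAt γ (((k : ℝ) + 1) / 2 ^ n) - pathAt γ ((k : ℝ) / 2 ^ n)) := by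
  simp [itoPartial, Finset.sum_range_succ]

theorem IsAdapted.measurable_itoPartial {u : ℝ → PathSpace d → E d} (hu : IsAdapted u)
    (n k : ℕ) : Measurable[past d ((k : ℝ) / 2 ^ n)] (itoPartial u n k) := by
  unfold itoPartial
  refine Finset.measurable_fun_sum _ fun j hj => ?_
  have hj : (j : ℝ) + 1 ≤ k := by exact_mod_cast Finset.mem_range.1 hj
  have h1 : (j : ℝ) / 2 ^ n ≤ (k : ℝ) / 2 ^ n := div_le_div_of_nonneg_right (by linarith) (by positivity)
  have h2 : ((j : ℝ) + 1) / 2 ^ n ≤ (k : ℝ) / 2 ^ n := by gcongr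
  exact Measurable.inner (𝕜 := ℝ) ((hu _ (by positivity)).mono (past_mono h1) le_rfl)
    ((measurable_past_pathAt h2).sub (measurable_past_pathAt h1))

theorem IsAdapted.measurable {u : ℝ → PathSpace d → E d} (hu : IsAdapted u) {s : ℝ}
    (hs : 0 ≤ s) : Measurable (u s) := (hu s hs).mono (past_le _) le_rfl

theorem IsAdapted.measurable_itoSum {u : ℝ → PathSpace d → E d} (hu : IsAdapted u) (n : ℕ) :
    Measurable (itoSum u n) :=
  (hu.measurable_itoPartial n (2 ^ n)).mono (past_le _) le_rfl

theorem grid_mem {n k : ℕ} (hk : k + 1 ≤ 2 ^ n) :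
    (0 : ℝ) ≤ (k : ℝ) / 2 ^ n ∧ (k : ℝ) / 2 ^ n ≤ ((k : ℝ) + 1) / 2 ^ n ∧
      ((k : ℝ) + 1) / 2 ^ n ≤ 1 := by
  refine ⟨by positivity, by gcongr; linarith, ?_⟩
  rw [div_le_one (by positivity)]
  exact_mod_cast hk

/-! ### Exponential moments and isometry of Riemann sums -/

namespace IsWienerMeasure

variable {ν : Measure (PathSpace d)}

/-- Integrating out the last increment, Gaussian with variance `2⁻ⁿ` in each direction, costs a
factor of at most `exp(2⁻ⁿ K² / 2)`. These factors multiply over the steps, so for the full sum the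
bound does not depend on the level. -/
theorem lintegral_exp_itoPartial_le (hν : IsWienerMeasure ν) {u : ℝ → PathSpace d → E d}
    (hu : IsAdapted u) {K : ℝ} (hK : ∀ s γ, ‖u s γ‖ ≤ K) (n k : ℕ) (hk : k ≤ 2 ^ n) :
    ∫⁻ γ, ENNReal.ofReal (Real.exp (itoPartial u n k γ)) ∂ν ≤
      ENNReal.ofReal (Real.exp ((k : ℝ) / 2 ^ n * (K ^ 2 / 2))) := by
  have := hν.isProbabilityMeasure
  induction k with
  | zero => simp [itoPartial]
  | succ k ih =>
    obtain ⟨h0, h1, h2⟩ := grid_mem hk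
    have hM := hu.measurable_itoPartial n k
    simp_rw [itoPartial_succ, Real.exp_add, ENNReal.ofReal_mul (Real.exp_pos _).le]
    have key := hν.lintegral_past h0 h1 h2
      (V := fun γ => (itoPartial u n k γ, u ((k : ℝ) / 2 ^ n) γ)) (hM.prodMk (hu _ h0))
      (G := fun p => ENNReal.ofReal (Real.exp p.1.1) *
        ENNReal.ofReal (Real.exp (inner ℝ p.1.2 p.2))) (by fun_prop)
    rw [key]
    have hd : ((k : ℝ) + 1) / 2 ^ n - (k : ℝ) / 2 ^ n = 1 / 2 ^ n := by ring
    have step : ∀ γ, ∫⁻ x, ENNReal.ofReal (Real.exp (itoPartial u n k γ)) *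
        ENNReal.ofReal (Real.exp (inner ℝ (u ((k : ℝ) / 2 ^ n) γ) x))
          ∂(incrLaw d (((k : ℝ) + 1) / 2 ^ n - (k : ℝ) / 2 ^ n)) ≤
        ENNReal.ofReal (Real.exp (itoPartial u n k γ)) *
          ENNReal.ofReal (Real.exp (1 / 2 ^ n * (K ^ 2 / 2))) := by
      intro γ
      rw [lintegral_const_mul _ (by fun_prop), lintegral_exp_inner_incrLaw (by linarith), hd]
      gcongr
      rw [mul_div_assoc]
      gcongr
      exact hK _ _
    refine (lintegral_mono step).trans ?_
    rw [lintegral_mul_const _ (by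
      have := hM.mono (past_le _) le_rfl
      fun_prop)]
    refine (mul_le_mul_left (ih (by omega)) _).trans ?_
    rw [← ENNReal.ofReal_mul (Real.exp_pos _).le, ← Real.exp_add]
    apply le_of_eq
    push_cast
    ring_nf

theorem lintegral_inner_incr_sq (hν : IsWienerMeasure ν) {s t : ℝ} (hs : 0 ≤ s) (hst : s ≤ t)
    (ht : t ≤ 1) {V : PathSpace d → E d} (hV : Measurable[past d s] V) :
    ∫⁻ γ, ‖inner ℝ (V γ) (pathAt γ t - pathAt γ s)‖ₑ ^ 2 ∂ν =
      ENNReal.ofReal (t - s) * ∫⁻ γ, ‖V γ‖ₑ ^ 2 ∂ν := by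
  have key := hν.lintegral_past hs hst ht hV
    (G := fun p => ENNReal.ofReal (inner ℝ p.1 p.2 ^ 2)) (by fun_prop)
  simp_rw [enorm_sq_real]
  rw [key, ← lintegral_const_mul' _ _ ENNReal.ofReal_ne_top]
  refine lintegral_congr fun γ => ?_
  rw [lintegral_inner_sq_incrLaw (sub_nonneg.2 hst), ENNReal.ofReal_mul (sub_nonneg.2 hst),
    enorm_sq_eq]

theorem memLp_inner_incr (hν : IsWienerMeasure ν) {s t : ℝ} (hs : 0 ≤ s) (hst : s ≤ t)
    (ht : t ≤ 1) {V : PathSpace d → E d} (hV : Measurable[past d s] V) (hV2 : MemLp V 2 ν) :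
    MemLp (fun γ => inner ℝ (V γ) (pathAt γ t - pathAt γ s)) 2 ν := by
  refine ⟨?_, ?_⟩
  · have := hV.mono (past_le s) le_rfl
    have h1 := measurable_pathAt (d := d) t
    have h2 := measurable_pathAt (d := d) s
    exact (Measurable.inner this (h1.sub h2)).aestronglyMeasurable
  · have h2 := hV2.2
    have e := eLpNorm_two_sq ν (fun γ => inner ℝ (V γ) (pathAt γ t - pathAt γ s))
    rw [hν.lintegral_inner_incr_sq hs hst ht hV, ← eLpNorm_two_sq] at e
    by_contra hcon
    rw [not_lt, top_le_iff] at hcon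
    rw [hcon] at e
    exact ENNReal.mul_ne_top ENNReal.ofReal_ne_top (ENNReal.pow_ne_top h2.ne) (by simpa using e.symm)

/-- The discrete Itô isometry: each new term is orthogonal to the sum of the earlier ones, by the
martingale property of the increments. -/
theorem itoPartial_isometry (hν : IsWienerMeasure ν) {u : ℝ → PathSpace d → E d}
    (hu : IsAdapted u) (h2 : ∀ s, 0 ≤ s → MemLp (u s) 2 ν) (n k : ℕ) (hk : k ≤ 2 ^ n) :
    MemLp (itoPartial u n k) 2 ν ∧ ∫ γ, itoPartial u n k γ ^ 2 ∂ν =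
      ∑ j ∈ Finset.range k, 1 / 2 ^ n * ∫ γ, ‖u ((j : ℝ) / 2 ^ n) γ‖ ^ 2 ∂ν := by
  have := hν.isProbabilityMeasure
  induction k with
  | zero => simp [itoPartial, show itoPartial u n 0 = fun _ => 0 from rfl]
  | succ k ih =>
    obtain ⟨h0, h1, hle⟩ := grid_mem hk
    obtain ⟨ih1, ih2⟩ := ih (by omega)
    have hM := hu.measurable_itoPartial n k
    have hx := hν.memLp_inner_incr h0 h1 hle (hu _ h0) (h2 _ h0)
    have e : itoPartial u n (k + 1) = fun γ => itoPartial u n k γ +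
      inner ℝ (u ((k : ℝ) / 2 ^ n) γ)
        (pathAt γ (((k : ℝ) + 1) / 2 ^ n) - pathAt γ ((k : ℝ) / 2 ^ n)) :=
      funext fun γ => itoPartial_succ u n k γ
    refine ⟨by rw [e]; exact ih1.add hx, ?_⟩
    have hcross : ∫ γ, itoPartial u n k γ * inner ℝ (u ((k : ℝ) / 2 ^ n) γ)
        (pathAt γ (((k : ℝ) + 1) / 2 ^ n) - pathAt γ ((k : ℝ) / 2 ^ n)) ∂ν = 0 := by
      -- The scalar partial sum is known at the left end point and can be absorbed into the vector
      -- paired with the increment.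
      have := hν.integral_inner_sub_eq_zero h0 h1 hle
        (V := fun γ => itoPartial u n k γ • u ((k : ℝ) / 2 ^ n) γ) (hM.smul (hu _ h0))
      simpa [inner_smul_left] using this
    have hsq : ∫ γ, inner ℝ (u ((k : ℝ) / 2 ^ n) γ)
        (pathAt γ (((k : ℝ) + 1) / 2 ^ n) - pathAt γ ((k : ℝ) / 2 ^ n)) ^ 2 ∂ν =
        1 / 2 ^ n * ∫ γ, ‖u ((k : ℝ) / 2 ^ n) γ‖ ^ 2 ∂ν := by
      have hl := hν.lintegral_inner_incr_sq h0 h1 hle (hu _ h0)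
      simp_rw [enorm_sq_real, enorm_sq_eq] at hl
      rw [← ofReal_integral_eq_lintegral_ofReal hx.integrable_sq (.of_forall fun _ => sq_nonneg _),
        ← ofReal_integral_eq_lintegral_ofReal (h2 _ h0).norm.integrable_sq
          (.of_forall fun _ => sq_nonneg _), ← ENNReal.ofReal_mul (by linarith)] at hl
      have := (ENNReal.ofReal_eq_ofReal_iff (integral_nonneg fun _ => sq_nonneg _)
        (mul_nonneg (by linarith) (integral_nonneg fun _ => sq_nonneg _))).1 hl
      rw [this]
      ring
    rw [Finset.sum_range_succ, ← ih2, ← hsq, e]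
    have i1 := ih1.integrable_sq
    have i2 := hx.integrable_sq
    have i3 : Integrable (fun γ => 2 * (itoPartial u n k γ * inner ℝ (u ((k : ℝ) / 2 ^ n) γ)
        (pathAt γ (((k : ℝ) + 1) / 2 ^ n) - pathAt γ ((k : ℝ) / 2 ^ n)))) ν :=
      (ih1.integrable_mul hx).const_mul 2
    rw [← integral_add i1 i2]
    have i12 : Integrable (fun γ => itoPartial u n k γ ^ 2 + inner ℝ (u ((k : ℝ) / 2 ^ n) γ)
        (pathAt γ (((k : ℝ) + 1) / 2 ^ n) - pathAt γ ((k : ℝ) / 2 ^ n)) ^ 2) ν := i1.add i2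
    calc _ = ∫ γ, ((itoPartial u n k γ ^ 2 + inner ℝ (u ((k : ℝ) / 2 ^ n) γ)
        (pathAt γ (((k : ℝ) + 1) / 2 ^ n) - pathAt γ ((k : ℝ) / 2 ^ n)) ^ 2) +
        2 * (itoPartial u n k γ * inner ℝ (u ((k : ℝ) / 2 ^ n) γ)
        (pathAt γ (((k : ℝ) + 1) / 2 ^ n) - pathAt γ ((k : ℝ) / 2 ^ n)))) ∂ν := by
          congr 1; funext γ; ring
      _ = _ := by
          rw [integral_add i12 i3, integral_const_mul, hcross]
          simp

theorem memLp_itoSum (hν : IsWienerMeasure ν) {u : ℝ → PathSpace d → E d}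
    (hu : IsAdapted u) (h2 : ∀ s, 0 ≤ s → MemLp (u s) 2 ν) (n : ℕ) : MemLp (itoSum u n) 2 ν :=
  (hν.itoPartial_isometry hu h2 n _ le_rfl).1

theorem eLpNorm_itoSum_le (hν : IsWienerMeasure ν) {u : ℝ → PathSpace d → E d}
    (hu : IsAdapted u) (h2 : ∀ s, 0 ≤ s → MemLp (u s) 2 ν) {r : ℝ} (hr : 0 ≤ r)
    (hb : ∀ s ∈ Set.Icc (0 : ℝ) 1, ∫ γ, ‖u s γ‖ ^ 2 ∂ν ≤ r ^ 2) (n : ℕ) :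
    eLpNorm (itoSum u n) 2 ν ≤ ENNReal.ofReal r := by
  obtain ⟨h, e⟩ := hν.itoPartial_isometry hu h2 n _ le_rfl
  rw [itoPartial_two_pow] at h e
  rw [eLpNorm_two_le_iff]
  simp_rw [enorm_sq_real]
  rw [← ofReal_integral_eq_lintegral_ofReal h.integrable_sq (.of_forall fun _ => sq_nonneg _), e,
    ← ENNReal.ofReal_pow hr]
  refine ENNReal.ofReal_le_ofReal ?_
  calc _ ≤ ∑ j ∈ Finset.range (2 ^ n), 1 / 2 ^ n * r ^ 2 := by
        refine Finset.sum_le_sum fun j hj => ?_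
        obtain ⟨h0, h1, hle⟩ := grid_mem (Finset.mem_range.1 hj)
        gcongr
        exact hb _ ⟨h0, h1.trans hle⟩
    _ = r ^ 2 := by
        rw [Finset.sum_const, Finset.card_range, nsmul_eq_mul]
        push_cast
        field_simp

end IsWienerMeasure

/-! ### Refinement of dyadic sums -/

theorem sum_range_two_mul {M : Type*} [AddCommMonoid M] (f : ℕ → M) (N : ℕ) :
    ∑ k ∈ Finset.range (2 * N), f k = ∑ k ∈ Finset.range N, (f (2 * k) + f (2 * k + 1)) := by
  induction N with
  | zero => simp
  | succ N ih =>
    rw [show 2 * (N + 1) = 2 * N + 1 + 1 by ring, Finset.sum_range_succ, Finset.sum_range_succ,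
      Finset.sum_range_succ, ih, add_assoc]

/-- When the integrand at each new midpoint repeats its value at the left neighbour, the two half
increments add up to the coarse one. -/
theorem itoSum_succ {u : ℝ → PathSpace d → E d} {m : ℕ} {γ : PathSpace d}
    (h : ∀ k : ℕ, k < 2 ^ m → u ((2 * (k : ℝ) + 1) / 2 ^ (m + 1)) γ = u ((k : ℝ) / 2 ^ m) γ) :
    itoSum u (m + 1) γ = itoSum u m γ := by
  unfold itoSum
  rw [pow_succ', sum_range_two_mul]
  refine Finset.sum_congr rfl fun k hk => ?_
  have e1 : (((2 * k : ℕ) : ℝ)) / (2 * 2 ^ m) = (k : ℝ) / 2 ^ m := by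
    push_cast; field_simp
  have e2 : (((2 * k + 1 : ℕ) : ℝ) + 1) / (2 * 2 ^ m) = ((k : ℝ) + 1) / 2 ^ m := by
    push_cast; field_simp; ring
  have e3 : ((2 * k : ℕ) : ℝ) + 1 = ((2 * k + 1 : ℕ) : ℝ) := by push_cast; ring
  have h' := h k (Finset.mem_range.1 hk)
  rw [pow_succ'] at h'
  have e4 : (2 * (k : ℝ) + 1) = ((2 * k + 1 : ℕ) : ℝ) := by push_cast; ring
  rw [e4] at h'
  simp only [pow_succ']
  rw [e1, e2, e3, h', ← inner_add_right]
  congr 1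
  abel

/-- The left end point of the dyadic interval of level `n` that contains `s`. -/
def dyadicFloor (n : ℕ) (s : ℝ) : ℝ := (⌊s * 2 ^ n⌋₊ : ℝ) / 2 ^ n

theorem dyadicFloor_nonneg (n : ℕ) (s : ℝ) : 0 ≤ dyadicFloor n s := by
  unfold dyadicFloor; positivity

theorem dyadicFloor_le (n : ℕ) {s : ℝ} (hs : 0 ≤ s) : dyadicFloor n s ≤ s := by
  unfold dyadicFloor
  rw [div_le_iff₀ (by positivity)]
  exact Nat.floor_le (by positivity)

theorem sub_dyadicFloor_lt (n : ℕ) (s : ℝ) : s - dyadicFloor n s < (1 / 2) ^ n := by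
  unfold dyadicFloor
  rw [one_div, inv_pow, sub_lt_iff_lt_add, ← one_div, ← add_div, lt_div_iff₀ (by positivity),
    add_comm]
  exact Nat.lt_floor_add_one _

theorem dyadicFloor_grid (n k : ℕ) : dyadicFloor n ((k : ℝ) / 2 ^ n) = (k : ℝ) / 2 ^ n := by
  unfold dyadicFloor
  rw [div_mul_cancel₀ _ (by positivity), Nat.floor_natCast]

/-- A new midpoint lies in the same cell of level `n` as its left neighbour, since `(2k + 1) / (2 ·
2^p)` and `k / 2^p` have equal integer quotients. -/
theorem dyadicFloor_refine (n p k : ℕ) :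
    dyadicFloor n ((2 * (k : ℝ) + 1) / 2 ^ (n + p + 1)) = dyadicFloor n ((k : ℝ) / 2 ^ (n + p)) := by
  unfold dyadicFloor
  have e1 : (2 * (k : ℝ) + 1) / 2 ^ (n + p + 1) * 2 ^ n =
      ((2 * k + 1 : ℕ) : ℝ) / ((2 * 2 ^ p : ℕ) : ℝ) := by
    push_cast; rw [pow_succ, pow_add]; field_simp
  have e2 : (k : ℝ) / 2 ^ (n + p) * 2 ^ n = (k : ℝ) / ((2 ^ p : ℕ) : ℝ) := by
    push_cast; rw [pow_add]; field_simp
  rw [e1, e2, Nat.floor_div_eq_div, Nat.floor_div_eq_div, ← Nat.div_div_eq_div_mul]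
  congr 3
  omega

/-- A coarse Riemann sum is a fine one with frozen integrand. Sums of different levels can thus be
subtracted on a common grid, where the isometry applies. -/
theorem itoSum_dyadicFloor (u : ℝ → PathSpace d → E d) (n p : ℕ) (γ : PathSpace d) :
    itoSum (fun s => u (dyadicFloor n s)) (n + p) γ = itoSum u n γ := by
  induction p with
  | zero =>
    unfold itoSum
    simp only [add_zero, dyadicFloor_grid]
  | succ p ih =>
    rw [← add_assoc, itoSum_succ, ih]
    intro k _
    rw [dyadicFloor_refine]

theorem itoSum_sub (u v : ℝ → PathSpace d → E d) (n : ℕ) (γ : PathSpace d) :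
    itoSum (fun s γ => u s γ - v s γ) n γ = itoSum u n γ - itoSum v n γ := by
  simp [itoSum, inner_sub_left, Finset.sum_sub_distrib]

theorem itoSum_smul (c : ℝ) (u : ℝ → PathSpace d → E d) (n : ℕ) (γ : PathSpace d) :
    itoSum (fun s γ => c • u s γ) n γ = c * itoSum u n γ := by
  simp [itoSum, inner_smul_left, Finset.mul_sum]

theorem IsAdapted.sub {u v : ℝ → PathSpace d → E d} (hu : IsAdapted u) (hv : IsAdapted v) :
    IsAdapted fun s γ => u s γ - v s γ := fun s hs => (hu s hs).sub (hv s hs)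

theorem IsAdapted.dyadicFloor {u : ℝ → PathSpace d → E d} (hu : IsAdapted u) (n : ℕ) :
    IsAdapted fun s => u (dyadicFloor n s) := fun s hs =>
  (hu _ (dyadicFloor_nonneg n s)).mono (past_mono (dyadicFloor_le n hs)) le_rfl

/-! ### Itô integrals -/

/-- Adapted bounded processes with continuous trajectories. -/
structure IsItoIntegrand (u : ℝ → PathSpace d → E d) (K : ℝ) : Prop where
  adapted : IsAdapted u
  bound : ∀ s γ, ‖u s γ‖ ≤ K
  cont : ∀ γ, Continuous fun s => u s γ

theorem isItoIntegrand_comp_pathAt {U : ℝ → E d → E d} {K : ℝ}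
    (hU : Continuous (Function.uncurry U)) (hK : ∀ s x, ‖U s x‖ ≤ K) :
    IsItoIntegrand (fun s γ => U s (pathAt γ s)) K where
  adapted s _ := (hU.comp (Continuous.prodMk_right s)).measurable.comp
    (measurable_past_pathAt le_rfl)
  bound s _ := hK s _
  cont γ := hU.comp (continuous_id.prodMk (continuous_pathAt γ))

/-! ### Existence of the Itô integral -/

namespace IsItoIntegrand

variable {u v : ℝ → PathSpace d → E d} {K K' : ℝ} {ν : Measure (PathSpace d)}

theorem sub (hu : IsItoIntegrand u K) (hv : IsItoIntegrand v K') :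
    IsItoIntegrand (fun s γ => u s γ - v s γ) (K + K') where
  adapted := hu.adapted.sub hv.adapted
  bound s γ := (norm_sub_le _ _).trans (add_le_add (hu.bound s γ) (hv.bound s γ))
  cont γ := (hu.cont γ).sub (hv.cont γ)

theorem const_smul (hu : IsItoIntegrand u K) (c : ℝ) :
    IsItoIntegrand (fun s γ => c • u s γ) (|c| * K) where
  adapted s hs := (hu.adapted s hs).const_smul c
  bound s γ := by
    rw [norm_smul, Real.norm_eq_abs]
    exact mul_le_mul_of_nonneg_left (hu.bound s γ) (abs_nonneg c)
  cont γ := (hu.cont γ).const_smul c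

theorem memLp [IsFiniteMeasure ν] (hu : IsItoIntegrand u K) (p : ℝ≥0∞) {s : ℝ} (hs : 0 ≤ s) :
    MemLp (u s) p ν :=
  MemLp.of_bound (hu.adapted.measurable hs).aestronglyMeasurable K (.of_forall (hu.bound s))

/-- Dominated convergence makes the squared `L²` distance of two time slices continuous in both
times; compactness of `[0,1]²` makes this uniform. -/
theorem uniform_modulus [IsProbabilityMeasure ν] (hu : IsItoIntegrand u K) {ε : ℝ} (hε : 0 < ε) :
    ∃ δ > 0, ∀ s ∈ Set.Icc (0 : ℝ) 1, ∀ r ∈ Set.Icc (0 : ℝ) 1, |s - r| < δ →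
      ∫ γ, ‖u r γ - u s γ‖ ^ 2 ∂ν < ε := by
  -- Adaptedness yields measurability at nonnegative times only; the absolute values make `q` well
  -- behaved on the whole plane.
  let q : ℝ × ℝ → ℝ := fun p => ∫ γ, ‖u |p.1| γ - u |p.2| γ‖ ^ 2 ∂ν
  have hq : Continuous q := by
    refine continuous_of_dominated (bound := fun _ => (2 * K) ^ 2) ?_ ?_ (integrable_const _) ?_
    · intro p
      exact (((hu.adapted.measurable (abs_nonneg _)).sub
        (hu.adapted.measurable (abs_nonneg _))).norm.pow_const 2).aestronglyMeasurable
    · refine fun p => .of_forall fun γ => ?_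
      rw [Real.norm_of_nonneg (by positivity)]
      have h1 := hu.bound |p.1| γ
      have h2 := hu.bound |p.2| γ
      gcongr
      exact (norm_sub_le _ _).trans (by linarith)
    · refine .of_forall fun γ => ?_
      have := hu.cont γ
      fun_prop
  have huc : UniformContinuousOn q (Set.Icc (0 : ℝ) 1 ×ˢ Set.Icc (0 : ℝ) 1) :=
    (isCompact_Icc.prod isCompact_Icc).uniformContinuousOn_of_continuous hq.continuousOn
  obtain ⟨δ, hδ, h⟩ := Metric.uniformContinuousOn_iff.1 huc ε hε
  refine ⟨δ, hδ, fun s hs r hr hsr => ?_⟩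
  have := h (r, s) ⟨hr, hs⟩ (s, s) ⟨hs, hs⟩ (by
    rw [Prod.dist_eq, dist_self, Real.dist_eq, abs_sub_comm]
    simpa using hsr)
  rw [Real.dist_eq] at this
  have h0 : q (s, s) = 0 := by simp [q]
  rw [h0, sub_zero] at this
  have h1 := (le_abs_self _).trans_lt this
  simpa [q, abs_of_nonneg hs.1, abs_of_nonneg hr.1] using h1

/-- The difference of two levels is one Riemann sum of the frozen minus the true integrand. The
isometry bounds it by the `L²` modulus of continuity at the coarse mesh. -/
theorem eLpNorm_itoSum_sub_le (hν : IsWienerMeasure ν) (hu : IsItoIntegrand u K) {ε : ℝ}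
    (hε : 0 < ε) :
    ∃ N, ∀ n, N ≤ n → ∀ m, n ≤ m →
      eLpNorm (itoSum u n - itoSum u m) 2 ν ≤ ENNReal.ofReal ε := by
  have := hν.isProbabilityMeasure
  obtain ⟨δ, hδ, h⟩ := hu.uniform_modulus (ν := ν) (pow_pos hε 2)
  obtain ⟨N, hN⟩ := exists_pow_lt_of_lt_one hδ (show (1 / 2 : ℝ) < 1 by norm_num)
  refine ⟨N, fun n hn m hm => ?_⟩
  obtain ⟨p, rfl⟩ := Nat.exists_eq_add_of_le hm
  have e : itoSum u n - itoSum u (n + p) =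
      itoSum (fun s γ => u (dyadicFloor n s) γ - u s γ) (n + p) := by
    funext γ
    rw [itoSum_sub (fun s => u (dyadicFloor n s)), itoSum_dyadicFloor]
    rfl
  rw [e]
  refine hν.eLpNorm_itoSum_le ((hu.adapted.dyadicFloor n).sub hu.adapted)
    (fun s hs => (hu.memLp 2 (dyadicFloor_nonneg n s)).sub (hu.memLp 2 hs)) hε.le ?_ _
  intro s hs
  have h1 := dyadicFloor_le n hs.1
  have h2 := sub_dyadicFloor_lt n s
  refine (h s hs _ ⟨dyadicFloor_nonneg n s, h1.trans hs.2⟩ ?_).le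
  rw [abs_of_nonneg (by linarith)]
  refine h2.trans_le (le_trans ?_ hN.le)
  exact pow_le_pow_of_le_one (by norm_num) (by norm_num) hn

theorem exists_hasItoIntegral (hν : IsWienerMeasure ν) (hu : IsItoIntegrand u K) :
    ∃ J, HasItoIntegral ν u J := by
  have := hν.isProbabilityMeasure
  have hm : ∀ n, MemLp (itoSum u n) 2 ν := fun n =>
    hν.memLp_itoSum hu.adapted (fun s hs => hu.memLp 2 hs) n
  have hc : CauchySeq fun n => (hm n).toLp (itoSum u n) := by
    rw [Metric.cauchySeq_iff']
    intro ε hε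
    obtain ⟨N, hN⟩ := hu.eLpNorm_itoSum_sub_le hν (half_pos hε)
    refine ⟨N, fun n hn => ?_⟩
    rw [dist_comm, Lp.dist_def]
    have hae : eLpNorm (⇑((hm N).toLp (itoSum u N)) - ⇑((hm n).toLp (itoSum u n))) 2 ν =
        eLpNorm (itoSum u N - itoSum u n) 2 ν :=
      eLpNorm_congr_ae ((hm N).coeFn_toLp.sub (hm n).coeFn_toLp)
    rw [hae]
    exact (ENNReal.toReal_le_of_le_ofReal (half_pos hε).le (hN N le_rfl n hn)).trans_lt
      (half_lt_self hε)
  obtain ⟨J, hJ⟩ := cauchySeq_tendsto_of_complete hc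
  refine ⟨J, (Lp.stronglyMeasurable J).measurable, Lp.memLp J, ?_⟩
  have := (Lp.tendsto_Lp_iff_tendsto_eLpNorm'' _ hm J (Lp.memLp J)).1 (by
    simpa using hJ)
  exact this

end IsItoIntegrand

/-! ### Calculus and moment bounds of Itô integrals -/

namespace HasItoIntegral

variable {u v : ℝ → PathSpace d → E d} {J J' : PathSpace d → ℝ} {ν : Measure (PathSpace d)}

theorem sub (hu : HasItoIntegral ν u J) (hv : HasItoIntegral ν v J')
    (hum : ∀ n, Measurable (itoSum u n)) (hvm : ∀ n, Measurable (itoSum v n)) :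
    HasItoIntegral ν (fun s γ => u s γ - v s γ) (fun γ => J γ - J' γ) := by
  refine ⟨hu.1.sub hv.1, hu.2.1.sub hv.2.1, ?_⟩
  have h := hu.2.2.add hv.2.2
  rw [add_zero] at h
  refine tendsto_of_tendsto_of_tendsto_of_le_of_le tendsto_const_nhds h (fun _ => zero_le)
    fun n => ?_
  refine le_trans (le_of_eq ?_) (eLpNorm_sub_le (((hum n).sub hu.1).aestronglyMeasurable)
    (((hvm n).sub hv.1).aestronglyMeasurable) (by norm_num))
  congr 1
  funext γ
  simp only [Pi.sub_apply, itoSum_sub]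
  ring

theorem const_smul (hu : HasItoIntegral ν u J) (c : ℝ) :
    HasItoIntegral ν (fun s γ => c • u s γ) (fun γ => c * J γ) := by
  refine ⟨hu.1.const_mul c, hu.2.1.const_mul c, ?_⟩
  have h := ENNReal.Tendsto.const_mul hu.2.2 (a := ‖c‖ₑ) (Or.inr enorm_ne_top)
  rw [mul_zero] at h
  refine h.congr fun n => ?_
  rw [← eLpNorm_const_smul]
  congr 1
  funext γ
  simp only [Pi.smul_apply, itoSum_smul, smul_eq_mul]
  ring

/-- The given sequence `ns` allows extractions to be nested, so that several Itô integrals are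
almost sure limits along one common subsequence. -/
theorem exists_seq_tendsto_ae (hu : HasItoIntegral ν u J) (hum : ∀ n, Measurable (itoSum u n))
    {ns : ℕ → ℕ} (hns : Tendsto ns atTop atTop) :
    ∃ ms : ℕ → ℕ, StrictMono ms ∧
      ∀ᵐ γ ∂ν, Tendsto (fun i => itoSum u (ns (ms i)) γ) atTop (𝓝 (J γ)) := by
  have h1 : Tendsto (fun n => eLpNorm (itoSum u (ns n) - J) 2 ν) atTop (𝓝 0) := hu.2.2.comp hns
  have h2 := tendstoInMeasure_of_tendsto_eLpNorm (by norm_num)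
    (fun n => (hum (ns n)).aestronglyMeasurable) hu.1.aestronglyMeasurable h1
  exact h2.exists_seq_tendsto_ae

theorem ae_eq (hu : HasItoIntegral ν u J) (hu' : HasItoIntegral ν u J')
    (hum : ∀ n, Measurable (itoSum u n)) : J =ᵐ[ν] J' := by
  obtain ⟨ms, hms, h⟩ := hu.exists_seq_tendsto_ae hum tendsto_id
  obtain ⟨ms', hms', h'⟩ := hu'.exists_seq_tendsto_ae hum (ns := ms) hms.tendsto_atTop
  filter_upwards [h, h'] with γ hγ hγ'
  exact tendsto_nhds_unique (hγ.comp hms'.tendsto_atTop) hγ'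

theorem itoIntegral (hu : HasItoIntegral ν u J) : HasItoIntegral ν u (itoIntegral ν u) := by
  have h : ∃ J, HasItoIntegral ν u J := ⟨J, hu⟩
  unfold WienerForm.itoIntegral
  rw [dif_pos h]
  exact h.choose_spec

theorem eLpNorm_le (hu : HasItoIntegral ν u J) (hν : IsWienerMeasure ν) {K : ℝ}
    (hi : IsItoIntegrand u K) {r : ℝ} (hr : 0 ≤ r)
    (hb : ∀ s ∈ Set.Icc (0 : ℝ) 1, ∫ γ, ‖u s γ‖ ^ 2 ∂ν ≤ r ^ 2) :
    eLpNorm J 2 ν ≤ ENNReal.ofReal r := by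
  have := hν.isProbabilityMeasure
  have hle : ∀ n, eLpNorm J 2 ν ≤
      ENNReal.ofReal r + eLpNorm (fun γ => itoSum u n γ - J γ) 2 ν := by
    intro n
    have hm := hi.adapted.measurable_itoSum n
    have e : J = itoSum u n - fun γ => itoSum u n γ - J γ := by funext γ; simp
    conv_lhs => rw [e]
    refine (eLpNorm_sub_le hm.aestronglyMeasurable
      (hm.sub hu.1).aestronglyMeasurable (by norm_num)).trans ?_
    refine add_le_add ?_ le_rfl
    exact hν.eLpNorm_itoSum_le hi.adapted (fun s hs => hi.memLp 2 hs) hr hb n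
  have h := (tendsto_const_nhds (x := ENNReal.ofReal r)).add hu.2.2
  rw [add_zero] at h
  exact ge_of_tendsto' h hle

/-- Fatou's lemma along an almost surely convergent subsequence of Riemann sums, whose exponential
bound does not depend on the level. -/
theorem lintegral_exp_le (hu : HasItoIntegral ν u J) (hν : IsWienerMeasure ν) {K : ℝ}
    (hi : IsItoIntegrand u K) :
    ∫⁻ γ, ENNReal.ofReal (Real.exp (J γ)) ∂ν ≤ ENNReal.ofReal (Real.exp (K ^ 2 / 2)) := by
  obtain ⟨ms, hms, h⟩ := hu.exists_seq_tendsto_ae hi.adapted.measurable_itoSum tendsto_id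
  have hlim : ∀ᵐ γ ∂ν, ENNReal.ofReal (Real.exp (J γ)) ≤
      liminf (fun i => ENNReal.ofReal (Real.exp (itoSum u (ms i) γ))) atTop := by
    filter_upwards [h] with γ hγ
    exact (((ENNReal.continuous_ofReal.comp Real.continuous_exp).tendsto _).comp
      hγ).liminf_eq.ge
  refine (lintegral_mono_ae hlim).trans ((lintegral_liminf_le fun i => by
    have := hi.adapted.measurable_itoSum (ms i)
    fun_prop).trans ?_)
  refine (liminf_le_liminf (v := fun _ => ENNReal.ofReal (Real.exp (K ^ 2 / 2)))
    (.of_forall fun i => ?_)).trans (by simp)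
  have := hν.lintegral_exp_itoPartial_le hi.adapted hi.bound (ms i) _ le_rfl
  refine this.trans (le_of_eq ?_)
  push_cast
  rw [div_self (by positivity), one_mul]

end HasItoIntegral

/-! ### Haar functions -/

theorem le_dyadicFloor_iff {n k : ℕ} {s : ℝ} (hs : 0 ≤ s) :
    (k : ℝ) / 2 ^ n ≤ dyadicFloor n s ↔ (k : ℝ) / 2 ^ n ≤ s := by
  unfold dyadicFloor
  rw [div_le_div_iff_of_pos_right (by positivity), Nat.cast_le, Nat.le_floor_iff (by positivity),
    div_le_iff₀ (by positivity)]

theorem dyadicFloor_eq {n k : ℕ} {s : ℝ} (h1 : (k : ℝ) / 2 ^ n ≤ s)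
    (h2 : s < ((k : ℝ) + 1) / 2 ^ n) : dyadicFloor n s = (k : ℝ) / 2 ^ n := by
  have hs : 0 ≤ s := le_trans (by positivity) h1
  unfold dyadicFloor
  rw [div_le_iff₀ (by positivity)] at h1
  rw [lt_div_iff₀ (by positivity)] at h2
  rw [(Nat.floor_eq_iff (by positivity)).2 ⟨h1, h2⟩]

/-- The breakpoints of the Haar function are multiples of `2^-(m+1)`, and rounding down to a grid at
least as fine never moves a point across one of them. -/
theorem haar_dyadicFloor {r N : ℕ} (hN : Nat.log 2 r + 1 ≤ N) {t : ℝ} (ht : 0 ≤ t) :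
    haar r (dyadicFloor N t) = haar r t := by
  obtain ⟨p, rfl⟩ := Nat.exists_eq_add_of_le hN
  unfold haar
  set m := Nat.log 2 r
  set l := r - 2 ^ m with hl
  have key : ∀ k : ℕ, (k : ℝ) / 2 ^ (m + 1) ≤ dyadicFloor (m + 1 + p) t ↔
      (k : ℝ) / 2 ^ (m + 1) ≤ t := by
    intro k
    have e : (k : ℝ) / 2 ^ (m + 1) = ((k * 2 ^ p : ℕ) : ℝ) / 2 ^ (m + 1 + p) := by
      push_cast; rw [pow_add _ _ p]; field_simp
    rw [e, le_dyadicFloor_iff ht]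
  have e1 : (l : ℝ) / 2 ^ m = ((2 * l : ℕ) : ℝ) / 2 ^ (m + 1) := by
    push_cast; rw [pow_succ]; field_simp
  have e2 : (2 * (l : ℝ) + 1) / 2 ^ (m + 1) = ((2 * l + 1 : ℕ) : ℝ) / 2 ^ (m + 1) := by
    push_cast; rfl
  have e3 : ((l : ℝ) + 1) / 2 ^ m = ((2 * l + 2 : ℕ) : ℝ) / 2 ^ (m + 1) := by
    push_cast; rw [pow_succ]; field_simp
  simp only [← hl, e1, e2, e3, ← not_le, key]

/-- The `L²` normalisation of the Haar functions in discrete form. For `r ≠ 0` exactly two of the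
`2^(m+1)` cells carry the value `2^m`. -/
theorem sum_haar_sq (r : ℕ) :
    ∑ k ∈ Finset.range (2 ^ (Nat.log 2 r + 1)),
      1 / 2 ^ (Nat.log 2 r + 1) * haar r ((k : ℝ) / 2 ^ (Nat.log 2 r + 1)) ^ 2 = 1 := by
  rcases Nat.eq_zero_or_pos r with rfl | hr
  · simp [haar]
  set m := Nat.log 2 r with hm
  have hl : r - 2 ^ m < 2 ^ m := by
    have h1 := Nat.lt_pow_succ_log_self (b := 2) (by norm_num) r
    rw [← hm, pow_succ] at h1
    omega
  set l := r - 2 ^ m with hldef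
  -- The support consists of the cells `2l` and `2l + 1`, that is, of those with integer quotient `k
  -- / 2 = l`.
  have key : ∀ k : ℕ, haar r ((k : ℝ) / 2 ^ (m + 1)) ^ 2 = if k / 2 = l then 2 ^ m else 0 := by
    intro k
    have e1 : (l : ℝ) / 2 ^ m = ((2 * l : ℕ) : ℝ) / 2 ^ (m + 1) := by
      push_cast; rw [pow_succ]; field_simp
    have e2 : (2 * (l : ℝ) + 1) / 2 ^ (m + 1) = ((2 * l + 1 : ℕ) : ℝ) / 2 ^ (m + 1) := by
      push_cast; rfl
    have e3 : ((l : ℝ) + 1) / 2 ^ m = ((2 * l + 2 : ℕ) : ℝ) / 2 ^ (m + 1) := by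
      push_cast; rw [pow_succ]; field_simp
    have hp : (0 : ℝ) < 2 ^ (m + 1) := by positivity
    simp only [haar, hr.ne', if_false, ← hm, ← hldef]
    rw [e1, e2, e3]
    simp only [div_le_div_iff_of_pos_right hp, div_lt_div_iff_of_pos_right hp, Nat.cast_le,
      Nat.cast_lt]
    have hs : Real.sqrt (2 ^ m) ^ 2 = 2 ^ m := Real.sq_sqrt (by positivity)
    split_ifs <;> first | omega | simp [hs]
  simp_rw [key]
  rw [pow_succ' 2 m, sum_range_two_mul]
  have : ∀ k ∈ Finset.range (2 ^ m),
      (1 / 2 ^ (m + 1) * (if 2 * k / 2 = l then (2 : ℝ) ^ m else 0) +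
        1 / 2 ^ (m + 1) * (if (2 * k + 1) / 2 = l then (2 : ℝ) ^ m else 0)) =
      if k = l then 1 else 0 := by
    intro k _
    have h1 : 2 * k / 2 = k := by omega
    have h2 : (2 * k + 1) / 2 = k := by omega
    rw [h1, h2]
    split_ifs
    · rw [pow_succ]; field_simp; norm_num
    · simp
  rw [Finset.sum_congr rfl this, Finset.sum_ite_eq', if_pos (Finset.mem_range.2 hl)]

/-! ### Wiener integrals of Haar functions -/

section HaarVec

variable [NeZero d]

variable (d) in
/-- The dyadic level from which on the `i`-th Haar function is constant on dyadic intervals. -/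
def haarLevel (i : ℕ) : ℕ := Nat.log 2 (i / d) + 1

theorem haarVec_dyadicFloor {i N : ℕ} (hN : haarLevel d i ≤ N) {t : ℝ} (ht : 0 ≤ t) :
    haarVec d i (dyadicFloor N t) = haarVec d i t := by
  unfold haarVec
  rw [haar_dyadicFloor hN ht]

theorem haarVec_eq_grid {i N k : ℕ} (hN : haarLevel d i ≤ N) {t : ℝ} (h1 : (k : ℝ) / 2 ^ N ≤ t)
    (h2 : t < ((k : ℝ) + 1) / 2 ^ N) : haarVec d i t = haarVec d i ((k : ℝ) / 2 ^ N) := by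
  rw [← dyadicFloor_eq h1 h2, haarVec_dyadicFloor hN (le_trans (by positivity) h1)]

/-- A dyadic step integrand has eventually constant Riemann sums. Hence `𝕊_i` has a version that is
a continuous linear functional of the path, with no limit involved. -/
theorem itoSum_haarVec (i p : ℕ) (γ : PathSpace d) :
    itoSum (fun s _ => haarVec d i s) (haarLevel d i + p) γ =
      itoSum (fun s _ => haarVec d i s) (haarLevel d i) γ := by
  induction p with
  | zero => rfl
  | succ p ih =>
    rw [← add_assoc, itoSum_succ, ih]
    intro k _
    rw [← haarVec_dyadicFloor le_rfl (by positivity), dyadicFloor_refine,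
      haarVec_dyadicFloor le_rfl (by positivity)]

variable (d) in
/-- The Wiener integral of the `i`-th Haar function, as a finite linear combination of increments. -/
def haarCoord (i : ℕ) (γ : PathSpace d) : ℝ :=
  itoSum (fun s _ => haarVec d i s) (haarLevel d i) γ

theorem continuous_haarCoord (i : ℕ) : Continuous (haarCoord d i) := by
  unfold haarCoord itoSum
  refine continuous_finsetSum _ fun k _ => ?_
  exact continuous_const.inner ((continuous_pathAt_left _).sub (continuous_pathAt_left _))

theorem isAdapted_haarVec (i : ℕ) : IsAdapted fun s (_ : PathSpace d) => haarVec d i s :=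
  fun _ _ => measurable_const

theorem hasItoIntegral_haarCoord {ν : Measure (PathSpace d)} (hν : IsWienerMeasure ν) (i : ℕ) :
    HasItoIntegral ν (fun s _ => haarVec d i s) (haarCoord d i) := by
  have := hν.isProbabilityMeasure
  refine ⟨(continuous_haarCoord i).measurable,
    hν.memLp_itoSum (isAdapted_haarVec i) (fun s _ => memLp_const _) _, ?_⟩
  refine tendsto_const_nhds.congr' ?_
  filter_upwards [eventually_ge_atTop (haarLevel d i)] with n hn
  obtain ⟨p, rfl⟩ := Nat.exists_eq_add_of_le hn
  simp [itoSum_haarVec, haarCoord]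

theorem hasItoIntegral_wienerCoord {ν : Measure (PathSpace d)} (hν : IsWienerMeasure ν) (i : ℕ) :
    HasItoIntegral ν (fun s _ => haarVec d i s) (wienerCoord ν i) :=
  (hasItoIntegral_haarCoord hν i).itoIntegral

theorem wienerCoord_ae_eq {ν : Measure (PathSpace d)} (hν : IsWienerMeasure ν) (i : ℕ) :
    wienerCoord ν i =ᵐ[ν] haarCoord d i :=
  (hasItoIntegral_wienerCoord hν i).ae_eq (hasItoIntegral_haarCoord hν i)
    (isAdapted_haarVec i).measurable_itoSum

/-! ### Schauder functions -/

theorem pathAt_schauder (i : ℕ) {s : ℝ} (hs : s ∈ Set.Icc (0 : ℝ) 1) :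
    pathAt (schauder d i) s = ∫ u in (0 : ℝ)..s, haarVec d i u :=
  pathAt_coe (schauder d i) ⟨s, hs⟩

/-- The coefficients are the covariances of a Brownian coordinate at time `s` with its increments,
so this is the form in which `S_i(s)` is recognised as a covariance with `haarCoord d i`. -/
theorem pathAt_schauder_eq_sum (i : ℕ) {N : ℕ} (hN : haarLevel d i ≤ N) {s : ℝ}
    (hs : s ∈ Set.Icc (0 : ℝ) 1) :
    pathAt (schauder d i) s = ∑ k ∈ Finset.range (2 ^ N),
      (min s (((k : ℝ) + 1) / 2 ^ N) - min s ((k : ℝ) / 2 ^ N)) •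
        haarVec d i ((k : ℝ) / 2 ^ N) := by
  have h := intervalIntegral.sum_integral_adjacent_intervals (μ := volume) (f := haarVec d i)
    (a := fun k : ℕ => min s ((k : ℝ) / 2 ^ N)) (n := 2 ^ N)
    (fun k _ => intervalIntegrable_haarVec d i _ _)
  have e0 : min s (((0 : ℕ) : ℝ) / 2 ^ N) = 0 := by simp [hs.1]
  have e1 : min s (((2 ^ N : ℕ) : ℝ) / 2 ^ N) = s := by
    push_cast; rw [div_self (by positivity)]; simp [hs.2]
  simp only [e0, e1] at h
  rw [pathAt_schauder i hs, ← h]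
  refine Finset.sum_congr rfl fun k _ => ?_
  push_cast
  rw [← intervalIntegral.integral_const]
  refine intervalIntegral.integral_congr_ae ?_
  have hne : ∀ᵐ x : ℝ, x ≠ min s (((k : ℝ) + 1) / 2 ^ N) := by
    simp [ae_iff, measure_singleton]
  filter_upwards [hne] with x hx hmem
  have hle : (k : ℝ) / 2 ^ N ≤ ((k : ℝ) + 1) / 2 ^ N := by gcongr; linarith
  rw [Set.uIoc_of_le (min_le_min_left s hle)] at hmem
  have h2 : x < min s (((k : ℝ) + 1) / 2 ^ N) := lt_of_le_of_ne hmem.2 hx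
  rw [lt_min_iff] at h2
  have h3 := hmem.1
  rw [min_lt_iff] at h3
  refine haarVec_eq_grid hN (le_of_lt (h3.resolve_left (by linarith [h2.1]))) h2.2

theorem schauder_sub_grid (i : ℕ) {N k : ℕ} (hN : haarLevel d i ≤ N) (hk : k + 1 ≤ 2 ^ N) :
    pathAt (schauder d i) (((k : ℝ) + 1) / 2 ^ N) - pathAt (schauder d i) ((k : ℝ) / 2 ^ N) =
      (1 / 2 ^ N : ℝ) • haarVec d i ((k : ℝ) / 2 ^ N) := by
  obtain ⟨h0, h1, h2⟩ := grid_mem hk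
  rw [pathAt_schauder i ⟨h0.trans h1, h2⟩, pathAt_schauder i ⟨h0, h1.trans h2⟩,
    intervalIntegral.integral_interval_sub_left (intervalIntegrable_haarVec d i _ _)
      (intervalIntegrable_haarVec d i _ _),
    show (1 / 2 ^ N : ℝ) = ((k : ℝ) + 1) / 2 ^ N - (k : ℝ) / 2 ^ N by ring,
    ← intervalIntegral.integral_const]
  refine intervalIntegral.integral_congr_ae ?_
  have hne : ∀ᵐ x : ℝ, x ≠ ((k : ℝ) + 1) / 2 ^ N := by
    simp [ae_iff, measure_singleton]
  filter_upwards [hne] with x hx hmem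
  rw [Set.uIoc_of_le h1] at hmem
  exact haarVec_eq_grid hN hmem.1.le (lt_of_le_of_ne hmem.2 hx)

theorem haarCoord_schauder (i : ℕ) : haarCoord d i (schauder d i) = 1 := by
  rw [← sum_haar_sq (i / d)]
  unfold haarCoord itoSum
  refine Finset.sum_congr rfl fun k hk => ?_
  rw [schauder_sub_grid i le_rfl (Finset.mem_range.1 hk), inner_smul_right,
    real_inner_self_eq_norm_sq]
  unfold haarVec haarLevel
  rw [norm_smul, PiLp.norm_single, norm_one, mul_one, Real.norm_eq_abs, sq_abs]

end HaarVec

/-! ### Linear functionals of finitely many path values -/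

/-- Linear functionals that depend on finitely many values of the path only. -/
def IsFinLinear (Y : PathSpace d → ℝ) : Prop :=
  ∃ (I : Finset ℝ) (L : (I → E d) →L[ℝ] ℝ), ∀ γ, Y γ = L (I.restrict (fun s => pathAt γ s))

namespace IsFinLinear

variable {Y Z : PathSpace d → ℝ}

theorem inner_pathAt (x : E d) (s : ℝ) :
    IsFinLinear fun γ : PathSpace d => inner ℝ x (pathAt γ s) :=
  ⟨{s}, (innerSL ℝ x).comp (ContinuousLinearMap.proj (R := ℝ) (φ := fun _ => E d) ⟨s, by simp⟩),
    fun _ => rfl⟩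

theorem add (hY : IsFinLinear Y) (hZ : IsFinLinear Z) : IsFinLinear fun γ => Y γ + Z γ := by
  classical
  obtain ⟨I, L, hL⟩ := hY
  obtain ⟨I', L', hL'⟩ := hZ
  let R : (↥(I ∪ I') → E d) →L[ℝ] (I → E d) := ContinuousLinearMap.pi fun s =>
    ContinuousLinearMap.proj (R := ℝ) (φ := fun _ => E d)
      ⟨s.1, Finset.mem_union_left _ s.2⟩
  let R' : (↥(I ∪ I') → E d) →L[ℝ] (I' → E d) := ContinuousLinearMap.pi fun s =>
    ContinuousLinearMap.proj (R := ℝ) (φ := fun _ => E d)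
      ⟨s.1, Finset.mem_union_right _ s.2⟩
  exact ⟨I ∪ I', L.comp R + L'.comp R', fun γ => by simp only [hL, hL']; rfl⟩

theorem const_mul (hY : IsFinLinear Y) (c : ℝ) : IsFinLinear fun γ => c * Y γ := by
  obtain ⟨I, L, hL⟩ := hY
  exact ⟨I, c • L, fun γ => by simp only [hL]; rfl⟩

theorem sub (hY : IsFinLinear Y) (hZ : IsFinLinear Z) : IsFinLinear fun γ => Y γ - Z γ := by
  simpa [sub_eq_add_neg] using hY.add (hZ.const_mul (-1))

theorem sum {ι : Type*} (s : Finset ι) {Y : ι → PathSpace d → ℝ} (h : ∀ i, IsFinLinear (Y i)) :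
    IsFinLinear fun γ => ∑ i ∈ s, Y i γ := by
  classical
  induction s using Finset.induction_on with
  | empty => exact ⟨∅, 0, fun γ => rfl⟩
  | insert a s ha ih =>
    simp only [Finset.sum_insert ha]
    exact (h a).add ih

theorem haarCoord [NeZero d] (i : ℕ) : IsFinLinear (haarCoord d i) := by
  unfold WienerForm.haarCoord itoSum
  refine sum _ fun k => ?_
  simp only [inner_sub_right]
  exact (inner_pathAt _ _).sub (inner_pathAt _ _)

end IsFinLinear

variable (d) in
/-- Countably many coordinates that determine a path. -/
def denseCoords (γ : PathSpace d) (p : ℕ × Fin d) : ℝ :=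
  inner ℝ (EuclideanSpace.basisFun (Fin d) ℝ p.2)
    (pathAt γ (TopologicalSpace.denseSeq unitInterval p.1 : unitInterval))

/-- A continuous injection of a Polish space is a Borel embedding. Events on path space are
therefore events of countably many Gaussian coordinates, and covariances suffice to prove
independence of the whole path. -/
theorem measurableEmbedding_denseCoords : MeasurableEmbedding (denseCoords d) := by
  refine Continuous.measurableEmbedding ?_ ?_
  · exact continuous_pi fun p => continuous_const.inner (continuous_pathAt_left _)
  · intro γ η h
    have h1 : ∀ n, (γ : C(unitInterval, E d)) (TopologicalSpace.denseSeq unitInterval n) =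
        (η : C(unitInterval, E d)) (TopologicalSpace.denseSeq unitInterval n) := by
      intro n
      rw [← pathAt_coe, ← pathAt_coe]
      ext j
      have := congrFun h (n, j)
      simpa [denseCoords, EuclideanSpace.inner_single_left] using this
    refine Subtype.ext (DFunLike.coe_injective ?_)
    refine (TopologicalSpace.denseRange_denseSeq unitInterval).equalizer
      (γ : C(unitInterval, E d)).continuous (η : C(unitInterval, E d)).continuous (funext h1)

/-! ### The Cameron–Martin formula along Schauder functions -/

section CameronMartin

variable [NeZero d] {ν : Measure (PathSpace d)}

theorem memLp_haarCoord (hν : IsWienerMeasure ν) (i : ℕ) : MemLp (haarCoord d i) 2 ν :=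
  (hasItoIntegral_haarCoord hν i).2.1

/-- `S_i` represents `𝕊_i` through the Brownian covariance. This is exactly what makes the residual
of a path uncorrelated with its coordinate. -/
theorem covariance_inner_haarCoord (hν : IsWienerMeasure ν) (i : ℕ) (x : E d) {s : ℝ}
    (hs : s ∈ Set.Icc (0 : ℝ) 1) :
    cov[fun γ => inner ℝ x (pathAt γ s), haarCoord d i; ν] =
      inner ℝ x (pathAt (schauder d i) s) := by
  have := hν.isProbabilityMeasure
  have h2 : ∀ k : ℕ, MemLp (fun γ : PathSpace d => inner ℝ (haarVec d i ((k : ℝ) / 2 ^ haarLevel d i))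
      (pathAt γ (((k : ℝ) + 1) / 2 ^ haarLevel d i) - pathAt γ ((k : ℝ) / 2 ^ haarLevel d i))) 2 ν := by
    intro k
    simp only [inner_sub_right]
    exact (hν.memLp_two_inner _ _).sub (hν.memLp_two_inner _ _)
  have e : haarCoord d i = fun γ => ∑ k ∈ Finset.range (2 ^ haarLevel d i),
      inner ℝ (haarVec d i ((k : ℝ) / 2 ^ haarLevel d i))
        (pathAt γ (((k : ℝ) + 1) / 2 ^ haarLevel d i) -
          pathAt γ ((k : ℝ) / 2 ^ haarLevel d i)) := rfl
  rw [e, covariance_fun_sum_right' (fun k _ => h2 k) (hν.memLp_two_inner _ _),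
    pathAt_schauder_eq_sum i le_rfl hs, inner_sum]
  refine Finset.sum_congr rfl fun k hk => ?_
  obtain ⟨h0, h1, hle⟩ := grid_mem (Finset.mem_range.1 hk)
  simp only [inner_sub_right]
  rw [covariance_fun_sub_right (hν.memLp_two_inner x _) (hν.memLp_two_inner _ _)
        (hν.memLp_two_inner _ _), hν.covariance_inner hs ⟨h0.trans h1, hle⟩,
    hν.covariance_inner hs ⟨h0, h1.trans hle⟩, inner_smul_right]
  ring

theorem covariance_haarCoord (hν : IsWienerMeasure ν) (i : ℕ) :
    cov[haarCoord d i, haarCoord d i; ν] = 1 := by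
  have := hν.isProbabilityMeasure
  have h2 : ∀ k : ℕ, MemLp (fun γ : PathSpace d => inner ℝ (haarVec d i ((k : ℝ) / 2 ^ haarLevel d i))
      (pathAt γ (((k : ℝ) + 1) / 2 ^ haarLevel d i) - pathAt γ ((k : ℝ) / 2 ^ haarLevel d i))) 2 ν := by
    intro k
    simp only [inner_sub_right]
    exact (hν.memLp_two_inner _ _).sub (hν.memLp_two_inner _ _)
  have e : haarCoord d i = fun γ => ∑ k ∈ Finset.range (2 ^ haarLevel d i),
      inner ℝ (haarVec d i ((k : ℝ) / 2 ^ haarLevel d i))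
        (pathAt γ (((k : ℝ) + 1) / 2 ^ haarLevel d i) -
          pathAt γ ((k : ℝ) / 2 ^ haarLevel d i)) := rfl
  rw [← haarCoord_schauder (d := d) i]
  conv_lhs => enter [1]; rw [e]
  rw [covariance_fun_sum_left' (fun k _ => h2 k) (memLp_haarCoord hν i)]
  conv_rhs => rw [e]
  refine Finset.sum_congr rfl fun k hk => ?_
  obtain ⟨h0, h1, hle⟩ := grid_mem (Finset.mem_range.1 hk)
  simp only [inner_sub_right]
  rw [covariance_fun_sub_left (hν.memLp_two_inner _ _) (hν.memLp_two_inner _ _)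
      (memLp_haarCoord hν i), covariance_inner_haarCoord hν i _ ⟨h0.trans h1, hle⟩,
    covariance_inner_haarCoord hν i _ ⟨h0, h1.trans hle⟩]

variable (d) in
/-- The path with its component along the `i`-th Schauder function removed. -/
def residual (i : ℕ) (γ : PathSpace d) : PathSpace d := γ + (-haarCoord d i γ) • schauder d i

theorem continuous_residual (i : ℕ) : Continuous (residual d i) :=
  (continuous_add_smul _).comp (continuous_id.prodMk (continuous_haarCoord i).neg)

/-- Each scalar coordinate of the residual has covariance `⟨x, S_i(s)⟩ - ⟨x, S_i(s)⟩ · Var 𝕊_i = 0`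
with `𝕊_i`. Joint Gaussianity turns this into independence. -/
theorem indepFun_residual (hν : IsWienerMeasure ν) (i : ℕ) :
    IndepFun (residual d i) (haarCoord d i) ν := by
  have := hν.isProbabilityMeasure
  have key : IndepFun (fun γ (p : ℕ × Fin d) => denseCoords d (residual d i γ) p)
      (fun γ (_ : Unit) => haarCoord d i γ) ν := by
    have hlin : ∀ p, IsFinLinear fun γ => denseCoords d (residual d i γ) p := by
      intro p
      simp only [denseCoords, residual, pathAt_add, pathAt_smul, inner_add_right, inner_smul_right,
        neg_mul, ← sub_eq_add_neg]
      simp_rw [mul_comm (haarCoord d i _)]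
      exact (IsFinLinear.inner_pathAt _ _).sub ((IsFinLinear.haarCoord i).const_mul _)
    refine IsGaussianProcess.indepFun_of_covariance_eq_zero
      (X := fun p γ => denseCoords d (residual d i γ) p) (Y := fun (_ : Unit) γ => haarCoord d i γ)
      ?_ ?_ ?_ ?_
    · refine hν.isGaussianProcess.of_isGaussianProcess ?_
      rintro (p | _)
      · exact hlin p
      · exact IsFinLinear.haarCoord i
    · intro p
      exact ((measurable_pi_apply p).comp (measurableEmbedding_denseCoords.measurable.comp
        (continuous_residual i).measurable)).aemeasurable
    · exact fun _ => (continuous_haarCoord i).measurable.aemeasurable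
    · intro p _
      simp only [denseCoords, residual, pathAt_add, pathAt_smul, inner_add_right, inner_smul_right,
        neg_mul, ← sub_eq_add_neg]
      rw [covariance_fun_sub_left (hν.memLp_two_inner _ _)
        ((memLp_haarCoord hν i).mul_const _) (memLp_haarCoord hν i),
        covariance_inner_haarCoord hν i _ (TopologicalSpace.denseSeq unitInterval p.1).2,
        covariance_mul_const_left, covariance_haarCoord hν i, one_mul, sub_self]
  have h2 := key.comp (φ := id) (ψ := fun z : Unit → ℝ => z ()) measurable_id
    (measurable_pi_apply (X := fun _ : Unit => ℝ) ())
  rw [IndepFun_iff_Indep] at h2 ⊢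
  refine indep_of_indep_of_le_left h2 ?_
  -- The Borel sets of paths are pulled back from the dense coordinates, so independence of the
  -- latter passes to the residual itself.
  rw [← measurableEmbedding_denseCoords.comap_eq, MeasurableSpace.comap_comp]
  exact le_rfl

theorem map_haarCoord (hν : IsWienerMeasure ν) (i : ℕ) :
    ν.map (haarCoord d i) = gaussianReal 0 1 := by
  have := hν.isProbabilityMeasure
  have hG : IsGaussianProcess (fun (_ : Unit) γ => haarCoord d i γ) ν :=
    hν.isGaussianProcess.of_isGaussianProcess fun _ => IsFinLinear.haarCoord i
  have hg := hG.hasGaussianLaw_eval ()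
  have h := hg.map_eq_gaussianReal
  have hv : Var[haarCoord d i; ν] = 1 := by
    rw [← covariance_self (continuous_haarCoord i).measurable.aemeasurable,
      covariance_haarCoord hν i]
  have hm : ∫ γ, haarCoord d i γ ∂ν = 0 := by
    have e : haarCoord d i = fun γ => ∑ k ∈ Finset.range (2 ^ haarLevel d i),
      inner ℝ (haarVec d i ((k : ℝ) / 2 ^ haarLevel d i))
        (pathAt γ (((k : ℝ) + 1) / 2 ^ haarLevel d i) -
          pathAt γ ((k : ℝ) / 2 ^ haarLevel d i)) := rfl
    rw [e, integral_finsetSum]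
    · refine Finset.sum_eq_zero fun k hk => ?_
      obtain ⟨h0, h1, hle⟩ := grid_mem (Finset.mem_range.1 hk)
      exact hν.integral_inner_sub_eq_zero h0 h1 hle measurable_const
    · intro k _
      simp only [inner_sub_right]
      exact ((hν.memLp_two_inner _ _).sub (hν.memLp_two_inner _ _)).integrable (by norm_num)
  have h' : ν.map (haarCoord d i) = gaussianReal (∫ γ, haarCoord d i γ ∂ν)
    Var[haarCoord d i; ν].toNNReal := h
  rw [h', hm, hv, Real.toNNReal_one]

theorem gaussianReal_shift (t : ℝ) :
    (gaussianReal 0 1).map (fun x => x + t) =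
      (gaussianReal 0 1).withDensity fun x => ENNReal.ofReal (Real.exp (t * x - t ^ 2 / 2)) := by
  rw [gaussianReal_map_add_const, zero_add, gaussianReal_of_var_ne_zero _ one_ne_zero,
    gaussianReal_of_var_ne_zero _ one_ne_zero, ← withDensity_mul _ (by fun_prop) (by fun_prop)]
  congr 1
  funext x
  simp only [Pi.mul_apply, gaussianPDF, gaussianPDFReal]
  rw [← ENNReal.ofReal_mul (by positivity), mul_assoc _ (Real.exp _), ← Real.exp_add]
  congr 3
  simp
  ring

/-- The Cameron–Martin formula. -/
theorem map_add_schauder (hν : IsWienerMeasure ν) (i : ℕ) (t : ℝ) :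
    ν.map (fun γ => γ + t • schauder d i) =
      ν.withDensity fun γ => ENNReal.ofReal (Real.exp (t * haarCoord d i γ - t ^ 2 / 2)) := by
  have := hν.isProbabilityMeasure
  have hr := (continuous_residual (d := d) i).measurable
  have hw := (continuous_haarCoord (d := d) i).measurable
  refine Measure.ext_of_lintegral _ fun H hH => ?_
  -- Under `ν` a path is an independent pair of residual and coordinate, and the shift by `t •
  -- schauder d i` acts on the coordinate alone.
  have hprod := (indepFun_iff_map_prod_eq_prod_map_map hr.aemeasurable hw.aemeasurable).1
    (indepFun_residual hν i)
  rw [map_haarCoord hν i] at hprod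
  have hadd := measurable_shift (schauder d i) t
  have hc : Measurable fun p : PathSpace d × ℝ => p.1 + p.2 • schauder d i :=
    (continuous_add_smul _).measurable
  have hc' : Measurable fun p : PathSpace d × ℝ => p.1 + (p.2 + t) • schauder d i :=
    hc.comp (measurable_fst.prodMk (measurable_snd.add_const t))
  have hHc : Measurable fun p : PathSpace d × ℝ => H (p.1 + p.2 • schauder d i) := hH.comp hc
  have hHc' : Measurable fun p : PathSpace d × ℝ => H (p.1 + (p.2 + t) • schauder d i) :=
    hH.comp hc'
  have hrw := hr.prodMk hw
  have hHd : Measurable fun p : PathSpace d × ℝ =>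
      ENNReal.ofReal (Real.exp (t * p.2 - t ^ 2 / 2)) * H (p.1 + p.2 • schauder d i) :=
    Measurable.mul (by fun_prop) hHc
  have hdec : ∀ γ : PathSpace d, residual d i γ + haarCoord d i γ • schauder d i = γ := fun γ => by
    rw [residual, shift_shift, neg_add_cancel, shift_zero]
  have hρ : IsProbabilityMeasure (ν.map (residual d i)) :=
    Measure.isProbabilityMeasure_map hr.aemeasurable
  rw [lintegral_map hH hadd, lintegral_withDensity_eq_lintegral_mul _ (by fun_prop) hH]
  have e1 : ∫⁻ γ, H (γ + t • schauder d i) ∂ν =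
      ∫⁻ p, H (p.1 + (p.2 + t) • schauder d i)
        ∂((ν.map (residual d i)).prod (gaussianReal 0 1)) := by
    rw [← hprod, lintegral_map hHc' hrw]
    refine lintegral_congr fun γ => ?_
    rw [← shift_shift, hdec]
  have e2 : ∫⁻ γ, ((fun γ => ENNReal.ofReal (Real.exp (t * haarCoord d i γ - t ^ 2 / 2))) * H) γ ∂ν =
      ∫⁻ p, ENNReal.ofReal (Real.exp (t * p.2 - t ^ 2 / 2)) * H (p.1 + p.2 • schauder d i)
        ∂((ν.map (residual d i)).prod (gaussianReal 0 1)) := by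
    rw [← hprod, lintegral_map hHd hrw]
    refine lintegral_congr fun γ => ?_
    simp only [Pi.mul_apply, hdec]
  rw [e1, e2, lintegral_prod _ hHc'.aemeasurable,
    lintegral_prod _ hHd.aemeasurable]
  refine lintegral_congr fun η => ?_
  have hHη : Measurable fun x : ℝ => H (η + x • schauder d i) :=
    hHc.comp (measurable_const.prodMk measurable_id)
  have := lintegral_map (μ := gaussianReal 0 1) (f := fun x : ℝ => H (η + x • schauder d i))
    (g := fun x => x + t) hHη (by fun_prop)
  rw [← this, gaussianReal_shift, lintegral_withDensity_eq_lintegral_mul _ (by fun_prop) hHη]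
  rfl

/-- By Cameron–Martin the shifted measure is absolutely continuous, so almost sure limits of Riemann
sums may be evaluated at a shifted path. -/
theorem ae_shift (hν : IsWienerMeasure ν) (i : ℕ) (t : ℝ) {P : PathSpace d → Prop}
    (h : ∀ᵐ γ ∂ν, P γ) : ∀ᵐ γ ∂ν, P (γ + t • schauder d i) := by
  have hadd := measurable_shift (schauder d i) t
  refine ae_of_ae_map hadd.aemeasurable ?_
  rw [map_add_schauder hν i t]
  exact (withDensity_absolutelyContinuous _ _).ae_le h

end CameronMartin

/-! ### Exponential moments -/

section ExpMoments

variable {α ι κ : Type*} [MeasurableSpace α] {ν : Measure α}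

/-- A family of random variables all of whose exponential moments are bounded uniformly. -/
def HasExpMoments (ν : Measure α) (Z : ι → α → ℝ) : Prop :=
  ∀ a : ℝ, ∃ C : ℝ≥0∞, C ≠ ∞ ∧ ∀ i, ∫⁻ x, ENNReal.ofReal (Real.exp (a * |Z i x|)) ∂ν ≤ C

/-- Exponential moments of a sum are controlled by those of the summands at twice the exponent, with
neither independence nor Hölder's inequality. -/
theorem exp_add_le (x y : ℝ) : Real.exp (x + y) ≤ Real.exp (2 * x) + Real.exp (2 * y) := by
  rcases le_total x y with h | h
  · exact (Real.exp_le_exp.2 (by linarith)).trans (le_add_of_nonneg_left (Real.exp_pos _).le)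
  · exact (Real.exp_le_exp.2 (by linarith)).trans (le_add_of_nonneg_right (Real.exp_pos _).le)

namespace HasExpMoments

variable {Y Z : ι → α → ℝ}

theorem add (hY : HasExpMoments ν Y) (hZ : HasExpMoments ν Z)
    (hm : ∀ i, AEMeasurable (Y i) ν) :
    HasExpMoments ν fun i x => Y i x + Z i x := by
  intro a
  obtain ⟨C, hC, h⟩ := hY (2 * |a|)
  obtain ⟨C', hC', h'⟩ := hZ (2 * |a|)
  refine ⟨C + C', ENNReal.add_ne_top.2 ⟨hC, hC'⟩, fun i => ?_⟩
  refine le_trans ?_ (add_le_add (h i) (h' i))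
  rw [← lintegral_add_left' (by have := hm i; fun_prop)]
  refine lintegral_mono fun x => ?_
  rw [← ENNReal.ofReal_add (Real.exp_pos _).le (Real.exp_pos _).le]
  refine ENNReal.ofReal_le_ofReal (le_trans (Real.exp_le_exp.2 ?_)
    ((exp_add_le (|a| * |Y i x|) (|a| * |Z i x|)).trans (by rw [mul_assoc, mul_assoc])))
  rw [← mul_add]
  exact (mul_le_mul_of_nonneg_right (le_abs_self a) (abs_nonneg _)).trans
    (mul_le_mul_of_nonneg_left (abs_add_le _ _) (abs_nonneg a))

theorem const_mul (hY : HasExpMoments ν Y) (c : ℝ) : HasExpMoments ν fun i x => c * Y i x := by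
  intro a
  obtain ⟨C, hC, h⟩ := hY (a * |c|)
  refine ⟨C, hC, fun i => (le_of_eq ?_).trans (h i)⟩
  simp_rw [abs_mul, mul_assoc]

theorem sub (hY : HasExpMoments ν Y) (hZ : HasExpMoments ν Z)
    (hm : ∀ i, AEMeasurable (Y i) ν) :
    HasExpMoments ν fun i x => Y i x - Z i x := by
  simpa [sub_eq_add_neg] using hY.add (hZ.const_mul (-1)) hm

theorem of_bound [IsProbabilityMeasure ν] {K : ℝ} (h : ∀ i x, |Z i x| ≤ K) :
    HasExpMoments ν Z := by
  intro a
  refine ⟨ENNReal.ofReal (Real.exp (|a| * K)), ENNReal.ofReal_ne_top, fun i => ?_⟩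
  calc _ ≤ ∫⁻ _, ENNReal.ofReal (Real.exp (|a| * K)) ∂ν := by
        refine lintegral_mono fun x => ENNReal.ofReal_le_ofReal (Real.exp_le_exp.2 ?_)
        exact (mul_le_mul_of_nonneg_right (le_abs_self a) (abs_nonneg _)).trans
          (mul_le_mul_of_nonneg_left (h i x) (abs_nonneg a))
    _ = _ := by simp

theorem comp (hY : HasExpMoments ν Y) (f : κ → ι) : HasExpMoments ν fun k => Y (f k) := by
  intro a
  obtain ⟨C, hC, h⟩ := hY a
  exact ⟨C, hC, fun k => h (f k)⟩

theorem abs (hY : HasExpMoments ν Y) : HasExpMoments ν fun i x => |Y i x| := by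
  simpa [HasExpMoments] using hY

theorem of_lintegral_exp_le (hm : ∀ i, AEMeasurable (Z i) ν)
    (h : ∀ a : ℝ, ∃ C : ℝ≥0∞, C ≠ ∞ ∧ ∀ i, ∫⁻ x, ENNReal.ofReal (Real.exp (a * Z i x)) ∂ν ≤ C) :
    HasExpMoments ν Z := by
  intro a
  obtain ⟨C, hC, h1⟩ := h a
  obtain ⟨C', hC', h2⟩ := h (-a)
  refine ⟨C + C', ENNReal.add_ne_top.2 ⟨hC, hC'⟩, fun i => ?_⟩
  refine le_trans ?_ (add_le_add (h1 i) (h2 i))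
  rw [← lintegral_add_left' (by have := hm i; fun_prop)]
  refine lintegral_mono fun x => ?_
  rw [← ENNReal.ofReal_add (Real.exp_pos _).le (Real.exp_pos _).le]
  refine ENNReal.ofReal_le_ofReal ?_
  rcases abs_choice (Z i x) with hx | hx <;> rw [hx]
  · exact le_add_of_nonneg_right (Real.exp_pos _).le
  · rw [mul_neg, ← neg_mul]
    exact le_add_of_nonneg_left (Real.exp_pos _).le

/-- Functions dominated by the exponential of such a family are bounded in every `Lᵖ`. -/
theorem eLpNorm_le (hY : HasExpMoments ν Y) (c : ℝ) (p : ℝ≥0∞) (hp : p ≠ ∞) :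
    ∃ C : ℝ≥0∞, C ≠ ∞ ∧ ∀ (i : ι) (f : α → ℝ), (∀ᵐ x ∂ν, |f x| ≤ Real.exp (c * |Y i x|)) →
      eLpNorm f p ν ≤ C := by
  rcases eq_or_ne p 0 with rfl | hp0
  · exact ⟨0, by simp, fun i f _ => by simp⟩
  obtain ⟨C, hC, h⟩ := hY (c * p.toReal)
  refine ⟨C ^ (1 / p.toReal), ENNReal.rpow_ne_top_of_nonneg (by positivity) hC, fun i f hf => ?_⟩
  rw [eLpNorm_eq_lintegral_rpow_enorm_toReal hp0 hp]
  refine ENNReal.rpow_le_rpow (le_trans (lintegral_mono_ae ?_) (h i)) (by positivity)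
  filter_upwards [hf] with x hx
  rw [← ofReal_norm, ENNReal.ofReal_rpow_of_nonneg (norm_nonneg _) ENNReal.toReal_nonneg,
    Real.norm_eq_abs]
  refine ENNReal.ofReal_le_ofReal ?_
  calc _ ≤ Real.exp (c * |Y i x|) ^ p.toReal :=
        Real.rpow_le_rpow (abs_nonneg _) hx ENNReal.toReal_nonneg
    _ = _ := by rw [← Real.exp_mul]; ring_nf

end HasExpMoments

/-- Random variables with moments of every order. -/
def HasMoments (ν : Measure α) (f : α → ℝ) : Prop := ∀ p : ℝ≥0∞, p ≠ ∞ → MemLp f p ν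

namespace HasMoments

variable {f g : α → ℝ}

theorem aestronglyMeasurable (hf : HasMoments ν f) : AEStronglyMeasurable f ν :=
  (hf 1 (by simp)).1

theorem memLp_two (hf : HasMoments ν f) : MemLp f 2 ν := hf 2 (by simp)

theorem integrable (hf : HasMoments ν f) : Integrable f ν :=
  memLp_one_iff_integrable.1 (hf 1 (by simp))

theorem add (hf : HasMoments ν f) (hg : HasMoments ν g) : HasMoments ν fun x => f x + g x :=
  fun p hp => (hf p hp).add (hg p hp)

theorem sub (hf : HasMoments ν f) (hg : HasMoments ν g) : HasMoments ν fun x => f x - g x :=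
  fun p hp => (hf p hp).sub (hg p hp)

theorem mul (hf : HasMoments ν f) (hg : HasMoments ν g) : HasMoments ν fun x => f x * g x := by
  intro p hp
  have h2 : 2 * p ≠ ∞ := ENNReal.mul_ne_top (by simp) hp
  have : ENNReal.HolderTriple (2 * p) (2 * p) p := by
    constructor
    rcases eq_or_ne p 0 with rfl | hp0
    · simp
    rw [ENNReal.mul_inv (by simp) (by simp), ← add_mul, ENNReal.inv_two_add_inv_two, one_mul]
  exact (hg _ h2).mul' (hf _ h2)

theorem const [IsFiniteMeasure ν] (c : ℝ) : HasMoments ν fun _ => c := fun _ _ => memLp_const c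

theorem const_mul (hf : HasMoments ν f) (c : ℝ) : HasMoments ν fun x => c * f x :=
  fun p hp => (hf p hp).const_mul c

theorem sum {s : Finset ι} {F : ι → α → ℝ} (h : ∀ i ∈ s, HasMoments ν (F i)) :
    HasMoments ν fun x => ∑ i ∈ s, F i x :=
  fun p hp => memLp_finsetSum _ fun i hi => h i hi p hp

theorem of_exp {Y : ι → α → ℝ} (hY : HasExpMoments ν Y) (i : ι) (c : ℝ)
    (hf : AEStronglyMeasurable f ν) (h : ∀ᵐ x ∂ν, |f x| ≤ Real.exp (c * |Y i x|)) :
    HasMoments ν f := by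
  intro p hp
  obtain ⟨C, hC, h'⟩ := hY.eLpNorm_le c p hp
  exact ⟨hf, (h' i f h).trans_lt hC.lt_top⟩

theorem of_hasExpMoments {Y : ι → α → ℝ} (hY : HasExpMoments ν Y) (i : ι)
    (hf : AEStronglyMeasurable (Y i) ν) : HasMoments ν (Y i) :=
  of_exp hY i 1 hf (.of_forall fun x => by
    rw [one_mul]; linarith [Real.add_one_le_exp |Y i x|])

end HasMoments

end ExpMoments

/-- A multiple `a J` is the Itô integral of `a u`, which is bounded by `|a| K`. The exponential
bound sees only this constant and is therefore uniform over the family. -/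
theorem hasExpMoments_ito {ν : Measure (PathSpace d)} (hν : IsWienerMeasure ν) {ι : Type*}
    {u : ι → ℝ → PathSpace d → E d} {J : ι → PathSpace d → ℝ} {K : ℝ}
    (hu : ∀ i, IsItoIntegrand (u i) K) (hJ : ∀ i, HasItoIntegral ν (u i) (J i)) :
    HasExpMoments ν J := by
  refine HasExpMoments.of_lintegral_exp_le (fun i => (hJ i).1.aemeasurable) fun a => ?_
  exact ⟨ENNReal.ofReal (Real.exp ((|a| * K) ^ 2 / 2)), ENNReal.ofReal_ne_top, fun i =>
    ((hJ i).const_smul a).lintegral_exp_le hν ((hu i).const_smul a)⟩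

/-! ### `L²` convergence -/

section Conv

variable {α : Type*} [MeasurableSpace α] {ν : Measure α}

theorem tendsto_zero_of_sq {ι : Type*} {l : Filter ι} {f : ι → ℝ≥0∞}
    (h : Tendsto (fun i => f i ^ 2) l (𝓝 0)) : Tendsto f l (𝓝 0) := by
  have h3 := ((ENNReal.continuous_rpow_const (y := (1 / 2 : ℝ))).tendsto 0).comp h
  rw [ENNReal.zero_rpow_of_pos (by norm_num)] at h3
  refine h3.congr fun i => ?_
  simp only [Function.comp]
  rw [← ENNReal.rpow_natCast, ← ENNReal.rpow_mul]
  norm_num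

theorem tendsto_eLpNorm_of_bound {ι : Type*} {l : Filter ι} [l.IsCountablyGenerated]
    {f : ι → α → ℝ} {g : α → ℝ}
    (hf : ∀ᶠ i in l, AEStronglyMeasurable (f i) ν) (hg : MemLp g 2 ν)
    (hb : ∀ᶠ i in l, ∀ᵐ x ∂ν, |f i x| ≤ g x)
    (h : ∀ᵐ x ∂ν, Tendsto (fun i => f i x) l (𝓝 0)) :
    Tendsto (fun i => eLpNorm (f i) 2 ν) l (𝓝 0) := by
  have h2 : Tendsto (fun i => ∫⁻ x, ‖f i x‖ₑ ^ 2 ∂ν) l (𝓝 (∫⁻ _, 0 ∂ν)) := by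
    refine tendsto_lintegral_filter_of_dominated_convergence' (fun x => ‖g x‖ₑ ^ 2) ?_ ?_ ?_ ?_
    · filter_upwards [hf] with i hi
      exact hi.enorm.pow_const 2
    · filter_upwards [hb] with i hi
      filter_upwards [hi] with x hx
      gcongr
      exact enorm_le_iff_norm_le.2 (by
        rw [Real.norm_eq_abs, Real.norm_eq_abs]; exact hx.trans (le_abs_self _))
    · rw [← eLpNorm_two_sq]
      exact ENNReal.pow_ne_top hg.2.ne
    · filter_upwards [h] with x hx
      have := ((continuous_enorm.tendsto _).comp hx)
      have := ENNReal.Tendsto.pow (n := 2) this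
      simpa using this
  rw [lintegral_zero] at h2
  simp_rw [← eLpNorm_two_sq] at h2
  exact tendsto_zero_of_sq h2

/-- Cauchy–Schwarz for `|f² g| · |g|`: the growth of `f` goes into a factor that need only stay
bounded, while `g` keeps an `L²` norm that may tend to zero. -/
theorem eLpNorm_mul_sq_le {f g : α → ℝ} (hf : AEStronglyMeasurable f ν)
    (hg : AEStronglyMeasurable g ν) :
    eLpNorm (fun x => f x * g x) 2 ν ^ 2 ≤
      eLpNorm (fun x => f x ^ 2 * g x) 2 ν * eLpNorm g 2 ν := by
  rw [eLpNorm_two_sq]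
  have h := ENNReal.lintegral_mul_le_Lp_mul_Lq ν (p := 2) (q := 2) ⟨by norm_num, by norm_num, by norm_num⟩
    (f := fun x => ‖f x ^ 2 * g x‖ₑ) (g := fun x => ‖g x‖ₑ)
    ((hf.pow 2).mul hg).enorm hg.enorm
  refine le_trans (le_of_eq ?_) (h.trans (le_of_eq ?_))
  · refine lintegral_congr fun x => ?_
    simp only [Pi.mul_apply, enorm_mul, enorm_pow]
    ring
  · rw [eLpNorm_eq_lintegral_rpow_enorm_toReal (by simp) (by simp),
      eLpNorm_eq_lintegral_rpow_enorm_toReal (by simp) (by simp)]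
    simp

end Conv

/-! ### Riemann sums against Schauder functions -/

theorem measurable_dyadicFloor (n : ℕ) : Measurable (dyadicFloor n) := by
  unfold dyadicFloor
  have : Measurable fun s : ℝ => ((⌊s * 2 ^ n⌋₊ : ℕ) : ℝ) :=
    measurable_from_top.comp (Nat.measurable_floor.comp (measurable_id.mul_const _))
  exact this.div_const _

theorem tendsto_dyadicFloor {s : ℝ} (hs : 0 ≤ s) :
    Tendsto (fun n => dyadicFloor n s) atTop (𝓝 s) := by
  have h : Tendsto (fun n : ℕ => s - (1 / 2 : ℝ) ^ n) atTop (𝓝 (s - 0)) :=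
    tendsto_const_nhds.sub (tendsto_pow_atTop_nhds_zero_of_lt_one (by norm_num) (by norm_num))
  rw [sub_zero] at h
  refine tendsto_of_tendsto_of_tendsto_of_le_of_le h tendsto_const_nhds (fun n => ?_)
    fun n => dyadicFloor_le n hs
  have := sub_dyadicFloor_lt n s
  simp only
  linarith

theorem itoSum_shift (u : ℝ → PathSpace d → E d) (n : ℕ) (γ h : PathSpace d) (t : ℝ) :
    itoSum u n (γ + t • h) = itoSum (fun s γ => u s (γ + t • h)) n γ +
      t * ∑ k ∈ Finset.range (2 ^ n), inner ℝ (u ((k : ℝ) / 2 ^ n) (γ + t • h))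
        (pathAt h (((k : ℝ) + 1) / 2 ^ n) - pathAt h ((k : ℝ) / 2 ^ n)) := by
  unfold itoSum
  rw [Finset.mul_sum, ← Finset.sum_add_distrib]
  refine Finset.sum_congr rfl fun k _ => ?_
  rw [← inner_smul_right, ← inner_add_right]
  congr 1
  simp only [pathAt_add, pathAt_smul]
  module

section Schauder

variable [NeZero d]

/-- On each cell the frozen `v` is constant and the increment of `S_i` is the integral of `g_i`; the
right end point of the cell is a null set. -/
theorem sum_inner_schauder_eq (i n : ℕ) {v : ℝ → E d} (hv : Measurable v) {C : ℝ}
    (hC : ∀ s, ‖v s‖ ≤ C) :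
    ∑ k ∈ Finset.range (2 ^ n), inner ℝ (v ((k : ℝ) / 2 ^ n))
      (pathAt (schauder d i) (((k : ℝ) + 1) / 2 ^ n) - pathAt (schauder d i) ((k : ℝ) / 2 ^ n)) =
    ∫ s in (0 : ℝ)..1, inner ℝ (v (dyadicFloor n s)) (haarVec d i s) := by
  have hm : Measurable fun s => inner ℝ (v (dyadicFloor n s)) (haarVec d i s) :=
    (hv.comp (measurable_dyadicFloor n)).inner ((measurable_haar _).smul_const _)
  have hint : ∀ a b : ℝ, IntervalIntegrable (fun s => inner ℝ (v (dyadicFloor n s)) (haarVec d i s))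
      volume a b := fun a b =>
    (intervalIntegrable_const (c := C * (1 + Real.sqrt (2 ^ Nat.log 2 (i / d))))).mono_fun
      hm.aestronglyMeasurable (.of_forall fun s => by
        refine ((norm_inner_le_norm _ _).trans ?_).trans (le_abs_self _)
        exact mul_le_mul (hC _) (norm_haarVec_le d i s) (norm_nonneg _)
          ((norm_nonneg _).trans (hC 0)))
  have h := intervalIntegral.sum_integral_adjacent_intervals (μ := volume)
    (f := fun s => inner ℝ (v (dyadicFloor n s)) (haarVec d i s))
    (a := fun k : ℕ => (k : ℝ) / 2 ^ n) (n := 2 ^ n) (fun k _ => hint _ _)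
  have e0 : ((0 : ℕ) : ℝ) / 2 ^ n = 0 := by simp
  have e1 : ((2 ^ n : ℕ) : ℝ) / 2 ^ n = 1 := by push_cast; rw [div_self (by positivity)]
  simp only [e0, e1] at h
  rw [← h]
  refine Finset.sum_congr rfl fun k hk => ?_
  obtain ⟨h0, h1, h2⟩ := grid_mem (Finset.mem_range.1 hk)
  push_cast
  rw [pathAt_schauder i ⟨h0.trans h1, h2⟩, pathAt_schauder i ⟨h0, h1.trans h2⟩,
    intervalIntegral.integral_interval_sub_left (intervalIntegrable_haarVec d i _ _)
      (intervalIntegrable_haarVec d i _ _)]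
  have hL := (innerSL ℝ (v ((k : ℝ) / 2 ^ n))).intervalIntegral_comp_comm
    (intervalIntegrable_haarVec d i ((k : ℝ) / 2 ^ n) (((k : ℝ) + 1) / 2 ^ n))
  simp only [innerSL_apply_apply] at hL
  rw [← hL]
  refine intervalIntegral.integral_congr_ae ?_
  have hne : ∀ᵐ x : ℝ, x ≠ ((k : ℝ) + 1) / 2 ^ n := by
    simp [ae_iff, measure_singleton]
  filter_upwards [hne] with x hx hmem
  rw [Set.uIoc_of_le h1] at hmem
  rw [dyadicFloor_eq hmem.1.le (lt_of_le_of_ne hmem.2 hx)]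

theorem tendsto_sum_inner_schauder (i : ℕ) {v : ℝ → E d} (hv : Continuous v) {C : ℝ}
    (hC : ∀ s, ‖v s‖ ≤ C) :
    Tendsto (fun n => ∑ k ∈ Finset.range (2 ^ n), inner ℝ (v ((k : ℝ) / 2 ^ n))
      (pathAt (schauder d i) (((k : ℝ) + 1) / 2 ^ n) - pathAt (schauder d i) ((k : ℝ) / 2 ^ n)))
      atTop (𝓝 (∫ s in (0 : ℝ)..1, inner ℝ (v s) (haarVec d i s))) := by
  simp_rw [sum_inner_schauder_eq i _ hv.measurable hC]
  refine intervalIntegral.tendsto_integral_filter_of_dominated_convergence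
    (fun _ => C * (1 + Real.sqrt (2 ^ Nat.log 2 (i / d)))) ?_ ?_ intervalIntegrable_const ?_
  · refine .of_forall fun n => Measurable.aestronglyMeasurable ?_
    exact (hv.measurable.comp (measurable_dyadicFloor n)).inner ((measurable_haar _).smul_const _)
  · refine .of_forall fun n => .of_forall fun s _ => (norm_inner_le_norm _ _).trans ?_
    exact mul_le_mul (hC _) (norm_haarVec_le d i s) (norm_nonneg _) ((norm_nonneg _).trans (hC 0))
  · refine .of_forall fun s hs => ?_
    rw [Set.uIoc_of_le zero_le_one] at hs
    exact ((hv.tendsto s).comp (tendsto_dyadicFloor hs.1.le)).inner tendsto_const_nhds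

/-- The Itô integral along a path shifted in a Schauder direction. -/
theorem itoIntegral_shift {ν : Measure (PathSpace d)} (hν : IsWienerMeasure ν) (i : ℕ) (t : ℝ)
    {u : ℝ → PathSpace d → E d} {K K' : ℝ} (hu : IsItoIntegrand u K)
    (hu' : IsItoIntegrand (fun s γ => u s (γ + t • schauder d i)) K')
    {J J' : PathSpace d → ℝ} (hJ : HasItoIntegral ν u J)
    (hJ' : HasItoIntegral ν (fun s γ => u s (γ + t • schauder d i)) J') :
    ∀ᵐ γ ∂ν, J (γ + t • schauder d i) = J' γ +
      t * ∫ s in (0 : ℝ)..1, inner ℝ (u s (γ + t • schauder d i)) (haarVec d i s) := by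
  obtain ⟨ms, hms, h⟩ := hJ.exists_seq_tendsto_ae hu.adapted.measurable_itoSum tendsto_id
  -- The second extraction refines the first, so both Riemann sums converge along the same levels
  -- and their exact finite identity passes to the limit.
  obtain ⟨ms', hms', h'⟩ := hJ'.exists_seq_tendsto_ae hu'.adapted.measurable_itoSum
    (ns := ms) hms.tendsto_atTop
  filter_upwards [ae_shift hν i t h, h'] with γ h1 h2
  have h3 := h1.comp hms'.tendsto_atTop
  have h4 := (tendsto_sum_inner_schauder i (hu'.cont γ) (fun s => hu'.bound s γ)).comp
    (hms.tendsto_atTop.comp hms'.tendsto_atTop)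
  have h5 := h2.add (h4.const_mul t)
  refine tendsto_nhds_unique h3 (h5.congr fun n => ?_)
  simp only [Function.comp, id]
  rw [itoSum_shift]

end Schauder

/-! ### Differentiation in the direction of a fixed path -/

/-- The difference quotient of a `C¹` map as an average of its derivative. -/
theorem sub_eq_smul_integral_fderiv {F : Type*} [NormedAddCommGroup F] [NormedSpace ℝ F]
    [CompleteSpace F] {B : E d → F} (hB : ContDiff ℝ 1 B) (x y : E d) (t : ℝ) :
    B (x + t • y) - B x = t • ∫ θ in (0 : ℝ)..1, fderiv ℝ B (x + (θ * t) • y) y := by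
  have hd : ∀ θ ∈ Set.uIcc (0 : ℝ) 1, HasDerivAt (fun θ : ℝ => B (x + (θ * t) • y))
      (t • fderiv ℝ B (x + (θ * t) • y) y) θ := by
    intro θ _
    have h1 : HasDerivAt (fun θ : ℝ => x + (θ * t) • y) (t • y) θ := by
      simpa using (((hasDerivAt_id θ).mul_const t).smul_const y).const_add x
    have h2 := ((hB.differentiable one_ne_zero) (x + (θ * t) • y)).hasFDerivAt
    simpa using! h2.comp_hasDerivAt θ h1
  have hc : Continuous fun θ : ℝ => t • fderiv ℝ B (x + (θ * t) • y) y := by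
    have := hB.continuous_fderiv one_ne_zero
    fun_prop
  have := intervalIntegral.integral_eq_sub_of_hasDerivAt hd (hc.intervalIntegrable 0 1)
  rw [intervalIntegral.integral_smul] at this
  rw [this]
  simp

/-- The averaged derivative of `B` between `x` and `x + t y`, in direction `y`. -/
def avgDeriv {F : Type*} [NormedAddCommGroup F] [NormedSpace ℝ F] (B : E d → F) (t : ℝ)
    (y x : E d) : F := ∫ θ in (0 : ℝ)..1, fderiv ℝ B (x + (θ * t) • y) y

section AvgDeriv

variable {F : Type*} [NormedAddCommGroup F] [NormedSpace ℝ F] {B : E d → F}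

theorem continuous_avgDeriv (hB : ContDiff ℝ 1 B) :
    Continuous fun p : ℝ × E d × E d => avgDeriv B p.1 p.2.1 p.2.2 := by
  unfold avgDeriv
  refine intervalIntegral.continuous_parametric_intervalIntegral_of_continuous'
    (f := fun (p : ℝ × E d × E d) θ => fderiv ℝ B (p.2.2 + (θ * p.1) • p.2.1) p.2.1) ?_ 0 1
  have := hB.continuous_fderiv one_ne_zero
  simp only [Function.uncurry_def]
  fun_prop

theorem norm_avgDeriv_le {C : ℝ} (hC : ∀ x, ‖fderiv ℝ B x‖ ≤ C) (t : ℝ) (y x : E d) :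
    ‖avgDeriv B t y x‖ ≤ C * ‖y‖ := by
  unfold avgDeriv
  have := intervalIntegral.norm_integral_le_of_norm_le_const (a := 0) (b := 1)
    (f := fun θ : ℝ => fderiv ℝ B (x + (θ * t) • y) y) (C := C * ‖y‖) fun θ _ =>
      ((fderiv ℝ B _).le_opNorm y).trans (mul_le_mul_of_nonneg_right (hC _) (norm_nonneg y))
  simpa using this

end AvgDeriv

/-- `∫₀¹ B(γ_s) ds`. -/
def timeIntegral (B : E d → ℝ) (γ : PathSpace d) : ℝ := ∫ s in (0 : ℝ)..1, B (pathAt γ s)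

theorem continuous_timeIntegral {B : E d → ℝ} (hB : Continuous B) :
    Continuous (timeIntegral B) := by
  unfold timeIntegral
  refine intervalIntegral.continuous_parametric_intervalIntegral_of_continuous'
    (f := fun (γ : PathSpace d) s => B (pathAt γ s)) ?_ 0 1
  exact hB.comp (continuous_uncurry_pathAt.comp continuous_swap)

theorem abs_timeIntegral_le {B : E d → ℝ} {C : ℝ} (hC : ∀ x, |B x| ≤ C) (γ : PathSpace d) :
    |timeIntegral B γ| ≤ C := by
  unfold timeIntegral
  have := intervalIntegral.norm_integral_le_of_norm_le_const (a := 0) (b := 1)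
    (f := fun s : ℝ => B (pathAt γ s)) (C := C) fun s _ => hC _
  simpa using this

/-- The difference quotient of `timeIntegral`. -/
def timeIntegralQuot (B : E d → ℝ) (h : PathSpace d) (t : ℝ) (γ : PathSpace d) : ℝ :=
  ∫ s in (0 : ℝ)..1, avgDeriv B t (pathAt h s) (pathAt γ s)

theorem timeIntegral_sub {B : E d → ℝ} (hB : ContDiff ℝ 1 B) (h γ : PathSpace d) (t : ℝ) :
    timeIntegral B (γ + t • h) - timeIntegral B γ = t * timeIntegralQuot B h t γ := by
  unfold timeIntegral timeIntegralQuot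
  have h1 : Continuous fun s => B (pathAt (γ + t • h) s) :=
    hB.continuous.comp (continuous_pathAt _)
  have h2 : Continuous fun s => B (pathAt γ s) := hB.continuous.comp (continuous_pathAt _)
  rw [← intervalIntegral.integral_sub (h1.intervalIntegrable _ _) (h2.intervalIntegrable _ _),
    ← intervalIntegral.integral_const_mul]
  congr 1
  funext s
  rw [pathAt_add, pathAt_smul, sub_eq_smul_integral_fderiv hB]
  rfl

theorem continuous_timeIntegralQuot {B : E d → ℝ} (hB : ContDiff ℝ 1 B) (h : PathSpace d) :
    Continuous fun p : ℝ × PathSpace d => timeIntegralQuot B h p.1 p.2 := by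
  unfold timeIntegralQuot
  refine intervalIntegral.continuous_parametric_intervalIntegral_of_continuous'
    (f := fun (p : ℝ × PathSpace d) s => avgDeriv B p.1 (pathAt h s) (pathAt p.2 s)) ?_ 0 1
  simp only [Function.uncurry_def]
  refine (continuous_avgDeriv hB).comp (Continuous.prodMk (by fun_prop)
    (Continuous.prodMk ((continuous_pathAt h).comp continuous_snd) ?_))
  exact continuous_uncurry_pathAt.comp (continuous_snd.prodMk (continuous_snd.comp continuous_fst))

theorem abs_timeIntegralQuot_le {B : E d → ℝ} {C : ℝ} (hC : ∀ x, ‖fderiv ℝ B x‖ ≤ C)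
    (h : PathSpace d) (t : ℝ) (γ : PathSpace d) : |timeIntegralQuot B h t γ| ≤ C * ‖h‖ := by
  have hC0 : 0 ≤ C := (norm_nonneg (fderiv ℝ B 0)).trans (hC 0)
  have hb : ∀ s ∈ Set.uIoc (0 : ℝ) 1, ‖avgDeriv B t (pathAt h s) (pathAt γ s)‖ ≤ C * ‖h‖ :=
    fun s _ => (norm_avgDeriv_le hC _ _ _).trans
      (mul_le_mul_of_nonneg_left (norm_pathAt_le h s) hC0)
  have := intervalIntegral.norm_integral_le_of_norm_le_const hb
  rw [sub_zero, abs_one, mul_one] at this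
  exact this

section Drift

variable [NeZero d]

/-- `∫₀¹ ⟨b(γ_s + t S_i(s)), g_i(s)⟩ ds`. -/
def driftIntegral (b : E d → E d) (i : ℕ) (t : ℝ) (γ : PathSpace d) : ℝ :=
  ∫ s in (0 : ℝ)..1, inner ℝ (b (pathAt (γ + t • schauder d i) s)) (haarVec d i s)

theorem continuous_driftIntegral {b : E d → E d} (hb : Continuous b) {C : ℝ}
    (hC : ∀ x, ‖b x‖ ≤ C) (i : ℕ) :
    Continuous fun p : ℝ × PathSpace d => driftIntegral b i p.1 p.2 := by
  unfold driftIntegral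
  have hcont : Continuous fun q : (ℝ × PathSpace d) × ℝ =>
      b (pathAt (q.1.2 + q.1.1 • schauder d i) q.2) :=
    hb.comp (continuous_uncurry_pathAt.comp (continuous_snd.prodMk
      ((continuous_add_smul (schauder d i)).comp
        ((continuous_snd.comp continuous_fst).prodMk (continuous_fst.comp continuous_fst)))))
  refine intervalIntegral.continuous_of_dominated_interval
    (bound := fun _ => C * (1 + Real.sqrt (2 ^ Nat.log 2 (i / d)))) ?_ ?_ intervalIntegrable_const ?_
  · intro p
    refine Measurable.aestronglyMeasurable ?_
    exact (hcont.comp (Continuous.prodMk_right p)).measurable.inner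
      ((measurable_haar _).smul_const _)
  · refine fun p => .of_forall fun s _ => (norm_inner_le_norm _ _).trans ?_
    exact mul_le_mul (hC _) (norm_haarVec_le d i s) (norm_nonneg _) ((norm_nonneg _).trans (hC 0))
  · refine .of_forall fun s _ => ?_
    exact (hcont.comp (Continuous.prodMk_left s)).inner continuous_const

theorem abs_driftIntegral_le {b : E d → E d} {C : ℝ} (hC : ∀ x, ‖b x‖ ≤ C) (i : ℕ) (t : ℝ)
    (γ : PathSpace d) :
    |driftIntegral b i t γ| ≤ C * (1 + Real.sqrt (2 ^ Nat.log 2 (i / d))) := by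
  unfold driftIntegral
  have := intervalIntegral.norm_integral_le_of_norm_le_const (a := 0) (b := 1)
    (f := fun s : ℝ => inner ℝ (b (pathAt (γ + t • schauder d i) s)) (haarVec d i s))
    (C := C * (1 + Real.sqrt (2 ^ Nat.log 2 (i / d)))) fun s _ =>
      (norm_inner_le_norm _ _).trans (mul_le_mul (hC _) (norm_haarVec_le d i s) (norm_nonneg _)
        ((norm_nonneg _).trans (hC 0)))
  simpa using this

end Drift

/-! ### Differentiability of the density -/

/-- Bounded `C¹` vector fields with bounded derivative. -/
structure IsCb1 (b : E d → E d) (C : ℝ) : Prop where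
  contDiff : ContDiff ℝ 1 b
  bound : ∀ x, ‖b x‖ ≤ C
  fderiv_bound : ∀ x, ‖fderiv ℝ b x‖ ≤ C

/-- The gradient is the derivative followed by the Riesz isometry, so bounds on the first two
derivatives of `f` become bounds on `b` and its derivative. -/
theorem IsCb2.exists_isCb1 {f : E d → ℝ} (hf : IsCb2 f) : ∃ C, IsCb1 (gradient f) C := by
  let L : StrongDual ℝ (E d) →L[ℝ] E d := LinearMap.mkContinuous
    { toFun := (InnerProductSpace.toDual ℝ (E d)).symm
      map_add' := fun x y => map_add _ x y
      map_smul' := fun c x => by simp } 1 (fun x => by simp)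
  have hL : ∀ x, ‖L x‖ = ‖x‖ := fun x => (InnerProductSpace.toDual ℝ (E d)).symm.norm_map x
  have e : gradient f = fun x => L (fderiv ℝ f x) := rfl
  obtain ⟨C1, h1⟩ := hf.2 1 (by norm_num)
  obtain ⟨C2, h2⟩ := hf.2 2 le_rfl
  have hc : ContDiff ℝ 1 (fderiv ℝ f) := hf.1.fderiv_right (by norm_num)
  refine ⟨max C1 C2, ?_, ?_, ?_⟩
  · rw [e]; exact L.contDiff.comp hc
  · intro x
    rw [e, hL]
    refine le_trans (le_of_eq ?_) ((h1 x).trans (le_max_left _ _))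
    rw [norm_iteratedFDeriv_one]
  · intro x
    have hd : HasFDerivAt (gradient f) (L.comp (fderiv ℝ (fderiv ℝ f) x)) x :=
      L.hasFDerivAt.comp x (hc.differentiable one_ne_zero x).hasFDerivAt
    rw [hd.fderiv]
    refine le_trans ?_ ((h2 x).trans (le_max_right _ _))
    rw [show (2 : ℕ) = 1 + 1 from rfl, ← norm_iteratedFDeriv_fderiv, norm_iteratedFDeriv_one]
    refine ContinuousLinearMap.opNorm_le_bound _ (norm_nonneg _) fun y => ?_
    rw [ContinuousLinearMap.comp_apply, hL]
    exact ContinuousLinearMap.le_opNorm _ y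

theorem abs_exp_sub_one_sub_le (y : ℝ) :
    |Real.exp y - 1 - y| ≤ y ^ 2 * Real.exp |y| := by
  have h0 := Real.add_one_le_exp y
  rw [abs_of_nonneg (by linarith)]
  rcases le_total 0 y with hy | hy
  · rw [abs_of_nonneg hy]
    have h1 := Real.add_one_le_exp (-y)
    have h2 : Real.exp (-y) * Real.exp y = 1 := by rw [← Real.exp_add]; simp
    have h3 := Real.exp_pos y
    nlinarith [mul_le_mul_of_nonneg_right h1 h3.le]
  · rw [abs_of_nonpos hy]
    have h1 := Real.add_one_le_exp (-y)
    have h2 : Real.exp (-y) * Real.exp y = 1 := by rw [← Real.exp_add]; simp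
    have h3 := Real.exp_pos y
    have h4 : Real.exp y * (1 - y) ≤ 1 := by nlinarith
    have h5 : (1 : ℝ) ≤ Real.exp (-y) := Real.one_le_exp (by linarith)
    have h6 : Real.exp y - 1 - y ≤ y ^ 2 := by nlinarith
    nlinarith [sq_nonneg y]

/-! ### The logarithm of the density and its difference quotients -/

section

variable {ν : Measure (PathSpace d)} {b : E d → E d} {C : ℝ}

theorem IsCb1.nonneg (hb : IsCb1 b C) : 0 ≤ C := (norm_nonneg _).trans (hb.bound 0)

theorem IsCb1.contDiff_norm_sq (hb : IsCb1 b C) : ContDiff ℝ 1 fun x => ‖b x‖ ^ 2 :=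
  hb.contDiff.norm_sq ℝ

theorem IsCb1.norm_fderiv_norm_sq_le (hb : IsCb1 b C) (x : E d) :
    ‖fderiv ℝ (fun x => ‖b x‖ ^ 2) x‖ ≤ 2 * C ^ 2 := by
  have h := (hb.contDiff.differentiable one_ne_zero x).hasFDerivAt.norm_sq
  rw [h.fderiv]
  refine ContinuousLinearMap.opNorm_le_bound _ (by have := hb.nonneg; positivity) fun y => ?_
  have h1 : ‖fderiv ℝ b x y‖ ≤ C * ‖y‖ :=
    ((fderiv ℝ b x).le_opNorm y).trans
      (mul_le_mul_of_nonneg_right (hb.fderiv_bound x) (norm_nonneg y))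
  have h2 : ‖inner ℝ (b x) (fderiv ℝ b x y)‖ ≤ C * (C * ‖y‖) :=
    (norm_inner_le_norm _ _).trans (mul_le_mul (hb.bound x) h1 (norm_nonneg _) hb.nonneg)
  have e : (2 • (innerSL ℝ (b x)).comp (fderiv ℝ b x)) y = 2 * inner ℝ (b x) (fderiv ℝ b x y) := by
    simp [two_mul, two_smul]
  rw [e, norm_mul]
  norm_num at h2 ⊢
  nlinarith

theorem IsCb1.isItoIntegrand_shift (hb : IsCb1 b C) (h : PathSpace d) (t : ℝ) :
    IsItoIntegrand (fun s γ => b (pathAt (γ + t • h) s)) C :=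
  isItoIntegrand_comp_pathAt (U := fun s x => b (x + t • pathAt h s))
    (hb.contDiff.continuous.comp (continuous_snd.add
      (((continuous_pathAt h).comp continuous_fst).const_smul t))) fun _ _ => hb.bound _

theorem IsCb1.isItoIntegrand (hb : IsCb1 b C) :
    IsItoIntegrand (fun s γ => b (pathAt γ s)) C :=
  isItoIntegrand_comp_pathAt (U := fun _ x => b x)
    (hb.contDiff.continuous.comp continuous_snd) fun _ _ => hb.bound _

theorem IsCb1.isItoIntegrand_avgDeriv (hb : IsCb1 b C) (h : PathSpace d) (t : ℝ) :
    IsItoIntegrand (fun s γ => avgDeriv b t (pathAt h s) (pathAt γ s)) (C * ‖h‖) :=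
  isItoIntegrand_comp_pathAt (U := fun s x => avgDeriv b t (pathAt h s) x)
    ((continuous_avgDeriv hb.contDiff).comp (continuous_const.prodMk
      (((continuous_pathAt h).comp continuous_fst).prodMk continuous_snd)))
    fun s _ => (norm_avgDeriv_le hb.fderiv_bound _ _ _).trans
      (mul_le_mul_of_nonneg_left (norm_pathAt_le h s) hb.nonneg)

/-- `L²`-continuity of the Itô integral of the averaged derivative. -/
theorem tendsto_eLpNorm_ito_avgDeriv (hν : IsWienerMeasure ν) (hb : IsCb1 b C) (h : PathSpace d)
    {I : ℝ → PathSpace d → ℝ}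
    (hI : ∀ t, HasItoIntegral ν (fun s γ => avgDeriv b t (pathAt h s) (pathAt γ s)) (I t)) :
    Tendsto (fun t => eLpNorm (fun γ => I t γ - I 0 γ) 2 ν) (𝓝 0) (𝓝 0) := by
  have := hν.isProbabilityMeasure
  let w : ℝ → ℝ → PathSpace d → E d := fun t s γ => avgDeriv b t (pathAt h s) (pathAt γ s)
  have hw : ∀ t, IsItoIntegrand (w t) (C * ‖h‖) := fun t => hb.isItoIntegrand_avgDeriv h t
  have hwc : ∀ γ, Continuous fun p : ℝ × ℝ => w p.1 p.2 γ := fun γ =>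
    (continuous_avgDeriv hb.contDiff).comp (continuous_fst.prodMk
      (((continuous_pathAt h).comp continuous_snd).prodMk
        ((continuous_pathAt γ).comp continuous_snd)))
  let q : ℝ × ℝ → ℝ := fun p => ∫ γ, ‖w p.1 p.2 γ - w 0 p.2 γ‖ ^ 2 ∂ν
  have hm : ∀ t s, Measurable (w t s) := fun t s =>
    ((continuous_avgDeriv hb.contDiff).comp (continuous_const.prodMk
      (continuous_const.prodMk (continuous_pathAt_left s)))).measurable
  have hq : Continuous q := by
    refine continuous_of_dominated (bound := fun _ => (2 * (C * ‖h‖)) ^ 2) ?_ ?_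
      (integrable_const _) ?_
    · intro p
      exact (((hm _ _).sub (hm _ _)).norm.pow_const 2).aestronglyMeasurable
    · refine fun p => .of_forall fun γ => ?_
      rw [Real.norm_of_nonneg (by positivity)]
      have h1 := (hw p.1).bound p.2 γ
      have h2 := (hw 0).bound p.2 γ
      gcongr
      exact (norm_sub_le _ _).trans (by linarith)
    · refine .of_forall fun γ => ?_
      have h1 := hwc γ
      have h2 : Continuous fun p : ℝ × ℝ => w 0 p.2 γ :=
        (hwc γ).comp (continuous_const.prodMk continuous_snd)
      exact ((h1.sub h2).norm).pow 2
  rw [ENNReal.tendsto_nhds_zero]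
  intro ε hε
  obtain ⟨r, hr0, hr⟩ := ENNReal.lt_iff_exists_nnreal_btwn.1 hε
  have hr0' : (0 : ℝ) < r := by exact_mod_cast hr0
  -- `q` is jointly continuous and vanishes at `t = 0`; compactness of `[0,1]` makes its smallness
  -- uniform in `s`, as the isometry bound requires.
  have hev : ∀ᶠ t in 𝓝 (0 : ℝ), ∀ s ∈ Set.Icc (0 : ℝ) 1, q (t, s) < (r : ℝ) ^ 2 := by
    refine isCompact_Icc.eventually_forall_of_forall_eventually fun s _ => ?_
    have h0 : q (0, s) = 0 := by simp [q]
    exact (hq.tendsto (0, s)).eventually_lt_const (by rw [h0]; positivity)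
  filter_upwards [hev] with t ht
  refine le_trans ?_ hr.le
  have hsub := (hI t).sub (hI 0) (hw t).adapted.measurable_itoSum (hw 0).adapted.measurable_itoSum
  have := hsub.eLpNorm_le hν ((hw t).sub (hw 0)) hr0'.le (fun s hs => (ht s hs).le)
  rwa [ENNReal.ofReal_coe_nnreal] at this

/-- The logarithm of the density. -/
def logDensity (b : E d → E d) (J : PathSpace d → ℝ) (γ : PathSpace d) : ℝ :=
  J γ - 1 / 2 * timeIntegral (fun x => ‖b x‖ ^ 2) γ

theorem measurable_logDensity (hb : IsCb1 b C) {J : PathSpace d → ℝ} (hJ : Measurable J) :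
    Measurable (logDensity b J) :=
  hJ.sub ((continuous_timeIntegral (hb.contDiff_norm_sq.continuous)).measurable.const_mul _)

theorem hasExpMoments_logDensity (hν : IsWienerMeasure ν) (hb : IsCb1 b C)
    {J : PathSpace d → ℝ} (hJ : HasItoIntegral ν (fun s γ => b (pathAt γ s)) J) :
    HasExpMoments ν fun (_ : Unit) => logDensity b J := by
  have := hν.isProbabilityMeasure
  have h1 : HasExpMoments ν fun (_ : Unit) => J :=
    hasExpMoments_ito hν (fun _ => hb.isItoIntegrand) fun _ => hJ
  have h2 : HasExpMoments ν fun (_ : Unit) => timeIntegral (fun x => ‖b x‖ ^ 2) :=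
    HasExpMoments.of_bound (K := C ^ 2) fun _ γ => abs_timeIntegral_le (fun x => by
      rw [abs_of_nonneg (by positivity)]
      have := hb.bound x
      gcongr) γ
  exact h1.sub (h2.const_mul (1 / 2)) fun _ => hJ.1.aemeasurable

variable [NeZero d]

/-- The logarithmic derivative of the density, before the limit `t → 0`. -/
def logQuot (b : E d → E d) (i : ℕ) (I : ℝ → PathSpace d → ℝ) (t : ℝ) (γ : PathSpace d) : ℝ :=
  I t γ + driftIntegral b i t γ -
    1 / 2 * timeIntegralQuot (fun x => ‖b x‖ ^ 2) (schauder d i) t γ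

/-- The shift enters the integrand, the integrator and the time integral, and contributes the Itô
integral of the averaged derivative, the drift integral and the last quotient respectively. The
identity is exact, so no Taylor remainder arises at this stage. -/
theorem logDensity_shift (hν : IsWienerMeasure ν) (hb : IsCb1 b C) (i : ℕ)
    {J : PathSpace d → ℝ} (hJ : HasItoIntegral ν (fun s γ => b (pathAt γ s)) J)
    {I : ℝ → PathSpace d → ℝ}
    (hI : ∀ t, HasItoIntegral ν
      (fun s γ => avgDeriv b t (pathAt (schauder d i) s) (pathAt γ s)) (I t)) (t : ℝ) :
    ∀ᵐ γ ∂ν, logDensity b J (γ + t • schauder d i) - logDensity b J γ = t * logQuot b i I t γ := by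
  have hu := hb.isItoIntegrand
  have hu' := hb.isItoIntegrand_shift (schauder d i) t
  obtain ⟨J', hJ'⟩ := hu'.exists_hasItoIntegral hν
  have h1 := itoIntegral_shift hν i t hu hu' hJ hJ'
  have h2 := hJ'.sub hJ hu'.adapted.measurable_itoSum hu.adapted.measurable_itoSum
  have h3 := (hI t).const_smul t
  have e : (fun (s : ℝ) (γ : PathSpace d) =>
      b (pathAt (γ + t • schauder d i) s) - b (pathAt γ s)) =
      fun s γ => t • avgDeriv b t (pathAt (schauder d i) s) (pathAt γ s) := by
    funext s γ
    rw [pathAt_add, pathAt_smul, sub_eq_smul_integral_fderiv hb.contDiff]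
    rfl
  rw [e] at h2
  have h4 := h2.ae_eq h3
    ((hb.isItoIntegrand_avgDeriv (schauder d i) t).const_smul t).adapted.measurable_itoSum
  filter_upwards [h1, h4] with γ g1 g4
  have h5 := timeIntegral_sub hb.contDiff_norm_sq (schauder d i) γ t
  unfold logDensity logQuot driftIntegral
  rw [g1]
  linear_combination g4 - 1 / 2 * h5

theorem measurable_logQuot (hb : IsCb1 b C) (i : ℕ) {I : ℝ → PathSpace d → ℝ}
    (hI : ∀ t, Measurable (I t)) (t : ℝ) : Measurable (logQuot b i I t) :=
  ((hI t).add ((continuous_driftIntegral hb.contDiff.continuous hb.bound i).comp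
    (continuous_const.prodMk continuous_id)).measurable).sub
    (((continuous_timeIntegralQuot hb.contDiff_norm_sq (schauder d i)).comp
    (continuous_const.prodMk continuous_id)).measurable.const_mul _)

theorem hasExpMoments_logQuot (hν : IsWienerMeasure ν) (hb : IsCb1 b C) (i : ℕ)
    {I : ℝ → PathSpace d → ℝ}
    (hI : ∀ t, HasItoIntegral ν
      (fun s γ => avgDeriv b t (pathAt (schauder d i) s) (pathAt γ s)) (I t)) :
    HasExpMoments ν (logQuot b i I) := by
  have := hν.isProbabilityMeasure
  have h1 : HasExpMoments ν I :=
    hasExpMoments_ito hν (fun t => hb.isItoIntegrand_avgDeriv (schauder d i) t) hI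
  have h2 : HasExpMoments ν (driftIntegral b i) :=
    HasExpMoments.of_bound fun t γ => abs_driftIntegral_le hb.bound i t γ
  have h3 : HasExpMoments ν (timeIntegralQuot (fun x => ‖b x‖ ^ 2) (schauder d i)) :=
    HasExpMoments.of_bound fun t γ => abs_timeIntegralQuot_le hb.norm_fderiv_norm_sq_le _ t γ
  refine (h1.add h2 fun t => (hI t).1.aemeasurable).sub (h3.const_mul (1 / 2)) fun t => ?_
  exact ((hI t).1.add ((continuous_driftIntegral hb.contDiff.continuous hb.bound i).comp
    (continuous_const.prodMk continuous_id)).measurable).aemeasurable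

/-- The Itô part converges by the isometry. The other two parts are uniformly bounded and jointly
continuous in `t` and the path, so dominated convergence applies. -/
theorem tendsto_eLpNorm_logQuot (hν : IsWienerMeasure ν) (hb : IsCb1 b C) (i : ℕ)
    {I : ℝ → PathSpace d → ℝ}
    (hI : ∀ t, HasItoIntegral ν
      (fun s γ => avgDeriv b t (pathAt (schauder d i) s) (pathAt γ s)) (I t)) :
    Tendsto (fun t => eLpNorm (fun γ => logQuot b i I t γ - logQuot b i I 0 γ) 2 ν)
      (𝓝 0) (𝓝 0) := by
  have := hν.isProbabilityMeasure
  have h1 := tendsto_eLpNorm_ito_avgDeriv hν hb (schauder d i) hI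
  let A : ℝ → PathSpace d → ℝ := fun t γ => driftIntegral b i t γ -
    1 / 2 * timeIntegralQuot (fun x => ‖b x‖ ^ 2) (schauder d i) t γ
  have hAc : Continuous fun p : ℝ × PathSpace d => A p.1 p.2 :=
    (continuous_driftIntegral hb.contDiff.continuous hb.bound i).sub
      ((continuous_timeIntegralQuot hb.contDiff_norm_sq (schauder d i)).const_mul _)
  have hAm : ∀ t, Measurable (A t) := fun t =>
    (hAc.comp (continuous_const.prodMk continuous_id)).measurable
  have hAb : ∃ K, ∀ t γ, |A t γ| ≤ K := by
    refine ⟨C * (1 + Real.sqrt (2 ^ Nat.log 2 (i / d))) +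
      1 / 2 * (2 * C ^ 2 * ‖schauder d i‖), fun t γ => ?_⟩
    have g1 := abs_driftIntegral_le hb.bound i t γ
    have g2 := abs_timeIntegralQuot_le hb.norm_fderiv_norm_sq_le (schauder d i) t γ
    refine (abs_sub _ _).trans ?_
    rw [abs_mul, abs_of_nonneg (by norm_num : (0 : ℝ) ≤ 1 / 2)]
    linarith
  obtain ⟨K, hK⟩ := hAb
  have h2 : Tendsto (fun t => eLpNorm (fun γ => A t γ - A 0 γ) 2 ν) (𝓝 0) (𝓝 0) := by
    refine tendsto_eLpNorm_of_bound (g := fun _ => K + K)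
      (.of_forall fun t => ((hAm t).sub (hAm 0)).aestronglyMeasurable) (memLp_const _) ?_ ?_
    · exact .of_forall fun t => .of_forall fun γ =>
        (abs_sub _ _).trans (add_le_add (hK _ _) (hK _ _))
    · refine .of_forall fun γ => ?_
      have := ((hAc.comp (Continuous.prodMk_left γ)).tendsto 0).sub_const (A 0 γ)
      simpa using! this
  have h3 := h1.add h2
  rw [add_zero] at h3
  refine tendsto_of_tendsto_of_tendsto_of_le_of_le tendsto_const_nhds h3 (fun _ => zero_le)
    fun t => ?_
  refine le_trans (le_of_eq ?_) (eLpNorm_add_le (((hI t).1.sub (hI 0).1).aestronglyMeasurable)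
    (((hAm t).sub (hAm 0)).aestronglyMeasurable) (by norm_num))
  congr 1
  funext γ
  simp only [logQuot, Pi.add_apply, A]
  ring

end

/-! ### From the logarithm to the exponential -/

section

variable {α : Type*} [MeasurableSpace α] {ν : Measure α}

/-- Multiplication by the exponential of a variable with exponential moments preserves
`L²`-convergence of families with exponential moments. -/
theorem tendsto_eLpNorm_exp_mul {X : α → ℝ} {Z : ℝ → α → ℝ} {l : Filter ℝ}
    (hXm : Measurable X) (hZm : ∀ t, Measurable (Z t))
    (hX : HasExpMoments ν fun (_ : Unit) => X) (hZ : HasExpMoments ν Z)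
    (h : Tendsto (fun t => eLpNorm (Z t) 2 ν) l (𝓝 0)) :
    Tendsto (fun t => eLpNorm (fun x => Real.exp (X x) * Z t x) 2 ν) l (𝓝 0) := by
  -- The exponential of this sum dominates `exp (X)² |Z|`, since `|z| ≤ exp |z|`; that is the factor
  -- Cauchy–Schwarz leaves to be bounded uniformly in `t`.
  have hR : HasExpMoments ν fun t x => 2 * |X x| + |Z t x| :=
    ((hX.abs.const_mul 2).comp fun _ : ℝ => ()).add hZ.abs fun _ => by fun_prop
  obtain ⟨D, hD, hb⟩ := hR.eLpNorm_le 1 2 (by simp)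
  refine tendsto_zero_of_sq ?_
  have h0 : Tendsto (fun t => D * eLpNorm (Z t) 2 ν) l (𝓝 (D * 0)) :=
    ENNReal.Tendsto.const_mul h (Or.inr hD)
  rw [mul_zero] at h0
  refine tendsto_of_tendsto_of_tendsto_of_le_of_le tendsto_const_nhds h0 (fun _ => zero_le)
    fun t => ?_
  refine (eLpNorm_mul_sq_le (by fun_prop) (hZm t).aestronglyMeasurable).trans
    (mul_le_mul_left (hb t _ (.of_forall fun x => ?_)) _)
  rw [abs_mul, abs_of_nonneg (by positivity : (0 : ℝ) ≤ Real.exp (X x) ^ 2), one_mul,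
    abs_of_nonneg (by positivity : (0 : ℝ) ≤ 2 * |X x| + |Z t x|), Real.exp_add, ← Real.exp_nat_mul]
  refine mul_le_mul (Real.exp_le_exp.2 ?_) ?_ (abs_nonneg _) (Real.exp_pos _).le
  · push_cast
    exact mul_le_mul_of_nonneg_left (le_abs_self _) (by norm_num)
  · linarith [Real.add_one_le_exp |Z t x|]

/-- The remainder of the difference quotient of `exp` is linear in `t`, with a majorant exponential
in `|x|` and `|D|`. It is meant for variables with exponential moments, where the majorant lies in
`L²`. -/
theorem abs_exp_quot_sub_le {t x D : ℝ} (ht : t ≠ 0) (ht1 : |t| ≤ 1) :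
    |t⁻¹ * (Real.exp (x + t * D) - Real.exp x) - Real.exp x * D| ≤
      |t| * (2 * Real.exp (|x| + 2 * |D|)) := by
  have e : t⁻¹ * (Real.exp (x + t * D) - Real.exp x) - Real.exp x * D =
      Real.exp x * t⁻¹ * (Real.exp (t * D) - 1 - t * D) := by
    rw [Real.exp_add]; field_simp
  have h1 := abs_exp_sub_one_sub_le (t * D)
  have h2 : Real.exp |t * D| ≤ Real.exp |D| := by
    refine Real.exp_le_exp.2 ?_
    rw [abs_mul]
    exact mul_le_of_le_one_left (abs_nonneg _) ht1
  have h3 : D ^ 2 ≤ 2 * Real.exp |D| := by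
    have := Real.quadratic_le_exp_of_nonneg (abs_nonneg D)
    rw [← sq_abs]
    nlinarith [abs_nonneg D]
  have h4 : Real.exp x ≤ Real.exp |x| := Real.exp_le_exp.2 (le_abs_self x)
  have ht0 : 0 < |t| := abs_pos.2 ht
  rw [e, abs_mul, abs_mul, abs_of_pos (Real.exp_pos x), abs_inv]
  calc Real.exp x * |t|⁻¹ * |Real.exp (t * D) - 1 - t * D|
      ≤ Real.exp x * |t|⁻¹ * ((t * D) ^ 2 * Real.exp |t * D|) := by gcongr
    _ = |t| * (Real.exp x * (D ^ 2 * Real.exp |t * D|)) := by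
        rw [mul_pow, ← sq_abs t]; field_simp
    _ ≤ |t| * (Real.exp |x| * ((2 * Real.exp |D|) * Real.exp |D|)) := by gcongr
    _ = |t| * (2 * Real.exp (|x| + 2 * |D|)) := by
        rw [Real.exp_add, two_mul |D|, Real.exp_add]; ring

end

/-! ### Differentiability of the density in `L²` -/

section

variable {ν : Measure (PathSpace d)} {b : E d → E d} {C : ℝ}

theorem HasL2DirDeriv.ae_eq {h : PathSpace d} {Φ ψ ψ' : PathSpace d → ℝ}
    (hΦ : Measurable Φ) (h1 : HasL2DirDeriv ν h Φ ψ) (h2 : HasL2DirDeriv ν h Φ ψ') :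
    ψ =ᵐ[ν] ψ' := by
  have hq : ∀ t : ℝ, AEStronglyMeasurable (fun γ => t⁻¹ * (Φ (γ + t • h) - Φ γ)) ν := fun t =>
    (((hΦ.comp (measurable_shift h t)).sub hΦ).const_mul _).aestronglyMeasurable
  have h3 := h1.2.add h2.2
  rw [add_zero] at h3
  have hle : ∀ t : ℝ, eLpNorm (ψ' - ψ) 2 ν ≤
      eLpNorm (fun γ => t⁻¹ * (Φ (γ + t • h) - Φ γ) - ψ γ) 2 ν +
        eLpNorm (fun γ => t⁻¹ * (Φ (γ + t • h) - Φ γ) - ψ' γ) 2 ν := fun t => by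
    refine le_trans (le_of_eq ?_) (eLpNorm_sub_le ((hq t).sub h1.1.1) ((hq t).sub h2.1.1)
      (by norm_num))
    congr 1
    funext γ
    simp only [Pi.sub_apply]
    ring
  have h0 : eLpNorm (ψ' - ψ) 2 ν = 0 := le_antisymm (ge_of_tendsto' h3 hle) zero_le
  rw [eLpNorm_eq_zero_iff (h2.1.1.sub h1.1.1) (by norm_num)] at h0
  filter_upwards [h0] with γ hγ
  simp only [Pi.sub_apply, Pi.zero_apply] at hγ
  linarith

theorem HasL2DirDeriv.l2DirDeriv {h : PathSpace d} {Φ ψ : PathSpace d → ℝ}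
    (h1 : HasL2DirDeriv ν h Φ ψ) : HasL2DirDeriv ν h Φ (l2DirDeriv ν h Φ) := by
  have ex : ∃ ψ, HasL2DirDeriv ν h Φ ψ := ⟨ψ, h1⟩
  unfold WienerForm.l2DirDeriv
  rw [dif_pos ex]
  exact ex.choose_spec

theorem hasMoments_exp_logDensity (hν : IsWienerMeasure ν) (hb : IsCb1 b C)
    {J : PathSpace d → ℝ} (hJ : HasItoIntegral ν (fun s γ => b (pathAt γ s)) J) :
    HasMoments ν fun γ => Real.exp (logDensity b J γ) := by
  have hm := measurable_logDensity hb hJ.1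
  refine HasMoments.of_exp (hasExpMoments_logDensity hν hb hJ) () 1 (by fun_prop)
    (.of_forall fun γ => ?_)
  rw [abs_of_pos (Real.exp_pos _), one_mul]
  exact Real.exp_le_exp.2 (le_abs_self _)

variable [NeZero d]

/-- The density is differentiable in `L²` in every Schauder direction, and its logarithmic
derivative has moments of every order. -/
theorem exists_hasL2DirDeriv (hν : IsWienerMeasure ν) (hb : IsCb1 b C) (i : ℕ)
    {J : PathSpace d → ℝ} (hJ : HasItoIntegral ν (fun s γ => b (pathAt γ s)) J) :
    ∃ ψ, HasMoments ν ψ ∧ HasL2DirDeriv ν (schauder d i)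
      (fun γ => Real.exp (logDensity b J γ)) fun γ => Real.exp (logDensity b J γ) * ψ γ := by
  have := hν.isProbabilityMeasure
  choose I hI using fun t : ℝ =>
    (hb.isItoIntegrand_avgDeriv (schauder d i) t).exists_hasItoIntegral hν
  have hXm := measurable_logDensity hb hJ.1
  have hDm := measurable_logQuot hb i fun t => (hI t).1
  have hXe := hasExpMoments_logDensity hν hb hJ
  have hDe := hasExpMoments_logQuot hν hb i hI
  have hD0 : HasMoments ν (logQuot b i I 0) :=
    HasMoments.of_hasExpMoments hDe 0 (hDm 0).aestronglyMeasurable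
  refine ⟨logQuot b i I 0, hD0, ((hasMoments_exp_logDensity hν hb hJ).mul hD0).memLp_two, ?_⟩
  have hZe : HasExpMoments ν fun t γ => logQuot b i I t γ - logQuot b i I 0 γ :=
    hDe.sub (hDe.comp fun _ : ℝ => 0) fun t => (hDm t).aemeasurable
  -- The error of the difference quotient splits into `φ (D_t - D_0)`, treated here, and the
  -- remainder of the exponential, whose norm is of order `|t|`.
  have h1 := tendsto_eLpNorm_exp_mul hXm (fun t => (hDm t).sub (hDm 0)) hXe hZe
    (tendsto_eLpNorm_logQuot hν hb i hI)
  have hR : HasExpMoments ν fun t γ => |logDensity b J γ| + 2 * |logQuot b i I t γ| :=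
    (hXe.abs.comp fun _ : ℝ => ()).add (hDe.abs.const_mul 2) fun _ => by fun_prop
  obtain ⟨K, hK, hbound⟩ := hR.eLpNorm_le 1 2 (by simp)
  have h2 : Tendsto (fun t : ℝ => ‖2 * t‖ₑ * K) (𝓝 0) (𝓝 (‖2 * (0 : ℝ)‖ₑ * K)) :=
    ENNReal.Tendsto.mul_const
      ((continuous_enorm.comp (continuous_const.mul continuous_id)).tendsto 0) (Or.inr hK)
  simp only [mul_zero, enorm_zero, zero_mul] at h2
  have h3 := (h1.add h2).mono_left (nhdsWithin_le_nhds (s := {0}ᶜ))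
  rw [add_zero] at h3
  refine tendsto_of_tendsto_of_tendsto_of_le_of_le' tendsto_const_nhds h3
    (.of_forall fun _ => zero_le) ?_
  have hev : ∀ᶠ t : ℝ in 𝓝[≠] 0, t ≠ 0 ∧ |t| ≤ 1 := by
    refine (eventually_mem_nhdsWithin).and (nhdsWithin_le_nhds ?_)
    exact (continuous_abs.tendsto (0 : ℝ)).eventually_le_const (by simp)
  filter_upwards [hev] with t ht
  have hQm : Measurable fun γ => t⁻¹ * (Real.exp (logDensity b J (γ + t • schauder d i)) -
      Real.exp (logDensity b J γ)) - Real.exp (logDensity b J γ) * logQuot b i I t γ := by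
    have := hXm.comp (measurable_shift (schauder d i) t)
    have h' := hDm t
    exact (((Real.measurable_exp.comp this).sub (Real.measurable_exp.comp hXm)).const_mul _).sub
      ((Real.measurable_exp.comp hXm).mul h')
  have hZm : Measurable fun γ => Real.exp (logDensity b J γ) *
      (logQuot b i I t γ - logQuot b i I 0 γ) :=
    (Real.measurable_exp.comp hXm).mul ((hDm t).sub (hDm 0))
  have hrem : eLpNorm (fun γ => t⁻¹ * (Real.exp (logDensity b J (γ + t • schauder d i)) -
      Real.exp (logDensity b J γ)) - Real.exp (logDensity b J γ) * logQuot b i I t γ) 2 ν ≤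
      ‖2 * t‖ₑ * K := by
    have hs := hbound t (fun γ => Real.exp (|logDensity b J γ| + 2 * |logQuot b i I t γ|))
      (.of_forall fun γ => by
        rw [abs_of_pos (Real.exp_pos _), one_mul]
        exact Real.exp_le_exp.2 (le_abs_self _))
    refine le_trans ?_ (mul_le_mul_right hs _)
    rw [← eLpNorm_const_smul]
    refine eLpNorm_mono_ae ?_
    filter_upwards [logDensity_shift hν hb i hJ hI t] with γ hγ
    have hγ' : logDensity b J (γ + t • schauder d i) =
        logDensity b J γ + t * logQuot b i I t γ := by linarith
    rw [hγ', Real.norm_eq_abs]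
    refine (abs_exp_quot_sub_le ht.1 ht.2).trans (le_of_eq ?_)
    simp only [Pi.smul_apply, smul_eq_mul, Real.norm_eq_abs, abs_mul, abs_of_pos (Real.exp_pos _)]
    rw [abs_of_pos (by norm_num : (0 : ℝ) < 2)]
    ring
  rw [add_comm]
  refine le_trans (le_of_eq ?_) ((eLpNorm_add_le hQm.aestronglyMeasurable hZm.aestronglyMeasurable
    (by norm_num)).trans (add_le_add hrem le_rfl))
  congr 1
  funext γ
  simp only [Pi.add_apply]
  ring

end

section

/-! ### Cylindrical functions -/

section Temperate

variable {V W : Type*} [NormedAddCommGroup V] [NormedSpace ℝ V] [NormedAddCommGroup W]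
  [NormedSpace ℝ W]

theorem hasTemperateGrowth_fderiv_apply {f : V → W} (hf : f.HasTemperateGrowth) (v : V) :
    Function.HasTemperateGrowth fun x => fderiv ℝ f x v := by
  have h : Function.HasTemperateGrowth (fderiv ℝ f) := by
    refine ⟨hf.1.fderiv_right (m := (⊤ : ℕ∞)) (by simp), fun n => ?_⟩
    obtain ⟨k, C, h⟩ := hf.2 (n + 1)
    exact ⟨k, C, fun x => by rw [norm_iteratedFDeriv_fderiv]; exact h x⟩
  exact (ContinuousLinearMap.apply ℝ W v).hasTemperateGrowth.comp h

theorem exists_norm_le_of_hasTemperateGrowth {f : V → W} (hf : f.HasTemperateGrowth) :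
    ∃ (k : ℕ) (C : ℝ), 0 ≤ C ∧ ∀ x, ‖f x‖ ≤ C * (1 + ‖x‖) ^ k := by
  obtain ⟨k, C, hC, h⟩ := hf.norm_iteratedFDeriv_le_uniform 0
  exact ⟨k, C, hC, fun x => by simpa using h 0 le_rfl x⟩

end Temperate

/-- The values of a path at the positive dyadic times of level `n`. -/
def gridEval (n : ℕ) (γ : PathSpace d) (j : Fin (2 ^ n)) : E d := pathAt γ (((j : ℕ) + 1) / 2 ^ n)

theorem gridEval_shift (n : ℕ) (γ h : PathSpace d) (t : ℝ) :
    gridEval n (γ + t • h) = gridEval n γ + t • gridEval n h := by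
  funext j
  simp [gridEval]

theorem continuous_gridEval (n : ℕ) : Continuous (gridEval n : PathSpace d → _) :=
  continuous_pi fun _ => continuous_pathAt_left _

/-- Smooth functions of polynomial growth of the path values at the dyadic times of level `n`. -/
def IsCyl (n : ℕ) (F : PathSpace d → ℝ) : Prop :=
  ∃ f : (Fin (2 ^ n) → E d) → ℝ, f.HasTemperateGrowth ∧ ∀ γ, F γ = f (gridEval n γ)

theorem isCyl_of_times {ι : Type*} [Fintype ι] {n : ℕ} {s : ι → ℝ} {f : (ι → E d) → ℝ}
    (hf : f.HasTemperateGrowth) (hs : ∀ j, ∃ l : Fin (2 ^ n), s j = ((l : ℕ) + 1) / 2 ^ n) :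
    IsCyl n fun γ : PathSpace d => f fun j => pathAt γ (s j) := by
  choose l hl using hs
  let R : (Fin (2 ^ n) → E d) →L[ℝ] (ι → E d) := ContinuousLinearMap.pi fun j =>
    ContinuousLinearMap.proj (R := ℝ) (φ := fun _ => E d) (l j)
  refine ⟨f ∘ R, hf.comp R.hasTemperateGrowth, fun γ => ?_⟩
  simp only [Function.comp, hl]
  rfl

namespace IsCyl

variable {n : ℕ} {F G : PathSpace d → ℝ}

theorem mono (hF : IsCyl n F) {m : ℕ} (h : n ≤ m) : IsCyl m F := by
  obtain ⟨f, hf, hF⟩ := hF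
  obtain ⟨p, rfl⟩ := Nat.exists_eq_add_of_le h
  obtain rfl : F = fun γ => f (gridEval n γ) := funext hF
  refine isCyl_of_times (s := fun j : Fin (2 ^ n) => ((j : ℕ) + 1) / 2 ^ n) hf fun j => ?_
  have h1 : 1 ≤ ((j : ℕ) + 1) * 2 ^ p := Nat.mul_pos (Nat.succ_pos _) (by positivity)
  have h2 : ((j : ℕ) + 1) * 2 ^ p ≤ 2 ^ (n + p) := by
    rw [pow_add]
    exact Nat.mul_le_mul_right _ j.2
  refine ⟨⟨((j : ℕ) + 1) * 2 ^ p - 1, by omega⟩, ?_⟩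
  simp only [Nat.cast_sub h1]
  push_cast
  rw [sub_add_cancel, pow_add]
  field_simp

theorem add (hF : IsCyl n F) (hG : IsCyl n G) : IsCyl n (F + G) := by
  obtain ⟨f, hf, hF⟩ := hF
  obtain ⟨g, hg, hG⟩ := hG
  exact ⟨f + g, hf.add hg, fun γ => by simp [hF, hG]⟩

theorem sub (hF : IsCyl n F) (hG : IsCyl n G) : IsCyl n (F - G) := by
  obtain ⟨f, hf, hF⟩ := hF
  obtain ⟨g, hg, hG⟩ := hG
  exact ⟨f - g, hf.sub hg, fun γ => by simp [hF, hG]⟩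

theorem mul (hF : IsCyl n F) (hG : IsCyl n G) : IsCyl n (F * G) := by
  obtain ⟨f, hf, hF⟩ := hF
  obtain ⟨g, hg, hG⟩ := hG
  exact ⟨f * g, hf.mul hg, fun γ => by simp [hF, hG]⟩

theorem const (c : ℝ) : IsCyl n fun _ : PathSpace d => c :=
  ⟨fun _ => c, .const c, fun _ => rfl⟩

theorem continuous (hF : IsCyl n F) : Continuous F := by
  obtain ⟨f, hf, hF⟩ := hF
  rw [funext hF]
  exact hf.1.continuous.comp (continuous_gridEval n)

theorem exists_hasDerivAt (hF : IsCyl n F) (h : PathSpace d) :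
    ∃ f' : (Fin (2 ^ n) → E d) → ℝ, f'.HasTemperateGrowth ∧ ∀ γ t,
      HasDerivAt (fun t : ℝ => F (γ + t • h)) (f' (gridEval n γ + t • gridEval n h)) t := by
  obtain ⟨f, hf, hF⟩ := hF
  refine ⟨fun x => fderiv ℝ f x (gridEval n h), hasTemperateGrowth_fderiv_apply hf _,
    fun γ t => ?_⟩
  simp only [hF, gridEval_shift]
  have h1 : HasDerivAt (fun t : ℝ => gridEval n γ + t • gridEval n h) (gridEval n h) t := by
    simpa using ((hasDerivAt_id t).smul_const (gridEval n h)).const_add (gridEval n γ)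
  exact ((hf.1.differentiable (by simp)) _).hasFDerivAt.comp_hasDerivAt t h1

theorem hasDerivAt (hF : IsCyl n F) (h γ : PathSpace d) (t : ℝ) :
    HasDerivAt (fun t : ℝ => F (γ + t • h)) (dirDeriv h F (γ + t • h)) t := by
  obtain ⟨f', -, hd⟩ := hF.exists_hasDerivAt h
  convert hd γ t using 1
  unfold dirDeriv
  rw [(hd (γ + t • h) 0).deriv, gridEval_shift, zero_smul, add_zero]

theorem hasDerivAt_zero (hF : IsCyl n F) (h γ : PathSpace d) :
    HasDerivAt (fun t : ℝ => F (γ + t • h)) (dirDeriv h F γ) 0 := by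
  simpa [shift_zero] using hF.hasDerivAt h γ 0

theorem dirDeriv (hF : IsCyl n F) (h : PathSpace d) : IsCyl n (dirDeriv h F) := by
  obtain ⟨f', hf', hd⟩ := hF.exists_hasDerivAt h
  refine ⟨f', hf', fun γ => ?_⟩
  unfold WienerForm.dirDeriv
  rw [(hd γ 0).deriv, zero_smul, add_zero]

theorem dirDeriv_sub (hF : IsCyl n F) (hG : IsCyl n G) (h : PathSpace d) :
    WienerForm.dirDeriv h (F - G) = WienerForm.dirDeriv h F - WienerForm.dirDeriv h G :=
  funext fun γ => ((hF.hasDerivAt_zero h γ).sub (hG.hasDerivAt_zero h γ)).deriv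

theorem dirDeriv_mul (hF : IsCyl n F) (hG : IsCyl n G) (h γ : PathSpace d) :
    WienerForm.dirDeriv h (F * G) γ =
      WienerForm.dirDeriv h F γ * G γ + F γ * WienerForm.dirDeriv h G γ := by
  have e := ((hF.hasDerivAt_zero h γ).mul (hG.hasDerivAt_zero h γ)).deriv
  simp only [shift_zero] at e
  exact e

end IsCyl

/-- Arbitrary dyadic times may be completed to the full grid of one level. Grids refine each other,
so two elements of `Y` always share a level, and sums, products and derivatives can be formed there.
-/
theorem mem_cylindrical_iff {F : PathSpace d → ℝ} : F ∈ cylindrical d ↔ ∃ n, IsCyl n F := by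
  constructor
  · rintro ⟨k, s, f, hs, hs0, -, ⟨n, hn⟩, hf, hF⟩
    refine ⟨n, ?_⟩
    obtain rfl : F = fun γ => f fun j => pathAt γ (s j : ℝ) :=
      funext fun γ => by rw [hF]; simp only [pathAt_coe]
    refine isCyl_of_times hf fun j => ?_
    obtain ⟨l, hl⟩ := hn j
    have h0 : (0 : ℝ) < s j := lt_of_lt_of_le (Subtype.coe_lt_coe.2 hs0)
      (Subtype.coe_le_coe.2 (hs.monotone (Fin.zero_le j)))
    have h1 : (s j : ℝ) ≤ 1 := (s j).2.2
    rw [hl] at h0 h1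
    have hl0 : 0 < l := by
      rcases Nat.eq_zero_or_pos l with rfl | h
      · simp at h0
      · exact h
    have hl1 : l ≤ 2 ^ n := by
      rw [div_le_one (by positivity)] at h1
      exact_mod_cast h1
    refine ⟨⟨l - 1, by omega⟩, ?_⟩
    rw [hl]
    simp only [Nat.cast_sub hl0]
    push_cast
    rw [sub_add_cancel]
  · rintro ⟨n, f, hf, hF⟩
    obtain ⟨k, hk⟩ : ∃ k, 2 ^ n = k + 1 := Nat.exists_eq_succ_of_ne_zero (by positivity)
    have hR : (2 : ℝ) ^ n = k + 1 := by exact_mod_cast hk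
    have hmem : ∀ j : Fin (k + 1), ((j : ℝ) + 1) / 2 ^ n ∈ unitInterval := fun j => by
      refine ⟨by positivity, ?_⟩
      rw [div_le_one (by positivity), hR]
      exact_mod_cast j.2
    let R : (Fin (k + 1) → E d) →L[ℝ] (Fin (2 ^ n) → E d) := ContinuousLinearMap.pi fun j =>
      ContinuousLinearMap.proj (R := ℝ) (φ := fun _ => E d) (Fin.cast hk j)
    refine ⟨k, fun j => ⟨((j : ℝ) + 1) / 2 ^ n, hmem j⟩, f ∘ R, ?_, ?_, ?_, ⟨n, fun j =>
      ⟨j + 1, by push_cast; rfl⟩⟩, hf.comp R.hasTemperateGrowth, fun γ => ?_⟩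
    · intro i j hij
      refine Subtype.coe_lt_coe.1 ?_
      change ((i : ℕ) + 1 : ℝ) / 2 ^ n < ((j : ℕ) + 1) / 2 ^ n
      have : ((i : ℕ) : ℝ) < (j : ℕ) := by exact_mod_cast hij
      gcongr
    · refine Subtype.coe_lt_coe.1 ?_
      change (0 : ℝ) < (((0 : Fin (k + 1)) : ℕ) + 1 : ℝ) / 2 ^ n
      positivity
    · refine Subtype.ext ?_
      change ((Fin.last k : ℕ) + 1 : ℝ) / 2 ^ n = 1
      rw [hR, Fin.val_last, div_self (by positivity)]
    · rw [hF]
      simp only [Function.comp]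
      congr 1
      funext j
      exact pathAt_coe γ ⟨_, hmem (Fin.cast hk j)⟩

/-! ### Schauder functions at dyadic times -/

/-- A nonconstant Haar function has mean zero on every cell of its level `m`: the cell holds one
positive and one negative half, or misses the support. -/
theorem haar_add_haar_eq_zero {r : ℕ} (hr : r ≠ 0) (q : ℕ) :
    haar r (((2 * q : ℕ) : ℝ) / 2 ^ (Nat.log 2 r + 1)) +
      haar r (((2 * q + 1 : ℕ) : ℝ) / 2 ^ (Nat.log 2 r + 1)) = 0 := by
  set m := Nat.log 2 r with hm
  set l := r - 2 ^ m with hldef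
  have e1 : (l : ℝ) / 2 ^ m = ((2 * l : ℕ) : ℝ) / 2 ^ (m + 1) := by
    push_cast; rw [pow_succ]; field_simp
  have e2 : (2 * (l : ℝ) + 1) / 2 ^ (m + 1) = ((2 * l + 1 : ℕ) : ℝ) / 2 ^ (m + 1) := by
    push_cast; rfl
  have e3 : ((l : ℝ) + 1) / 2 ^ m = ((2 * l + 2 : ℕ) : ℝ) / 2 ^ (m + 1) := by
    push_cast; rw [pow_succ]; field_simp
  have hp : (0 : ℝ) < 2 ^ (m + 1) := by positivity
  simp only [haar, hr, if_false, ← hm, ← hldef]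
  rw [e1, e2, e3]
  simp only [div_le_div_iff_of_pos_right hp, div_lt_div_iff_of_pos_right hp, Nat.cast_le,
    Nat.cast_lt]
  split_ifs <;> first | omega | simp

variable [NeZero d]

/-- Since the Haar function has mean zero on each cell of its level, its primitive returns to zero
at every grid point of that level. -/
theorem pathAt_schauder_eq_zero {i : ℕ} (hi : i / d ≠ 0) {q : ℕ} (hq : q ≤ 2 ^ Nat.log 2 (i / d)) :
    pathAt (schauder d i) ((q : ℝ) / 2 ^ Nat.log 2 (i / d)) = 0 := by
  set m := Nat.log 2 (i / d) with hm
  induction q with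
  | zero => simp [pathAt_zero]
  | succ q ih =>
    have ih := ih (by omega)
    have hN : haarLevel d i = m + 1 := rfl
    have h1 := schauder_sub_grid i (N := m + 1) (k := 2 * q) hN.le (by rw [pow_succ]; omega)
    have h2 := schauder_sub_grid i (N := m + 1) (k := 2 * q + 1) hN.le (by rw [pow_succ]; omega)
    have e1 : ((2 * q : ℕ) : ℝ) / 2 ^ (m + 1) = (q : ℝ) / 2 ^ m := by
      push_cast; rw [pow_succ]; field_simp
    have e2 : (((2 * q + 1 : ℕ) : ℝ) + 1) / 2 ^ (m + 1) = ((q + 1 : ℕ) : ℝ) / 2 ^ m := by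
      push_cast; rw [pow_succ]; field_simp; ring
    have e3 : ((2 * q : ℕ) : ℝ) + 1 = ((2 * q + 1 : ℕ) : ℝ) := by push_cast; rfl
    have e4 : haarVec d i (((2 * q : ℕ) : ℝ) / 2 ^ (m + 1)) +
        haarVec d i (((2 * q + 1 : ℕ) : ℝ) / 2 ^ (m + 1)) = 0 := by
      unfold haarVec
      rw [← add_smul, hm, haar_add_haar_eq_zero hi, zero_smul]
    rw [e3] at h1
    rw [e2] at h2
    have h3 := congrArg₂ (· + ·) h1 h2
    simp only [← smul_add, e4, smul_zero] at h3
    rw [e1, ih] at h3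
    simpa using h3

/-- The hypothesis gives `n ≤ log₂ (i / d)`, so the grid of level `n` sits inside the zero set of
`S_i`. This makes the form and the generator finite sums on `Y`. -/
theorem gridEval_schauder {i n : ℕ} (h : 2 ^ n ≤ i / d) : gridEval n (schauder d i) = 0 := by
  funext j
  have hpos : 0 < 2 ^ n := by positivity
  have hi : i / d ≠ 0 := by omega
  obtain ⟨p, hp⟩ := Nat.exists_eq_add_of_le ((Nat.le_log_iff_pow_le (by norm_num) hi).2 h)
  have h1 : ((j : ℕ) + 1) * 2 ^ p ≤ 2 ^ Nat.log 2 (i / d) := by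
    rw [hp, pow_add]
    exact Nat.mul_le_mul_right _ j.2
  have h2 := pathAt_schauder_eq_zero hi h1
  have e : ((((j : ℕ) + 1) * 2 ^ p : ℕ) : ℝ) / 2 ^ Nat.log 2 (i / d) = ((j : ℕ) + 1) / 2 ^ n := by
    rw [hp, pow_add]
    push_cast
    field_simp
  rw [e] at h2
  exact h2

theorem IsCyl.dirDeriv_schauder_eq_zero {n i : ℕ} {F : PathSpace d → ℝ} (hF : IsCyl n F)
    (h : 2 ^ n ≤ i / d) (γ : PathSpace d) : WienerForm.dirDeriv (schauder d i) F γ = 0 := by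
  obtain ⟨f, hf, hF⟩ := hF
  unfold WienerForm.dirDeriv
  simp only [hF, gridEval_shift, gridEval_schauder h, smul_zero, add_zero, deriv_const]

end

section

/-! ### Moments of cylindrical functions -/

section

variable {α : Type*} [MeasurableSpace α] {ν : Measure α} {f g : α → ℝ}

theorem HasMoments.mono (hg : HasMoments ν g) (hf : AEStronglyMeasurable f ν)
    (h : ∀ x, |f x| ≤ g x) : HasMoments ν f := fun p hp =>
  (hg p hp).mono hf (.of_forall fun x => (h x).trans (le_abs_self _))

theorem HasMoments.pow [IsFiniteMeasure ν] (hf : HasMoments ν f) (k : ℕ) :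
    HasMoments ν fun x => f x ^ k := by
  induction k with
  | zero => simpa using HasMoments.const 1
  | succ k ih => simpa only [pow_succ] using ih.mul hf

theorem integrable_fun_mul (hf : MemLp f 2 ν) (hg : MemLp g 2 ν) :
    Integrable (fun x => f x * g x) ν :=
  hf.integrable_mul hg

/-- Hölder's inequality turns `L²`-convergence of the factors into convergence of integrals. -/
theorem tendsto_integral_mul {ι : Type*} {l : Filter ι} {F G : ι → α → ℝ}
    (hf : MemLp f 2 ν) (hg : MemLp g 2 ν) (hF : ∀ᶠ i in l, MemLp (F i) 2 ν)
    (hG : ∀ᶠ i in l, MemLp (G i) 2 ν)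
    (hFf : Tendsto (fun i => eLpNorm (F i - f) 2 ν) l (𝓝 0))
    (hGg : Tendsto (fun i => eLpNorm (G i - g) 2 ν) l (𝓝 0)) :
    Tendsto (fun i => ∫ x, F i x * G i x ∂ν) l (𝓝 (∫ x, f x * g x ∂ν)) := by
  have hol : ∀ {u v : α → ℝ}, MemLp u 2 ν → MemLp v 2 ν →
      eLpNorm (u * v) 1 ν ≤ eLpNorm u 2 ν * eLpNorm v 2 ν := fun hu hv => by
    have := eLpNorm_smul_le_mul_eLpNorm (p := 2) (q := 2) (r := 1) hv.1 hu.1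
    exact this
  have h1 := ((ENNReal.Tendsto.mul hFf (Or.inr (by simp)) hGg (Or.inr (by simp))).add
    (ENNReal.Tendsto.mul_const hFf (Or.inr hg.2.ne))).add
    (ENNReal.Tendsto.const_mul (a := eLpNorm f 2 ν) hGg (Or.inr hf.2.ne))
  simp only [mul_zero, zero_mul, add_zero] at h1
  refine tendsto_integral_of_L1' _ (hf.1.mul hg.1) ?_
    (tendsto_of_tendsto_of_tendsto_of_le_of_le' tendsto_const_nhds h1 (.of_forall fun _ => zero_le) ?_)
  · filter_upwards [hF, hG] with i hi hi'
    exact hi.integrable_mul hi'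
  · filter_upwards [hF, hG] with i hi hi'
    have e : (fun x => F i x * G i x) - (fun x => f x * g x) =
        (F i - f) * (G i - g) + (F i - f) * g + f * (G i - g) := by
      funext x
      simp only [Pi.sub_apply, Pi.add_apply, Pi.mul_apply]
      ring
    have hu := hi.sub hf
    have hv := hi'.sub hg
    change eLpNorm ((fun x => F i x * G i x) - (fun x => f x * g x)) 1 ν ≤ _
    rw [e]
    refine (eLpNorm_add_le ((hu.1.mul hv.1).add (hu.1.mul hg.1)) (hf.1.mul hv.1) le_rfl).trans
      (add_le_add ((eLpNorm_add_le (hu.1.mul hv.1) (hu.1.mul hg.1) le_rfl).trans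
        (add_le_add (hol hu hv) (hol hu hg))) (hol hf hv))

end

variable {ν : Measure (PathSpace d)}

theorem IsWienerMeasure.hasMoments_norm_pathAt (hν : IsWienerMeasure ν) {s : ℝ} (h0 : 0 ≤ s)
    (h1 : s ≤ 1) : HasMoments ν fun γ => ‖pathAt γ s‖ := by
  intro p hp
  have hl := hν.hasLaw_pathAt h0 h1
  have hg : MemLp id p (incrLaw d s) := IsGaussian.memLp_id (incrLaw d s) p hp
  rw [← hl.map_eq] at hg
  exact ((memLp_map_measure_iff hg.1 hl.aemeasurable).1 hg).norm

theorem IsWienerMeasure.hasMoments_gridEval (hν : IsWienerMeasure ν) (n k : ℕ) (C c : ℝ) :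
    HasMoments ν fun γ : PathSpace d => C * (c + ‖gridEval n γ‖) ^ k := by
  have := hν.isProbabilityMeasure
  refine HasMoments.const_mul (HasMoments.pow ((HasMoments.const c).add ?_) k) C
  refine HasMoments.mono (HasMoments.sum (s := Finset.univ) fun (j : Fin (2 ^ n)) _ =>
    hν.hasMoments_norm_pathAt (s := ((j : ℕ) + 1) / 2 ^ n) (by positivity) ?_) ?_ fun γ => ?_
  · rw [div_le_one (by positivity)]
    exact_mod_cast j.2
  · exact (continuous_norm.comp (continuous_gridEval n)).aestronglyMeasurable
  · rw [abs_of_nonneg (norm_nonneg _), pi_norm_le_iff_of_nonneg (by positivity)]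
    exact fun j => Finset.single_le_sum (f := fun j : Fin (2 ^ n) => ‖gridEval n γ j‖)
      (fun _ _ => norm_nonneg _) (Finset.mem_univ j)

theorem IsCyl.hasMoments (hν : IsWienerMeasure ν) {n : ℕ} {F : PathSpace d → ℝ}
    (hF : IsCyl n F) : HasMoments ν F := by
  have hc := hF.continuous
  obtain ⟨f, hf, hF⟩ := hF
  obtain ⟨k, C, hC, hb⟩ := exists_norm_le_of_hasTemperateGrowth hf
  refine (hν.hasMoments_gridEval n k C 1).mono hc.aestronglyMeasurable fun γ => ?_
  rw [hF]
  exact hb _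

/-- For `|t| ≤ 1` the mean value inequality dominates the difference quotients by one polynomial in
the grid values, which has all Gaussian moments; dominated convergence does the rest. -/
theorem IsCyl.hasL2DirDeriv (hν : IsWienerMeasure ν) {n : ℕ} {F : PathSpace d → ℝ}
    (hF : IsCyl n F) (h : PathSpace d) : HasL2DirDeriv ν h F (WienerForm.dirDeriv h F) := by
  refine ⟨((hF.dirDeriv h).hasMoments hν).memLp_two, ?_⟩
  obtain ⟨f', hf', hd⟩ := hF.exists_hasDerivAt h
  obtain ⟨k, C, hC, hb⟩ := exists_norm_le_of_hasTemperateGrowth hf'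
  have hd0 : ∀ γ, WienerForm.dirDeriv h F γ = f' (gridEval n γ) := fun γ => by
    unfold WienerForm.dirDeriv
    rw [(hd γ 0).deriv, zero_smul, add_zero]
  have hB : ∀ γ (t : ℝ), |t| ≤ 1 → ‖f' (gridEval n γ + t • gridEval n h)‖ ≤
      C * ((1 + ‖gridEval n h‖) + ‖gridEval n γ‖) ^ k := fun γ t ht => by
    refine (hb _).trans ?_
    have h1 : ‖gridEval n γ + t • gridEval n h‖ ≤ ‖gridEval n γ‖ + ‖gridEval n h‖ := by
      refine (norm_add_le _ _).trans (add_le_add le_rfl ?_)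
      rw [norm_smul, Real.norm_eq_abs]
      exact mul_le_of_le_one_left (norm_nonneg _) ht
    refine mul_le_mul_of_nonneg_left (pow_le_pow_left₀ (by positivity) (by linarith) k) hC
  have hmeas : ∀ t : ℝ, Measurable fun γ => F (γ + t • h) := fun t =>
    hF.continuous.measurable.comp (measurable_shift h t)
  refine tendsto_eLpNorm_of_bound (g := fun γ =>
    2 * (C * ((1 + ‖gridEval n h‖) + ‖gridEval n γ‖) ^ k)) (.of_forall fun t => ?_)
    ((hν.hasMoments_gridEval n k C _).const_mul 2).memLp_two ?_ (.of_forall fun γ => ?_)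
  · exact ((((hmeas t).sub hF.continuous.measurable).const_mul _).sub
      (hF.dirDeriv h).continuous.measurable).aestronglyMeasurable
  · have hev : ∀ᶠ t : ℝ in 𝓝[≠] 0, t ≠ 0 ∧ |t| ≤ 1 := by
      refine (eventually_mem_nhdsWithin).and (nhdsWithin_le_nhds ?_)
      exact (continuous_abs.tendsto (0 : ℝ)).eventually_le_const (by simp)
    filter_upwards [hev] with t ht
    refine .of_forall fun γ => ?_
    have hmv := (convex_Icc (-1 : ℝ) 1).norm_image_sub_le_of_norm_hasDerivWithin_le
      (f := fun t : ℝ => F (γ + t • h)) (x := 0) (y := t)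
      (fun s _ => (hd γ s).hasDerivWithinAt) (fun s hs => hB γ s (abs_le.2 hs))
      (abs_le.1 (by simp)) (abs_le.1 ht.2)
    simp only [shift_zero, sub_zero, Real.norm_eq_abs] at hmv
    have ht0 : 0 < |t| := abs_pos.2 ht.1
    have h1 : |t⁻¹ * (F (γ + t • h) - F γ)| ≤
        C * ((1 + ‖gridEval n h‖) + ‖gridEval n γ‖) ^ k := by
      rw [abs_mul, abs_inv, inv_mul_le_iff₀ ht0, mul_comm]
      exact hmv
    have h2 : |WienerForm.dirDeriv h F γ| ≤ C * ((1 + ‖gridEval n h‖) + ‖gridEval n γ‖) ^ k := by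
      have := hB γ 0 (by simp)
      rwa [zero_smul, add_zero, ← hd0, Real.norm_eq_abs] at this
    refine (abs_sub _ _).trans ?_
    linarith
  · have h1 := (hF.hasDerivAt_zero h γ).tendsto_slope_zero
    simp only [zero_add, shift_zero, smul_eq_mul] at h1
    simpa using h1.sub_const (WienerForm.dirDeriv h F γ)

/-! ### Integration by parts -/

section IBP

variable [NeZero d]

theorem hasExpMoments_haarCoord (hν : IsWienerMeasure ν) (i : ℕ) :
    HasExpMoments ν fun (_ : Unit) => haarCoord d i := by
  have hm := (continuous_haarCoord (d := d) i).measurable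
  refine HasExpMoments.of_lintegral_exp_le (fun _ => hm.aemeasurable) fun a => ?_
  refine ⟨∫⁻ x, ENNReal.ofReal (Real.exp (a * x)) ∂gaussianReal 0 1, ?_, fun _ => ?_⟩
  · have h := (integrable_exp_mul_gaussianReal (μ := 0) (v := 1) a).lintegral_lt_top
    exact h.ne
  · rw [← map_haarCoord hν i, lintegral_map (by fun_prop) hm]

theorem hasMoments_haarCoord (hν : IsWienerMeasure ν) (i : ℕ) : HasMoments ν (haarCoord d i) :=
  HasMoments.of_hasExpMoments (hasExpMoments_haarCoord hν i) ()
    (continuous_haarCoord i).aestronglyMeasurable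

/-- The `L²` derivative of the Cameron–Martin density at `t = 0`; it is the source of the term `-𝕊_i
∂_i F` in the generator. -/
theorem tendsto_cameronMartin_quot (hν : IsWienerMeasure ν) (i : ℕ) :
    Tendsto (fun t : ℝ => eLpNorm ((fun γ => t⁻¹ * (Real.exp (t * haarCoord d i γ - t ^ 2 / 2) - 1)) -
      haarCoord d i) 2 ν) (𝓝[≠] 0) (𝓝 0) := by
  have := hν.isProbabilityMeasure
  have hm := (continuous_haarCoord (d := d) i).measurable
  have hev : ∀ᶠ t : ℝ in 𝓝[≠] 0, t ≠ 0 ∧ |t| ≤ 1 := by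
    refine (eventually_mem_nhdsWithin).and (nhdsWithin_le_nhds ?_)
    exact (continuous_abs.tendsto (0 : ℝ)).eventually_le_const (by simp)
  refine tendsto_eLpNorm_of_bound (g := fun γ => 3 * Real.exp (2 * (|haarCoord d i γ| + 1)))
    (.of_forall fun t => ?_) ?_ ?_ (.of_forall fun γ => ?_)
  · exact ((by fun_prop : Measurable fun γ =>
      t⁻¹ * (Real.exp (t * haarCoord d i γ - t ^ 2 / 2) - 1)).sub hm).aestronglyMeasurable
  · have hE : HasExpMoments ν fun (_ : Unit) γ => |haarCoord d i γ| + 1 :=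
      (hasExpMoments_haarCoord hν i).abs.add (HasExpMoments.of_bound (K := 1) (by simp))
        fun _ => by fun_prop
    refine (HasMoments.const_mul (HasMoments.of_exp hE () 2 (by fun_prop)
      (.of_forall fun γ => ?_)) 3).memLp_two
    rw [abs_of_pos (Real.exp_pos _), abs_of_nonneg (by positivity : 0 ≤ |haarCoord d i γ| + 1)]
  · filter_upwards [hev] with t ht
    refine .of_forall fun γ => ?_
    set w := haarCoord d i γ
    -- The exponent `t w - t² / 2` is `t` times `w - t / 2`; the leftover `t / 2` is absorbed into
    -- the majorant.
    have h1 := abs_exp_quot_sub_le (x := 0) (D := w - t / 2) ht.1 ht.2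
    simp only [zero_add, Real.exp_zero, one_mul, abs_zero] at h1
    have e : t * (w - t / 2) = t * w - t ^ 2 / 2 := by ring
    rw [e] at h1
    have hwt : |w - t / 2| ≤ |w| + 1 / 2 := by
      refine (abs_sub _ _).trans (add_le_add le_rfl ?_)
      rw [abs_div, abs_two]
      linarith [ht.2]
    have h2 : |t| * (2 * Real.exp (2 * |w - t / 2|)) ≤ 2 * Real.exp (2 * (|w| + 1)) := by
      calc _ ≤ 1 * (2 * Real.exp (2 * |w - t / 2|)) := by gcongr; exact ht.2
        _ ≤ _ := by rw [one_mul]; gcongr; linarith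
    have h3 : |t / 2| ≤ Real.exp (2 * (|w| + 1)) := by
      rw [abs_div, abs_two]
      have := Real.add_one_le_exp (2 * (|w| + 1))
      linarith [ht.2, abs_nonneg w]
    have e2 : t⁻¹ * (Real.exp (t * w - t ^ 2 / 2) - 1) - w =
      (t⁻¹ * (Real.exp (t * w - t ^ 2 / 2) - 1) - (w - t / 2)) - t / 2 := by ring
    change |t⁻¹ * (Real.exp (t * w - t ^ 2 / 2) - 1) - w| ≤ _
    rw [e2]
    refine (abs_sub _ _).trans ?_
    linarith
  · set w := haarCoord d i γ
    have hd : HasDerivAt (fun t : ℝ => Real.exp (t * w - t ^ 2 / 2)) w 0 := by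
      have h := (((hasDerivAt_id (0 : ℝ)).mul_const w).sub
        (((hasDerivAt_id (0 : ℝ)).pow 2).div_const 2)).exp
      simpa using h
    have h1 := hd.tendsto_slope_zero
    simp only [zero_add, smul_eq_mul, zero_mul, ne_eq, OfNat.ofNat_ne_zero, not_false_eq_true,
      zero_pow, zero_div, sub_zero, Real.exp_zero] at h1
    simpa using h1.sub_const w

theorem integral_shift (hν : IsWienerMeasure ν) (i : ℕ) (t : ℝ) {H : PathSpace d → ℝ}
    (hH : Measurable H) :
    ∫ γ, H (γ + t • schauder d i) ∂ν =
      ∫ γ, H γ * Real.exp (t * haarCoord d i γ - t ^ 2 / 2) ∂ν := by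
  have hm := (continuous_haarCoord (d := d) i).measurable
  rw [← integral_map (measurable_shift _ t).aemeasurable hH.aestronglyMeasurable,
    map_add_schauder hν i t, integral_withDensity_eq_integral_toReal_smul (by fun_prop) (by simp)]
  refine integral_congr_ae (.of_forall fun γ => ?_)
  simp only [smul_eq_mul, ENNReal.toReal_ofReal (Real.exp_pos _).le]
  ring

/-- Integration by parts along a Schauder function. -/
theorem integral_by_parts (hν : IsWienerMeasure ν) (i : ℕ) {K K' Φ Φ' : PathSpace d → ℝ}
    (hKm : Measurable K) (hΦm : Measurable Φ) (hK : HasMoments ν K) (hΦ : HasMoments ν Φ)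
    (hK' : HasL2DirDeriv ν (schauder d i) K K') (hΦ' : HasL2DirDeriv ν (schauder d i) Φ Φ') :
    ∫ γ, (K' γ * Φ γ + K γ * Φ' γ) ∂ν = ∫ γ, K γ * Φ γ * haarCoord d i γ ∂ν := by
  have := hν.isProbabilityMeasure
  set S := schauder d i
  have quot_memLp : ∀ {u u' : PathSpace d → ℝ}, Measurable u → HasL2DirDeriv ν S u u' →
      ∀ᶠ t : ℝ in 𝓝[≠] 0, MemLp (fun γ => t⁻¹ * (u (γ + t • S) - u γ)) 2 ν := by
    intro u u' hu h
    filter_upwards [h.2.eventually_lt_const (ENNReal.zero_lt_top)] with t ht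
    have hq : AEStronglyMeasurable (fun γ => t⁻¹ * (u (γ + t • S) - u γ)) ν :=
      (((hu.comp (measurable_shift S t)).sub hu).const_mul _).aestronglyMeasurable
    have h2 : MemLp (fun γ => t⁻¹ * (u (γ + t • S) - u γ) - u' γ) 2 ν := ⟨hq.sub h.1.1, ht⟩
    convert h2.add h.1 using 1
    funext γ
    simp
  have hqK := quot_memLp hKm hK'
  have hqΦ := quot_memLp hΦm hΦ'
  -- Difference quotients converging in `L²` are bounded there, so multiplying them by `t` gives
  -- `L²` continuity of the shift.
  have shift_tendsto : Tendsto (fun t : ℝ => eLpNorm ((fun γ => K (γ + t • S) - K γ) - 0) 2 ν)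
      (𝓝[≠] 0) (𝓝 0) := by
    have h1 : Tendsto (fun t : ℝ => ‖t‖ₑ) (𝓝[≠] 0) (𝓝 0) := by
      simpa using ((continuous_enorm (E := ℝ)).tendsto 0).mono_left nhdsWithin_le_nhds
    have h2 := ENNReal.Tendsto.mul h1 (Or.inr (by simpa using hK'.1.2.ne))
      (hK'.2.add (tendsto_const_nhds (x := eLpNorm K' 2 ν))) (Or.inr (by simp))
    rw [zero_mul] at h2
    refine tendsto_of_tendsto_of_tendsto_of_le_of_le' tendsto_const_nhds h2
      (.of_forall fun _ => zero_le) ?_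
    filter_upwards [self_mem_nhdsWithin, hqK] with t ht hq
    rw [sub_zero]
    have e : (fun γ => K (γ + t • S) - K γ) =
        t • ((fun γ => t⁻¹ * (K (γ + t • S) - K γ) - K' γ) + K') := by
      funext γ
      have ht' : t ≠ 0 := ht
      simp only [Pi.smul_apply, Pi.add_apply, smul_eq_mul]
      field_simp
      ring
    rw [e, eLpNorm_const_smul]
    exact mul_le_mul_right (eLpNorm_add_le (hq.sub hK'.1).1 hK'.1.1 (by norm_num)) _
  have hsm : ∀ᶠ t : ℝ in 𝓝[≠] 0, MemLp (fun γ => K (γ + t • S) - K γ) 2 ν := by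
    filter_upwards [self_mem_nhdsWithin, hqK] with t ht hq
    convert hq.const_mul t using 1
    funext γ
    have ht' : t ≠ 0 := ht
    field_simp
  have hzero : MemLp (0 : PathSpace d → ℝ) 2 ν := MemLp.zero
  -- With `q` denoting difference quotients, that of `K Φ` is `(K(γ + tS) - K) q_Φ + K q_Φ + q_K Φ`.
  -- The first term disappears in the limit, the others give the product rule.
  have c1 := tendsto_integral_mul hzero hΦ'.1 hsm hqΦ shift_tendsto hΦ'.2
  have c2 := tendsto_integral_mul hK.memLp_two hΦ'.1 (.of_forall fun _ => hK.memLp_two) hqΦ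
    (by simp) hΦ'.2
  have c3 := tendsto_integral_mul hK'.1 hΦ.memLp_two hqK (.of_forall fun _ => hΦ.memLp_two)
    hK'.2 (by simp)
  have hW := hasMoments_haarCoord hν i
  have hcm := tendsto_cameronMartin_quot hν i
  have hexp : ∀ t : ℝ, HasMoments ν fun γ => Real.exp (t * haarCoord d i γ - t ^ 2 / 2) := by
    intro t
    have hm := (continuous_haarCoord (d := d) i).measurable
    refine HasMoments.of_exp (hasExpMoments_haarCoord hν i) () |t| (by fun_prop)
      (.of_forall fun γ => ?_)
    rw [abs_of_pos (Real.exp_pos _), ← abs_mul]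
    exact Real.exp_le_exp.2 (by linarith [le_abs_self (t * haarCoord d i γ), sq_nonneg t])
  -- The same integral with the shift moved onto the measure: the quotient now falls on the
  -- Cameron–Martin density and tends to `haarCoord d i`.
  have c4 := tendsto_integral_mul (hK.mul hΦ).memLp_two hW.memLp_two
    (.of_forall fun _ => (hK.mul hΦ).memLp_two)
    (.of_forall fun t : ℝ => (((hexp t).sub (HasMoments.const 1)).const_mul t⁻¹).memLp_two)
    (by simp) hcm
  have c5 := (c1.add c2).add c3
  have hlim := tendsto_nhds_unique_of_eventuallyEq c5 c4 ?_
  · rw [← hlim, integral_add (integrable_fun_mul hK'.1 hΦ.memLp_two)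
      (integrable_fun_mul hK.memLp_two hΦ'.1)]
    simp [add_comm]
  · filter_upwards [self_mem_nhdsWithin, hqK, hqΦ, hsm] with t ht h1 h2 h3
    have hI := integral_shift hν i t (hKm.mul hΦm)
    have e1 : Integrable (fun γ => K γ * Φ γ) ν := (hK.mul hΦ).integrable
    have e2 : Integrable (fun γ => K γ * Φ γ * Real.exp (t * haarCoord d i γ - t ^ 2 / 2)) ν :=
      ((hK.mul hΦ).mul (hexp t)).integrable
    have h1' := integrable_fun_mul h1 hΦ.memLp_two
    have h2' := integrable_fun_mul hK.memLp_two h2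
    have h3' := integrable_fun_mul h3 h2
    -- Solving the product-rule decomposition for the shifted product gives its integrability.
    have e3 : Integrable (fun γ => K (γ + t • S) * Φ (γ + t • S)) ν := by
      have ht' : t ≠ 0 := ht
      refine (((h3'.add (h2'.add h1')).const_mul t).add e1).congr (.of_forall fun γ => ?_)
      simp only [Pi.add_apply]
      field_simp
      ring
    calc _ = ∫ γ, t⁻¹ * (K (γ + t • S) * Φ (γ + t • S) - K γ * Φ γ) ∂ν := by
          rw [← integral_add h3' h2', ← integral_add (h3'.fun_add h2') h1']
          refine integral_congr_ae (.of_forall fun γ => ?_)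
          beta_reduce
          ring
      _ = ∫ γ, t⁻¹ * (K γ * Φ γ * Real.exp (t * haarCoord d i γ - t ^ 2 / 2) - K γ * Φ γ) ∂ν := by
          rw [integral_const_mul, integral_const_mul, integral_sub e3 e1, integral_sub e2 e1]
          congr 2
      _ = _ := by
          refine integral_congr_ae (.of_forall fun γ => ?_)
          simp only
          ring

end IBP

end

section

/-! ### The weighted form -/

theorem exists_isCyl_pair {F G : PathSpace d → ℝ} (hF : F ∈ cylindrical d)
    (hG : G ∈ cylindrical d) :
    ∃ n, IsCyl n F ∧ IsCyl n G := by
  obtain ⟨n, hF⟩ := mem_cylindrical_iff.1 hF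
  obtain ⟨m, hG⟩ := mem_cylindrical_iff.1 hG
  exact ⟨max n m, hF.mono (le_max_left _ _), hG.mono (le_max_right _ _)⟩

theorem sub_mem_cylindrical {F G : PathSpace d → ℝ} (hF : F ∈ cylindrical d)
    (hG : G ∈ cylindrical d) :
    F - G ∈ cylindrical d := by
  obtain ⟨n, hF, hG⟩ := exists_isCyl_pair hF hG
  exact mem_cylindrical_iff.2 ⟨n, hF.sub hG⟩

variable [NeZero d] {ν : Measure (PathSpace d)} {φ : PathSpace d → ℝ}
  {ψ : ℕ → PathSpace d → ℝ} {lam : ℕ → ℝ}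

/-- Positive weights with moments of every order and with logarithmic derivatives `ψ i` along the
Schauder functions. -/
structure IsWeight (ν : Measure (PathSpace d)) (φ : PathSpace d → ℝ)
    (ψ : ℕ → PathSpace d → ℝ) : Prop where
  measurable : Measurable φ
  pos : ∀ γ, 0 < φ γ
  hasMoments : HasMoments ν φ
  hasMoments_logDeriv : ∀ i, HasMoments ν (ψ i)
  hasL2DirDeriv : ∀ i, HasL2DirDeriv ν (schauder d i) φ fun γ => φ γ * ψ i γ

namespace IsWeight

theorem isFiniteMeasure (hw : IsWeight ν φ ψ) : IsFiniteMeasure (weightedMeasure ν φ) :=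
  isFiniteMeasure_withDensity_ofReal hw.hasMoments.integrable.2

theorem absolutelyContinuous (_hw : IsWeight ν φ ψ) : weightedMeasure ν φ ≪ ν :=
  withDensity_absolutelyContinuous _ _

theorem integral_eq (hw : IsWeight ν φ ψ) (G : PathSpace d → ℝ) :
    ∫ γ, G γ ∂weightedMeasure ν φ = ∫ γ, G γ * φ γ ∂ν := by
  have := hw.measurable
  unfold weightedMeasure
  rw [integral_withDensity_eq_integral_toReal_smul (by fun_prop) (by simp)]
  refine integral_congr_ae (.of_forall fun γ => ?_)
  simp only [smul_eq_mul, ENNReal.toReal_ofReal (hw.pos γ).le]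
  ring

theorem memLp (hw : IsWeight ν φ ψ) {G : PathSpace d → ℝ} (hG : HasMoments ν G) :
    MemLp G 2 (weightedMeasure ν φ) := by
  have := hw.measurable
  rw [memLp_two_iff_integrable_sq (hG.aestronglyMeasurable.mono_ac hw.absolutelyContinuous)]
  unfold weightedMeasure
  rw [integrable_withDensity_iff (by fun_prop) (by simp)]
  have h := ((hG.mul hG).mul hw.hasMoments).integrable
  refine h.congr (.of_forall fun γ => ?_)
  simp only [ENNReal.toReal_ofReal (hw.pos γ).le]
  ring

end IsWeight

/-- The generator applied to a cylindrical function of level `n`. -/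
def genFun (lam : ℕ → ℝ) (ψ : ℕ → PathSpace d → ℝ) (n : ℕ) (F : PathSpace d → ℝ)
    (γ : PathSpace d) : ℝ :=
  ∑ i ∈ Finset.range (d * 2 ^ n), lam i *
    (dirDeriv (schauder d i) (dirDeriv (schauder d i) F) γ + ψ i γ * dirDeriv (schauder d i) F γ -
      haarCoord d i γ * dirDeriv (schauder d i) F γ)

variable {n : ℕ} {F G : PathSpace d → ℝ}

theorem IsCyl.dirDeriv_eq_zero (hF : IsCyl n F) {i : ℕ} (hi : i ∉ Finset.range (d * 2 ^ n))
    (γ : PathSpace d) : WienerForm.dirDeriv (schauder d i) F γ = 0 := by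
  refine hF.dirDeriv_schauder_eq_zero ?_ γ
  rw [Finset.mem_range, not_lt] at hi
  rw [Nat.le_div_iff_mul_le (Nat.pos_of_neZero d)]
  linarith

theorem form_eq_sum (μ : Measure (PathSpace d)) (hF : IsCyl n F) :
    form lam μ F G = ∑ i ∈ Finset.range (d * 2 ^ n),
      lam i * ∫ γ, dirDeriv (schauder d i) F γ * dirDeriv (schauder d i) G γ ∂μ :=
  tsum_eq_sum fun i hi => by simp [hF.dirDeriv_eq_zero hi]

theorem form_comm (μ : Measure (PathSpace d)) : form lam μ F G = form lam μ G F := by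
  unfold form
  simp_rw [mul_comm (dirDeriv _ F _)]

namespace IsWeight

theorem memLp_dirDeriv (hν : IsWienerMeasure ν) (hw : IsWeight ν φ ψ) (hF : IsCyl n F) (i : ℕ) :
    MemLp (dirDeriv (schauder d i) F) 2 (weightedMeasure ν φ) :=
  hw.memLp ((hF.dirDeriv _).hasMoments hν)

theorem hasMoments_genTerm (hν : IsWienerMeasure ν) (hw : IsWeight ν φ ψ) (hF : IsCyl n F)
    (i : ℕ) : HasMoments ν fun γ =>
      dirDeriv (schauder d i) (dirDeriv (schauder d i) F) γ + ψ i γ * dirDeriv (schauder d i) F γ -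
        haarCoord d i γ * dirDeriv (schauder d i) F γ :=
  have h1 := (hF.dirDeriv (schauder d i)).hasMoments hν
  ((((hF.dirDeriv (schauder d i)).dirDeriv (schauder d i)).hasMoments hν).add
    ((hw.hasMoments_logDeriv i).mul h1)).sub ((hasMoments_haarCoord hν i).mul h1)

theorem memLp_genFun (hν : IsWienerMeasure ν) (hw : IsWeight ν φ ψ) (hF : IsCyl n F) :
    MemLp (genFun lam ψ n F) 2 (weightedMeasure ν φ) :=
  hw.memLp (HasMoments.sum fun i _ => (hw.hasMoments_genTerm hν hF i).const_mul _)

/-- Integration by parts with `K = ∂_i F · G` and `Φ = φ`. The product rule produces `∂_i F ∂_i G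
φ`, and the remaining terms assemble to minus the generator. -/
theorem integral_dirDeriv_mul (hν : IsWienerMeasure ν) (hw : IsWeight ν φ ψ) (hF : IsCyl n F)
    (hG : IsCyl n G) (i : ℕ) :
    ∫ γ, dirDeriv (schauder d i) F γ * dirDeriv (schauder d i) G γ ∂weightedMeasure ν φ =
      ∫ γ, -(dirDeriv (schauder d i) (dirDeriv (schauder d i) F) γ +
        ψ i γ * dirDeriv (schauder d i) F γ - haarCoord d i γ * dirDeriv (schauder d i) F γ) * G γ
        ∂weightedMeasure ν φ := by
  set S := schauder d i
  have h1 := hF.dirDeriv S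
  have hK := h1.mul hG
  have ibp := integral_by_parts hν i hK.continuous.measurable hw.measurable (hK.hasMoments hν)
    hw.hasMoments (hK.hasL2DirDeriv hν S) (hw.hasL2DirDeriv i)
  rw [hw.integral_eq, hw.integral_eq]
  have m1 := h1.hasMoments hν
  have m2 := (h1.dirDeriv S).hasMoments hν
  have mG := hG.hasMoments hν
  have mG1 := (hG.dirDeriv S).hasMoments hν
  have mφ := hw.hasMoments
  have mψ := hw.hasMoments_logDeriv i
  have mW := hasMoments_haarCoord hν i
  have i1 : Integrable (fun γ => dirDeriv S F γ * dirDeriv S G γ * φ γ) ν :=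
    ((m1.mul mG1).mul mφ).integrable
  have i2 : Integrable (fun γ => -(dirDeriv S (dirDeriv S F) γ + ψ i γ * dirDeriv S F γ -
      haarCoord d i γ * dirDeriv S F γ) * G γ * φ γ) ν := by
    refine ((((hw.hasMoments_genTerm hν hF i).mul mG).mul mφ).const_mul (-1)).integrable.congr
      (.of_forall fun γ => ?_)
    beta_reduce
    ring
  have i3 : Integrable (fun γ => (dirDeriv S F * G) γ * φ γ * haarCoord d i γ) ν :=
    (((m1.mul mG).mul mφ).mul mW).integrable
  have i4 : Integrable (fun γ => dirDeriv S (dirDeriv S F * G) γ * φ γ +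
      (dirDeriv S F * G) γ * (φ γ * ψ i γ)) ν :=
    ((((hK.dirDeriv S).hasMoments hν).mul mφ).add ((m1.mul mG).mul (mφ.mul mψ))).integrable
  rw [← sub_eq_zero, ← integral_sub i1 i2]
  rw [← sub_eq_zero, ← integral_sub i4 i3] at ibp
  rw [← ibp]
  refine integral_congr_ae (.of_forall fun γ => ?_)
  simp only [h1.dirDeriv_mul hG, Pi.mul_apply]
  ring

theorem form_eq_integral (hν : IsWienerMeasure ν) (hw : IsWeight ν φ ψ) (hF : IsCyl n F)
    (hG : IsCyl n G) :
    form lam (weightedMeasure ν φ) F G =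
      ∫ γ, -genFun lam ψ n F γ * G γ ∂weightedMeasure ν φ := by
  have hGm := hw.memLp (hG.hasMoments hν)
  rw [form_eq_sum _ hF]
  simp_rw [hw.integral_dirDeriv_mul hν hF hG, ← integral_const_mul]
  rw [← integral_finsetSum]
  · refine integral_congr_ae (.of_forall fun γ => ?_)
    simp only [genFun, ← Finset.sum_neg_distrib, Finset.sum_mul]
    exact Finset.sum_congr rfl fun i _ => by ring
  · intro i _
    have := (integrable_fun_mul (hw.memLp (hw.hasMoments_genTerm hν hF i)) hGm).const_mul (-lam i)
    refine this.congr (.of_forall fun γ => ?_)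
    beta_reduce
    ring

theorem form_sub_left (hν : IsWienerMeasure ν) (hw : IsWeight ν φ ψ) {F' : PathSpace d → ℝ}
    (hF : IsCyl n F) (hF' : IsCyl n F') (hG : IsCyl n G) :
    form lam (weightedMeasure ν φ) (F - F') G =
      form lam (weightedMeasure ν φ) F G - form lam (weightedMeasure ν φ) F' G := by
  rw [form_eq_sum _ (hF.sub hF'), form_eq_sum _ hF, form_eq_sum _ hF', ← Finset.sum_sub_distrib]
  refine Finset.sum_congr rfl fun i _ => ?_
  have hGi := hw.memLp_dirDeriv hν hG i
  rw [hF.dirDeriv_sub hF', ← mul_sub, ← integral_sub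
    (integrable_fun_mul (hw.memLp_dirDeriv hν hF i) hGi)
    (integrable_fun_mul (hw.memLp_dirDeriv hν hF' i) hGi)]
  simp only [Pi.sub_apply, sub_mul]

theorem form_nonneg (hlam : ∀ i, 0 ≤ lam i) (μ : Measure (PathSpace d)) :
    0 ≤ form lam μ F F :=
  tsum_nonneg fun i => mul_nonneg (hlam i) (integral_nonneg fun _ => mul_self_nonneg _)

/-- The Cauchy–Schwarz inequality for the form. -/
theorem form_sq_le (hν : IsWienerMeasure ν) (hw : IsWeight ν φ ψ) (hlam : ∀ i, 0 ≤ lam i)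
    (hF : IsCyl n F) (hG : IsCyl n G) :
    form lam (weightedMeasure ν φ) F G ^ 2 ≤
      form lam (weightedMeasure ν φ) F F * form lam (weightedMeasure ν φ) G G := by
  -- The form of `F + c G` is a nonnegative quadratic polynomial in `c`, so its discriminant is not
  -- positive.
  have h : ∀ c : ℝ, 0 ≤ form lam (weightedMeasure ν φ) G G * (c * c) +
      2 * form lam (weightedMeasure ν φ) F G * c + form lam (weightedMeasure ν φ) F F := by
    intro c
    rw [form_eq_sum _ hF, form_eq_sum _ hF, form_eq_sum _ hG, Finset.mul_sum, Finset.sum_mul,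
      Finset.sum_mul, ← Finset.sum_add_distrib, ← Finset.sum_add_distrib]
    refine Finset.sum_nonneg fun i _ => ?_
    have hFi := hw.memLp_dirDeriv hν hF i
    have hGi := hw.memLp_dirDeriv hν hG i
    have h0 : 0 ≤ lam i * ∫ γ, (dirDeriv (schauder d i) F γ + c * dirDeriv (schauder d i) G γ) ^ 2
        ∂weightedMeasure ν φ :=
      mul_nonneg (hlam i) (integral_nonneg fun _ => sq_nonneg _)
    have e : ∫ γ, (dirDeriv (schauder d i) F γ + c * dirDeriv (schauder d i) G γ) ^ 2
        ∂weightedMeasure ν φ =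
        (∫ γ, dirDeriv (schauder d i) F γ * dirDeriv (schauder d i) F γ ∂weightedMeasure ν φ) +
        2 * c * (∫ γ, dirDeriv (schauder d i) F γ * dirDeriv (schauder d i) G γ
          ∂weightedMeasure ν φ) +
        c ^ 2 * ∫ γ, dirDeriv (schauder d i) G γ * dirDeriv (schauder d i) G γ
          ∂weightedMeasure ν φ := by
      rw [← integral_const_mul, ← integral_const_mul,
        ← integral_add (integrable_fun_mul hFi hFi) ((integrable_fun_mul hFi hGi).const_mul _),
        ← integral_add ((integrable_fun_mul hFi hFi).fun_add
          ((integrable_fun_mul hFi hGi).const_mul _)) ((integrable_fun_mul hGi hGi).const_mul _)]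
      refine integral_congr_ae (.of_forall fun γ => ?_)
      beta_reduce
      ring
    rw [e] at h0
    linarith
  have := discrim_le_zero h
  unfold discrim at this
  linarith

/-- Expand `0 ≤ ℰ((F - G) - G, (F - G) - G)`. It bounds the energies along an `ℰ`-Cauchy sequence by
that of one fixed member. -/
theorem form_le (hν : IsWienerMeasure ν) (hw : IsWeight ν φ ψ) (hlam : ∀ i, 0 ≤ lam i)
    (hF : IsCyl n F) (hG : IsCyl n G) :
    form lam (weightedMeasure ν φ) F F ≤ 2 * form lam (weightedMeasure ν φ) (F - G) (F - G) +
      2 * form lam (weightedMeasure ν φ) G G := by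
  have h1 := hw.form_sub_left (lam := lam) hν hF hG (hF.sub hG)
  have h2 := hw.form_sub_left (lam := lam) hν hF hG hF
  have h3 := hw.form_sub_left (lam := lam) hν hF hG hG
  rw [form_comm _ (F := F) (G := F - G), form_comm _ (F := G) (G := F - G)] at h1
  have h4 := hw.form_sub_left (lam := lam) hν (hF.sub hG) hG ((hF.sub hG).sub hG)
  have h5 := hw.form_sub_left (lam := lam) hν (hF.sub hG) hG (hF.sub hG)
  have h6 := hw.form_sub_left (lam := lam) hν (hF.sub hG) hG hG
  rw [form_comm _ (F := F - G) (G := F - G - G), form_comm _ (F := G) (G := F - G - G)] at h4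
  have h7 : 0 ≤ form lam (weightedMeasure ν φ) (F - G - G) (F - G - G) := form_nonneg hlam _
  have h8 := form_comm (lam := lam) (weightedMeasure ν φ) (F := F) (G := G)
  have h9 := form_comm (lam := lam) (weightedMeasure ν φ) (F := F - G) (G := G)
  linarith

end IsWeight

theorem genFun_eq_of_le (hF : IsCyl n F) {m : ℕ} (h : n ≤ m) :
    genFun lam ψ m F = genFun lam ψ n F := by
  funext γ
  refine (Finset.sum_subset (Finset.range_mono (Nat.mul_le_mul_left _
    (Nat.pow_le_pow_right (by norm_num) h))) fun i _ hi => ?_).symm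
  rw [hF.dirDeriv_eq_zero hi, (hF.dirDeriv _).dirDeriv_eq_zero hi]
  ring

theorem IsFormApprox.exists_le {μ : Measure (PathSpace d)} {F : ℕ → PathSpace d → ℝ}
    {u : PathSpace d → ℝ} (h : IsFormApprox lam μ F u) {ε : ℝ} (hε : 0 < ε) :
    ∃ N, ∀ n ≥ N, ∀ m ≥ N, form lam μ (F n - F m) (F n - F m) < ε := by
  have h1 := h.2.2.eventually_lt_const hε
  rw [prod_atTop_atTop_eq, eventually_atTop] at h1
  obtain ⟨⟨a, b⟩, hab⟩ := h1
  exact ⟨max a b, fun n hn m hm => hab (n, m)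
    ⟨(le_max_left _ _).trans hn, (le_max_right _ _).trans hm⟩⟩

theorem isFormApprox_const (μ : Measure (PathSpace d)) (hF : F ∈ cylindrical d) :
    IsFormApprox lam μ (fun _ => F) F := by
  refine ⟨fun _ => hF, by simp, ?_⟩
  simp [form, dirDeriv]

namespace IsWeight

/-- With `F` fixed, the form is integration against a fixed element of `L²(φν)`, so the energies of
the `G k` play no role. Closability and the description of the generator both rest on this. -/
theorem tendsto_form (hν : IsWienerMeasure ν) (hw : IsWeight ν φ ψ) (hF : IsCyl n F)
    {G : ℕ → PathSpace d → ℝ} {v : PathSpace d → ℝ} (hG : ∀ k, G k ∈ cylindrical d)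
    (hv : MemLp v 2 (weightedMeasure ν φ))
    (h : Tendsto (fun k => eLpNorm (G k - v) 2 (weightedMeasure ν φ)) atTop (𝓝 0)) :
    Tendsto (fun k => form lam (weightedMeasure ν φ) F (G k)) atTop
      (𝓝 (∫ γ, -genFun lam ψ n F γ * v γ ∂weightedMeasure ν φ)) := by
  have hA : MemLp (fun γ => -genFun lam ψ n F γ) 2 (weightedMeasure ν φ) :=
    (hw.memLp_genFun hν hF).neg
  have e : ∀ k, form lam (weightedMeasure ν φ) F (G k) =
      ∫ γ, -genFun lam ψ n F γ * G k γ ∂weightedMeasure ν φ := fun k => by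
    obtain ⟨m, hm⟩ := mem_cylindrical_iff.1 (hG k)
    rw [hw.form_eq_integral hν (hF.mono (le_max_left n m)) (hm.mono (le_max_right n m)),
      genFun_eq_of_le hF (le_max_left n m)]
  simp_rw [e]
  refine tendsto_integral_mul hA hv (.of_forall fun _ => hA) (.of_forall fun k => ?_) (by simp) h
  obtain ⟨m, hm⟩ := mem_cylindrical_iff.1 (hG k)
  exact hw.memLp (hm.hasMoments hν)

theorem exists_form_le (hν : IsWienerMeasure ν) (hw : IsWeight ν φ ψ) (hlam : ∀ i, 0 ≤ lam i)
    {F : ℕ → PathSpace d → ℝ} {u : PathSpace d → ℝ}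
    (h : IsFormApprox lam (weightedMeasure ν φ) F u) :
    ∃ M > 0, ∃ N, ∀ k ≥ N, form lam (weightedMeasure ν φ) (F k) (F k) ≤ M := by
  obtain ⟨N, hN⟩ := h.exists_le one_pos
  have h0 : 0 ≤ form lam (weightedMeasure ν φ) (F N) (F N) := form_nonneg hlam _
  refine ⟨2 + 2 * form lam (weightedMeasure ν φ) (F N) (F N), by positivity, N, fun k hk => ?_⟩
  obtain ⟨n, h1, h2⟩ := exists_isCyl_pair (h.1 k) (h.1 N)
  linarith [hw.form_le hν hlam h1 h2, hN k hk N le_rfl]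

theorem abs_form_le (hν : IsWienerMeasure ν) (hw : IsWeight ν φ ψ) (hlam : ∀ i, 0 ≤ lam i)
    (hF : F ∈ cylindrical d) (hG : G ∈ cylindrical d) {ε M : ℝ} (hε : 0 ≤ ε) (hM : 0 < M)
    (h1 : form lam (weightedMeasure ν φ) F F ≤ ε ^ 2 / M)
    (h2 : form lam (weightedMeasure ν φ) G G ≤ M) :
    |form lam (weightedMeasure ν φ) F G| ≤ ε := by
  obtain ⟨n, hF, hG⟩ := exists_isCyl_pair hF hG
  refine abs_le_of_sq_le_sq ?_ hε
  refine (hw.form_sq_le hν hlam hF hG).trans ?_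
  calc _ ≤ ε ^ 2 / M * M := mul_le_mul h1 h2 (form_nonneg hlam _) (by positivity)
    _ = ε ^ 2 := by field_simp

/-- Write `ℰ(F_k, F_k) = ℰ(F_k - F_N, F_k) + ℰ(F_N, F_k)`. The first term is small by
Cauchy–Schwarz, as energies stay bounded by `M`; the second tends to zero because `F_N` is fixed and
`F_k → 0` in `L²`. -/
theorem isClosableForm (hν : IsWienerMeasure ν) (hw : IsWeight ν φ ψ) (hlam : ∀ i, 0 ≤ lam i) :
    IsClosableForm lam (weightedMeasure ν φ) := by
  intro F h
  obtain ⟨M, hM, N₁, hN₁⟩ := hw.exists_form_le hν hlam h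
  rw [Metric.tendsto_atTop]
  intro ε hε
  obtain ⟨N₂, hN₂⟩ := h.exists_le (ε := (ε / 2) ^ 2 / M) (by positivity)
  obtain ⟨n, hn⟩ := mem_cylindrical_iff.1 (h.1 N₂)
  have h3 := hw.tendsto_form (lam := lam) hν hn h.1 MemLp.zero h.2.1
  simp only [Pi.zero_apply, mul_zero, integral_zero] at h3
  obtain ⟨N₃, hN₃⟩ := Metric.tendsto_atTop.1 h3 (ε / 2) (by positivity)
  refine ⟨max N₁ (max N₂ N₃), fun k hk => ?_⟩
  simp only [ge_iff_le, max_le_iff] at hk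
  obtain ⟨m, hm1, hm2⟩ := exists_isCyl_pair (h.1 k) (h.1 N₂)
  have e := hw.form_sub_left (lam := lam) hν hm1 hm2 hm1
  have b1 := hw.abs_form_le hν hlam (sub_mem_cylindrical (h.1 k) (h.1 N₂)) (h.1 k)
    (by positivity : 0 ≤ ε / 2) hM (hN₂ k hk.2.1 N₂ le_rfl).le (hN₁ k hk.1)
  have b2 := hN₃ k hk.2.2
  rw [Real.dist_eq, sub_zero] at b2 ⊢
  have e' : form lam (weightedMeasure ν φ) (F k) (F k) =
      form lam (weightedMeasure ν φ) (F k - F N₂) (F k) +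
        form lam (weightedMeasure ν φ) (F N₂) (F k) := by linarith
  rw [e']
  exact (abs_add_le _ _).trans_lt (by linarith)

theorem mem_closureDomain (hν : IsWienerMeasure ν) (hw : IsWeight ν φ ψ)
    (hF : F ∈ cylindrical d) : F ∈ closureDomain lam (weightedMeasure ν φ) := by
  obtain ⟨n, hn⟩ := mem_cylindrical_iff.1 hF
  exact ⟨hw.memLp (hn.hasMoments hν), _, isFormApprox_const _ hF⟩

/-- Any sequence `A k` approximating `F` may be replaced by `F` itself: `A k - F` is an `ℰ`-Cauchy
sequence tending to `0` in `L²`, so closability removes its energy. -/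
theorem hasFormValue (hν : IsWienerMeasure ν) (hw : IsWeight ν φ ψ) (hlam : ∀ i, 0 ≤ lam i)
    (hF : IsCyl n F) {v : PathSpace d → ℝ} (hv : v ∈ closureDomain lam (weightedMeasure ν φ)) :
    HasFormValue lam (weightedMeasure ν φ) F v
      (∫ γ, -genFun lam ψ n F γ * v γ ∂weightedMeasure ν φ) := by
  have hFY : F ∈ cylindrical d := mem_cylindrical_iff.2 ⟨n, hF⟩
  refine ⟨hw.mem_closureDomain hν hFY, hv, fun A B hA hB => ?_⟩
  obtain ⟨M, hM, N₁, hN₁⟩ := hw.exists_form_le hν hlam hB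
  have hD : IsFormApprox lam (weightedMeasure ν φ) (fun k => A k - F) 0 := by
    refine ⟨fun k => sub_mem_cylindrical (hA.1 k) hFY, ?_, ?_⟩
    · simpa only [sub_zero] using hA.2.1
    · simpa only [sub_sub_sub_cancel_right] using hA.2.2
  have h1 := hw.isClosableForm hν hlam _ hD
  have h2 := hw.tendsto_form (lam := lam) hν hF hB.1 hv.1 hB.2.1
  have h3 : Tendsto (fun k => form lam (weightedMeasure ν φ) (A k - F) (B k)) atTop (𝓝 0) := by
    rw [Metric.tendsto_atTop]
    intro ε hε
    have h4 := h1.eventually_lt_const (by positivity : 0 < (ε / 2) ^ 2 / M)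
    rw [eventually_atTop] at h4
    obtain ⟨N₂, hN₂⟩ := h4
    refine ⟨max N₁ N₂, fun k hk => ?_⟩
    simp only [ge_iff_le, max_le_iff] at hk
    rw [Real.dist_eq, sub_zero]
    refine (hw.abs_form_le hν hlam (hD.1 k) (hB.1 k) (by positivity : 0 ≤ ε / 2) hM
      (hN₂ k hk.2).le (hN₁ k hk.1)).trans_lt (by linarith)
  have h5 := h3.add h2
  rw [zero_add] at h5
  refine h5.congr fun k => ?_
  obtain ⟨m, hm⟩ := mem_cylindrical_iff.1 (hA.1 k)
  obtain ⟨m', hm'⟩ := mem_cylindrical_iff.1 (hB.1 k)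
  have e := hw.form_sub_left (lam := lam) hν
    (hm.mono ((le_max_left m m').trans (le_max_right n _)))
    (hF.mono (le_max_left n (max m m')))
    (hm'.mono ((le_max_right m m').trans (le_max_right n _)))
  linarith

theorem isGeneratorValue (hν : IsWienerMeasure ν) (hw : IsWeight ν φ ψ) (hlam : ∀ i, 0 ≤ lam i)
    (hF : IsCyl n F) :
    IsGeneratorValue lam (weightedMeasure ν φ) F (genFun lam ψ n F) :=
  ⟨hw.memLp_genFun hν hF, fun _ hv => hw.hasFormValue hν hlam hF hv⟩

end IsWeight

end

section

/-! ### Cylindrical functions determine finite measures -/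

variable (d) in
/-- The algebra of bounded cylindrical functions. -/
def boundedCylindrical : StarSubalgebra ℝ (BoundedContinuousFunction (PathSpace d) ℝ) where
  carrier := {g | ∃ n, IsCyl n (g : PathSpace d → ℝ)}
  mul_mem' := by
    rintro a b ⟨n, ha⟩ ⟨m, hb⟩
    exact ⟨max n m, by
      simpa using (ha.mono (le_max_left n m)).mul (hb.mono (le_max_right n m))⟩
  add_mem' := by
    rintro a b ⟨n, ha⟩ ⟨m, hb⟩
    exact ⟨max n m, by
      simpa using (ha.mono (le_max_left n m)).add (hb.mono (le_max_right n m))⟩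
  algebraMap_mem' := fun r => ⟨0, IsCyl.const r⟩
  star_mem' := by
    rintro a ⟨n, ha⟩
    exact ⟨n, ha⟩

theorem path_eq_of_grid {γ η : PathSpace d} (h : ∀ n, gridEval n γ = gridEval n η) : γ = η := by
  have h1 : ∀ (n k : ℕ), k ≤ 2 ^ n → pathAt γ ((k : ℝ) / 2 ^ n) = pathAt η ((k : ℝ) / 2 ^ n) := by
    intro n k hk
    rcases k with _ | k
    · simp [pathAt_zero]
    · have := congrFun (h n) ⟨k, hk⟩
      simpa [gridEval] using this
  refine Subtype.ext (ContinuousMap.ext fun s => ?_)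
  rw [← pathAt_coe, ← pathAt_coe]
  have hs : Tendsto (fun n => dyadicFloor n (s : ℝ)) atTop (𝓝 s) := by
    have h0 : Tendsto (fun n : ℕ => (s : ℝ) - (1 / 2) ^ n) atTop (𝓝 s) := by
      simpa using (tendsto_pow_atTop_nhds_zero_of_lt_one (r := (1 / 2 : ℝ)) (by norm_num)
        (by norm_num)).const_sub (s : ℝ)
    exact tendsto_of_tendsto_of_tendsto_of_le_of_le h0 tendsto_const_nhds
      (fun n => by have := sub_dyadicFloor_lt n (s : ℝ); linarith) fun n => dyadicFloor_le n s.2.1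
  refine tendsto_nhds_unique (((continuous_pathAt γ).tendsto _).comp hs)
    ((((continuous_pathAt η).tendsto _).comp hs).congr fun n => ?_)
  simp only [Function.comp, dyadicFloor]
  refine (h1 n _ ?_).symm
  refine Nat.floor_le_of_le ?_
  push_cast
  exact mul_le_of_le_one_left (by positivity) s.2.2

theorem separatesPoints_boundedCylindrical :
    ((boundedCylindrical d).map
      (BoundedContinuousFunction.toContinuousMapStarₐ ℝ)).SeparatesPoints := by
  intro γ η hne
  obtain ⟨n, hn⟩ : ∃ n, gridEval n γ ≠ gridEval n η := by
    by_contra! h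
    exact hne (path_eq_of_grid h)
  obtain ⟨j, hj⟩ := Function.ne_iff.1 hn
  -- A smooth function bounded by `1` that attains `1` only where the `j`-th grid value is that of
  -- `γ`.
  let f : (Fin (2 ^ n) → E d) → ℝ := fun x => (1 + ‖x j - gridEval n γ j‖ ^ 2) ^ (-1 : ℝ)
  have hf : f.HasTemperateGrowth := by
    have h1 := Function.hasTemperateGrowth_one_add_norm_sq_rpow (E d) (-1)
    have h2 : Function.HasTemperateGrowth fun x : Fin (2 ^ n) → E d => x j - gridEval n γ j :=
      (ContinuousLinearMap.proj (R := ℝ) (φ := fun _ => E d) j).hasTemperateGrowth.sub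
        (.const _)
    exact h1.comp h2
  have hF : IsCyl n fun η : PathSpace d => f (gridEval n η) := ⟨f, hf, fun _ => rfl⟩
  have hb : ∀ x, ‖f x‖ ≤ 1 := fun x => by
    have h0 : (1 : ℝ) ≤ 1 + ‖x j - gridEval n γ j‖ ^ 2 := le_add_of_nonneg_right (sq_nonneg _)
    simp only [f, Real.rpow_neg_one, norm_inv]
    rw [Real.norm_of_nonneg (zero_le_one.trans h0)]
    exact inv_le_one_of_one_le₀ h0
  let g : BoundedContinuousFunction (PathSpace d) ℝ :=
    BoundedContinuousFunction.ofNormedAddCommGroup (fun η => f (gridEval n η)) hF.continuous 1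
      fun η => hb _
  refine ⟨g, ⟨BoundedContinuousFunction.toContinuousMapStarₐ ℝ g, ⟨g, ⟨n, hF⟩, rfl⟩, rfl⟩, ?_⟩
  change f (gridEval n γ) ≠ f (gridEval n η)
  have hpos : 0 < ‖gridEval n η j - gridEval n γ j‖ := norm_pos_iff.2 (sub_ne_zero.2 hj.symm)
  simp only [f, sub_self, norm_zero, Real.rpow_neg_one]
  intro h
  rw [inv_inj] at h
  nlinarith

/-- Bounded cylindrical functions are total in `L²`. -/
theorem ae_eq_zero_of_integral_mul_eq_zero {μ : Measure (PathSpace d)} [IsFiniteMeasure μ]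
    {g : PathSpace d → ℝ} (hg : Integrable g μ)
    (h : ∀ v ∈ cylindrical d, ∫ γ, g γ * v γ ∂μ = 0) : g =ᵐ[μ] 0 := by
  have h1 := isFiniteMeasure_withDensity_ofReal hg.2
  have h2 := isFiniteMeasure_withDensity_ofReal hg.neg.2
  -- The positive and negative parts of `g` are densities of two finite measures that agree on a
  -- separating algebra, and therefore coincide.
  have key : μ.withDensity (fun γ => ENNReal.ofReal (g γ)) =
      μ.withDensity (fun γ => ENNReal.ofReal ((-g) γ)) := by
    refine ext_of_forall_mem_subalgebra_integral_eq_of_polish separatesPoints_boundedCylindrical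
      fun v hv => ?_
    obtain ⟨n, hn⟩ := hv
    have hm := hg.1.aemeasurable
    rw [integral_withDensity_eq_integral_toReal_smul₀ hm.ennreal_ofReal (by simp),
      integral_withDensity_eq_integral_toReal_smul₀ hm.neg.ennreal_ofReal (by simp)]
    have hb : ∀ {u : PathSpace d → ℝ}, Integrable u μ →
        Integrable (fun γ => (ENNReal.ofReal (u γ)).toReal • v γ) μ := fun hu => by
      have := hu.real_toNNReal.mul_bdd (c := ‖v‖) v.continuous.aestronglyMeasurable
        (.of_forall fun γ => v.norm_coe_le_norm γ)
      exact this
    rw [← sub_eq_zero, ← integral_sub (hb hg) (hb hg.neg), ← h v (mem_cylindrical_iff.2 ⟨n, hn⟩)]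
    refine integral_congr_ae (.of_forall fun γ => ?_)
    simp only [Pi.neg_apply, smul_eq_mul, ENNReal.toReal_ofReal', ← sub_mul]
    congr 1
    rcases le_total 0 (g γ) with h | h
    · simp [h]
    · simp [h]
  rw [withDensity_eq_iff hg.1.aemeasurable.ennreal_ofReal
    hg.1.aemeasurable.neg.ennreal_ofReal hg.lintegral_lt_top.ne] at key
  filter_upwards [key] with γ hγ
  have := congrArg ENNReal.toReal hγ
  simp only [Pi.neg_apply, ENNReal.toReal_ofReal'] at this
  rcases le_total 0 (g γ) with h | h
  · simpa [h] using this
  · simpa [h] using this.symm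

variable [NeZero d] {ν : Measure (PathSpace d)} {φ : PathSpace d → ℝ}
  {ψ : ℕ → PathSpace d → ℝ} {lam : ℕ → ℝ} {n : ℕ} {F : PathSpace d → ℝ}

/-! ### Identification of the generator on cylindrical functions -/

namespace IsWeight

theorem mem_generatorDomain (hν : IsWienerMeasure ν) (hw : IsWeight ν φ ψ) (hlam : ∀ i, 0 ≤ lam i)
    (hF : IsCyl n F) : F ∈ generatorDomain lam (weightedMeasure ν φ) :=
  ⟨hw.mem_closureDomain hν (mem_cylindrical_iff.2 ⟨n, hF⟩), _, hw.isGeneratorValue hν hlam hF⟩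

/-- The chosen value and the explicit one give the same pairing with every cylindrical function, so
their difference is orthogonal to a total set. -/
theorem generator_ae_eq (hν : IsWienerMeasure ν) (hw : IsWeight ν φ ψ) (hlam : ∀ i, 0 ≤ lam i)
    (hF : IsCyl n F) :
    generator lam (weightedMeasure ν φ) F =ᵐ[weightedMeasure ν φ] genFun lam ψ n F := by
  have := hw.isFiniteMeasure
  have hd := hw.mem_generatorDomain hν hlam hF
  have hgen : IsGeneratorValue lam (weightedMeasure ν φ) F
      (generator lam (weightedMeasure ν φ) F) := by
    unfold generator
    rw [dif_pos hd]
    exact hd.2.choose_spec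
  set w := generator lam (weightedMeasure ν φ) F
  have hA := hw.memLp_genFun (lam := lam) hν hF
  have hFY := mem_cylindrical_iff.2 ⟨n, hF⟩
  have h0 := ae_eq_zero_of_integral_mul_eq_zero
    ((hgen.1.sub hA).integrable (by norm_num)) fun v hv => ?_
  · filter_upwards [h0] with γ hγ
    simpa [sub_eq_zero] using hγ
  · have hvD := hw.mem_closureDomain (lam := lam) hν hv
    have e := tendsto_nhds_unique
      ((hgen.2 v hvD).2.2 _ _ (isFormApprox_const _ hFY) (isFormApprox_const _ hv))
      ((hw.hasFormValue hν hlam hF hvD).2.2 _ _ (isFormApprox_const _ hFY)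
        (isFormApprox_const _ hv))
    have i1 := integrable_fun_mul hgen.1 hvD.1
    have i2 := integrable_fun_mul hA hvD.1
    simp only [neg_mul, integral_neg, neg_inj] at e
    simp only [Pi.sub_apply, sub_mul]
    rw [integral_sub i1 i2, e, sub_self]

/-- The chosen versions of `∂_i φ` and `𝕊_i` agree with the explicit ones off a `ν`-null set. One
null set serves all of the countably many `i`, and it is also null for `φν`. -/
theorem hasSum_generator (hν : IsWienerMeasure ν) (hw : IsWeight ν φ ψ) (hlam : ∀ i, 0 ≤ lam i)
    (hF : F ∈ cylindrical d) :
    ∀ᵐ γ ∂weightedMeasure ν φ, HasSum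
      (fun i => lam i * (dirDeriv (schauder d i) (dirDeriv (schauder d i) F) γ
        + l2DirDeriv ν (schauder d i) φ γ * dirDeriv (schauder d i) F γ / φ γ
        - wienerCoord ν i γ * dirDeriv (schauder d i) F γ))
      (generator lam (weightedMeasure ν φ) F γ) := by
  obtain ⟨n, hF⟩ := mem_cylindrical_iff.1 hF
  have h1 : ∀ᵐ γ ∂ν, ∀ i, wienerCoord ν i γ = haarCoord d i γ :=
    ae_all_iff.2 fun i => wienerCoord_ae_eq hν i
  have h2 : ∀ᵐ γ ∂ν, ∀ i, l2DirDeriv ν (schauder d i) φ γ = φ γ * ψ i γ :=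
    ae_all_iff.2 fun i => (hw.hasL2DirDeriv i).l2DirDeriv.ae_eq hw.measurable (hw.hasL2DirDeriv i)
  filter_upwards [hw.absolutelyContinuous.ae_le h1, hw.absolutelyContinuous.ae_le h2,
    hw.generator_ae_eq hν hlam hF] with γ hγ1 hγ2 hγ3
  rw [hγ3]
  have hpos := (hw.pos γ).ne'
  have e : genFun lam ψ n F γ = ∑ i ∈ Finset.range (d * 2 ^ n),
      lam i * (dirDeriv (schauder d i) (dirDeriv (schauder d i) F) γ
        + l2DirDeriv ν (schauder d i) φ γ * dirDeriv (schauder d i) F γ / φ γ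
        - wienerCoord ν i γ * dirDeriv (schauder d i) F γ) := by
    refine Finset.sum_congr rfl fun i _ => ?_
    rw [hγ1, hγ2]
    field_simp
  rw [e]
  refine hasSum_sum_of_ne_finset_zero fun i hi => ?_
  rw [hF.dirDeriv_eq_zero hi, (hF.dirDeriv _).dirDeriv_eq_zero hi]
  ring

end IsWeight

theorem exists_isWeight_girsanovDensity (hν : IsWienerMeasure ν) {f : E d → ℝ} (hf : IsCb2 f) :
    ∃ ψ, IsWeight ν (girsanovDensity ν (gradient f)) ψ := by
  obtain ⟨C, hb⟩ := hf.exists_isCb1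
  obtain ⟨J, hJ⟩ := hb.isItoIntegrand.exists_hasItoIntegral hν
  have hI := hJ.itoIntegral
  choose ψ hψ hφ using fun i => exists_hasL2DirDeriv hν hb i hI
  exact ⟨ψ, Real.measurable_exp.comp (measurable_logDensity hb hI.1), fun γ => Real.exp_pos _,
    hasMoments_exp_logDensity hν hb hI, hψ, hφ⟩

end

end WienerForm

end

/-! ### The main theorem -/

theorem mainTheorem5 {d : ℕ} [NeZero d]
    (ν : MeasureTheory.Measure (WienerForm.PathSpace d)) (hν : WienerForm.IsWienerMeasure ν)
    (lam : ℕ → ℝ) (hpos : ∀ i, 0 < lam i) (hmono : Monotone lam)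
    (f : WienerForm.E d → ℝ) (hf : WienerForm.IsCb2 f)
    (φ : WienerForm.PathSpace d → ℝ) (hφ : φ = WienerForm.girsanovDensity ν (gradient f))
    (μ : MeasureTheory.Measure (WienerForm.PathSpace d))
    (hμ : μ = WienerForm.weightedMeasure ν φ) :
    -- the stochastic integrals in the definition of `φ` and of `𝕊_i` exist
    WienerForm.HasItoIntegral ν (fun s γ => gradient f (WienerForm.pathAt γ s))
      (WienerForm.itoIntegral ν (fun s γ => gradient f (WienerForm.pathAt γ s))) ∧
    (∀ i, WienerForm.HasItoIntegral ν (fun s _ => WienerForm.haarVec d i s)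
      (WienerForm.wienerCoord ν i)) ∧
    -- the derivatives `∂_{S_i} φ` exist
    (∀ i, WienerForm.HasL2DirDeriv ν (WienerForm.schauder d i) φ
      (WienerForm.l2DirDeriv ν (WienerForm.schauder d i) φ)) ∧
    -- the form is closable, so that its closure and generator are well defined
    WienerForm.IsClosableForm lam μ ∧
    -- `Y ⊆ D(𝐀)` and the formula for `𝐀 F`
    ∀ F ∈ WienerForm.cylindrical d,
      F ∈ WienerForm.generatorDomain lam μ ∧
      ∀ᵐ γ ∂μ, HasSum
        (fun i => lam i *
          (WienerForm.dirDeriv (WienerForm.schauder d i)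
              (WienerForm.dirDeriv (WienerForm.schauder d i) F) γ
            + WienerForm.l2DirDeriv ν (WienerForm.schauder d i) φ γ *
                WienerForm.dirDeriv (WienerForm.schauder d i) F γ / φ γ
            - WienerForm.wienerCoord ν i γ * WienerForm.dirDeriv (WienerForm.schauder d i) F γ))
        (WienerForm.generator lam μ F γ) := by
  subst hφ hμ
  obtain ⟨C, hb⟩ := hf.exists_isCb1
  obtain ⟨J, hJ⟩ := hb.isItoIntegrand.exists_hasItoIntegral hν
  obtain ⟨ψ, hw⟩ := WienerForm.exists_isWeight_girsanovDensity hν hf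
  have hlam : ∀ i, 0 ≤ lam i := fun i => (hpos i).le
  refine ⟨hJ.itoIntegral, WienerForm.hasItoIntegral_wienerCoord hν,
    fun i => (hw.hasL2DirDeriv i).l2DirDeriv, hw.isClosableForm hν hlam, fun F hF => ?_⟩
  obtain ⟨n, hn⟩ := WienerForm.mem_cylindrical_iff.1 hF
  exact ⟨hw.mem_generatorDomain hν hlam hn, hw.hasSum_generator hν hlam hF⟩
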